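/- **Definitions.** A *signed tree model* is a triple $\mathcal T=(T,A,B)$ where $T$ is a rooted tree in which every internal node has exactly two children, and $A$ (anti-edges) and $B$ (edges) are disjoint sets of *transversal pairs*, i.e. unordered pairs of nodes of $T$ neither of which is an ancestor of the other, such that no two pairs of $A\cup B$ cross; here $u_1v_1$ and $u_2v_2$ *cross* if one of $u_1,v_1$ is a strict ancestor of one of $u_2,v_2$, and one of $u_2,v_2$ is a strict ancestor of one of $u_1,v_1$. A pair $u'v'\in A\cup B$ *covers* $u,v$ if $u'$ is an ancestor of $u$ and $v'$ an ancestor of $v$ (each node being its own ancestor), and there is no other pair $u''v''\in A\cup B$ with $u''$ between $u'$ and $u$ and $v''$ between $v'$ and $v$. $\mathcal T$ is a signed tree model *of* the graph $G$ if the leaves of $T$ are bijectively mapped to $V(G)$ and two vertices of $G$ are adjacent if and only if the pair of their leaves is covered by a pair of $B$. Algorithms are programs of a word RAM with $O(\log n)$-bit words, possibly with an instruction that draws a uniformly random word. Graphs are simple, undirected, unweighted, have $n\ge 1$ vertices and $m$ edges, and are given by adjacency lists. Solving *All-Pairs Shortest Path* means to output, for every vertex $u$, the distances from $u$ to all vertices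 and a shortest-path tree rooted at $u$ (unreachable vertices being marked as such). **Statement.** Let $\mathcal C$ be a class of unweighted graphs, and let $p$ and $T$ be two functions such that $n^2=O(T(n,m)+n\,p(n)\log_2 n)$ over the $n$-vertex $m$-edge graphs of $\mathcal C$ (that is, the time bound below is at least of the order of the size of the output). Suppose that there is a deterministic algorithm that, given an $n$-vertex $m$-edge graph $G\in\mathcal C$, outputs a signed tree model of $G$ with at most $p(n)$ transversal pairs, in time $O(T(n,m))$. Then there is a deterministic algorithm that solves All-Pairs Shortest Path on the $n$-vertex $m$-edge graphs of $\mathcal C$ in time $O(T(n,m)+n\cdot p(n)\log_2 n)$. The same holds with randomized algorithms in place of deterministic ones, in each of the following senses: 1. for all functions $\delta,\varepsilon$: on $n$-vertex graphs the algorithm halts with a correct output within the time bound except with probability at most $\delta(n)$, and halts with a correct output, in any time, except with probability at most $\varepsilon(n)$ (with the same $\delta$ and $\varepsilon$ in the hypothesis and in the conclusion); 2. the algorithm halts with a correct output almost surely, and its expected running time obeys the time bound. -/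

import Mathlib

open scoped ENNReal

noncomputable section

/-! ## Signed tree models -/

/-- A rooted tree on the set `ν` of nodes, given by its parent function; by convention the root is
its own parent. -/
structure ParentTree (ν : Type*) where
  root : ν
  parent : ν → ν
  parent_root : parent root = root
  reaches_root : ∀ x, ∃ k, parent^[k] x = root

namespace ParentTree

variable {ν : Type*} (T : ParentTree ν)

/-- `x` is an ancestor of `y` (every node is an ancestor of itself). -/
def Anc (x y : ν) : Prop := ∃ k, T.parent^[k] y = x

/-- `x` is a strict ancestor of `y`. -/
def SAnc (x y : ν) : Prop := T.Anc x y ∧ x ≠ y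

/-- The children of a node. -/
def children (x : ν) : Set ν := {y | y ≠ T.root ∧ T.parent y = x}

/-- A leaf is a node without children. -/
def IsLeaf (x : ν) : Prop := T.children x = ∅

/-- Every internal node has exactly two children. -/
def IsFullBinary : Prop := ∀ x, ¬ T.IsLeaf x → (T.children x).ncard = 2

/-- A transversal pair: neither node of the pair is an ancestor of the other. -/
def IsTransversal (e : Sym2 ν) : Prop := ∀ x y, e = s(x, y) → ¬ T.Anc x y ∧ ¬ T.Anc y x

/-- Two pairs cross if one node of the first is a strict ancestor of one node of the second, and
one node of the second is a strict ancestor of one node of the first. -/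
def Cross (e f : Sym2 ν) : Prop :=
  (∃ x ∈ e, ∃ y ∈ f, T.SAnc x y) ∧ (∃ y ∈ f, ∃ x ∈ e, T.SAnc y x)

/-- With respect to the set `P` of pairs, the pair `x'y'` covers `x, y`: it belongs to `P`,
`x'` is an ancestor of `x` and `y'` of `y`, and no other pair of `P` lies in between. -/
def Covers (P : Set (Sym2 ν)) (x' y' x y : ν) : Prop :=
  s(x', y') ∈ P ∧ T.Anc x' x ∧ T.Anc y' y ∧
    ∀ x'' y'', s(x'', y'') ∈ P → T.Anc x' x'' → T.Anc x'' x → T.Anc y' y'' → T.Anc y'' y →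
      s(x'', y'') = s(x', y')

theorem anc_total {x y z : ν} (hx : T.Anc x z) (hy : T.Anc y z) : T.Anc x y ∨ T.Anc y x := by
  obtain ⟨k, rfl⟩ := hx
  obtain ⟨l, rfl⟩ := hy
  rcases le_total k l with h | h
  · right
    exact ⟨l - k, by rw [← Function.iterate_add_apply, Nat.sub_add_cancel h]⟩
  · left
    exact ⟨k - l, by rw [← Function.iterate_add_apply, Nat.sub_add_cancel h]⟩

theorem Covers.symm {P : Set (Sym2 ν)} {x' y' x y : ν} (h : T.Covers P x' y' x y) :
    T.Covers P y' x' y x := by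
  obtain ⟨h1, h2, h3, h4⟩ := h
  refine ⟨by rwa [Sym2.eq_swap], h3, h2, ?_⟩
  intro x'' y'' hm a b c d
  rw [Sym2.eq_swap, h4 y'' x'' (by rwa [Sym2.eq_swap]) c d a b, Sym2.eq_swap]

end ParentTree

/-- A signed tree model with set of nodes `ν`, whose leaves are bijectively mapped to `V`. -/
structure SignedTreeModel (ν V : Type*) where
  tree : ParentTree ν
  fullBinary : tree.IsFullBinary
  /-- the leaf of each vertex -/
  leaf : V → ν
  leaf_injective : Function.Injective leaf
  range_leaf : Set.range leaf = {x | tree.IsLeaf x}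
  /-- the transversal anti-edges -/
  neg : Finset (Sym2 ν)
  /-- the transversal edges -/
  pos : Finset (Sym2 ν)
  disjoint : Disjoint neg pos
  transversal : ∀ e, e ∈ neg ∨ e ∈ pos → tree.IsTransversal e
  nonCrossing : ∀ e f, e ∈ neg ∨ e ∈ pos → f ∈ neg ∨ f ∈ pos → ¬ tree.Cross e f

namespace SignedTreeModel

variable {ν V : Type*} (M : SignedTreeModel ν V)

/-- The set of all transversal pairs of the model. -/
def pairs : Set (Sym2 ν) := {e | e ∈ M.neg ∨ e ∈ M.pos}

/-- The number of transversal pairs of the model. -/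
def numPairs : ℕ := M.neg.card + M.pos.card

/-- The graph of the model: two vertices are adjacent iff the pair of their leaves is covered by a
positive transversal pair. -/
def graph : SimpleGraph V where
  Adj u v := ∃ x y, s(x, y) ∈ M.pos ∧ M.tree.Covers M.pairs x y (M.leaf u) (M.leaf v)
  symm := ⟨fun u v ⟨x, y, hp, hc⟩ => ⟨y, x, by rwa [Sym2.eq_swap], hc.symm⟩⟩
  loopless := ⟨fun u ⟨x, y, hp, hc⟩ => by
    have ht := M.transversal _ (Or.inr hp) x y rfl
    rcases M.tree.anc_total hc.2.1 hc.2.2.1 with h | h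
    · exact ht.1 h
    · exact ht.2 h⟩

end SignedTreeModel

/-! ## Programs of a word RAM

A program has finitely many scalar variables and finitely many arrays, all named by natural
numbers. With words of `w` bits, every scalar and every array cell holds a word, i.e. a natural
number below `2 ^ w`, and arrays are indexed by words. -/

namespace WordRAM

/-- The binary operations on words. -/
inductive BinOp
  | add | sub | mul | div | mod | lt | eq | and | or | xor | shl | shr

/-- The value of an operation on `w`-bit words. Subtraction is truncated at `0`; the results of the
comparisons are `0` and `1`. -/
def BinOp.eval (w : ℕ) : BinOp → ℕ → ℕ → ℕ
  | add, a, b => (a + b) % 2 ^ w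
  | sub, a, b => a - b
  | mul, a, b => (a * b) % 2 ^ w
  | div, a, b => a / b
  | mod, a, b => a % b
  | lt, a, b => if a < b then 1 else 0
  | eq, a, b => if a = b then 1 else 0
  | and, a, b => a &&& b
  | or, a, b => a ||| b
  | xor, a, b => a ^^^ b
  | shl, a, b => (a <<< b) % 2 ^ w
  | shr, a, b => a >>> b

/-- Expressions: constants, scalar variables, array accesses and operations. -/
inductive Expr
  | const (c : ℕ)
  | var (x : ℕ)
  | get (a : ℕ) (i : Expr)
  | op (o : BinOp) (e₁ e₂ : Expr)

/-- The contents of the memory, and the number of random words drawn so far. -/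
structure State where
  var : ℕ → ℕ
  arr : ℕ → ℕ → ℕ
  drawn : ℕ

/-- The value of an expression. -/
def Expr.eval (w : ℕ) (s : State) : Expr → ℕ
  | const c => c % 2 ^ w
  | var x => s.var x
  | get a i => s.arr a (i.eval w s)
  | op o e₁ e₂ => o.eval w (e₁.eval w s) (e₂.eval w s)

/-- The number of steps that the evaluation of an expression takes: one for each constant,
variable, array access and operation. -/
def Expr.cost : Expr → ℕ
  | const _ => 1
  | var _ => 1
  | get _ i => i.cost + 1
  | op _ e₁ e₂ => e₁.cost + e₂.cost + 1

/-- Programs. -/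
inductive Prog
  | skip
  /-- `x := e` -/
  | assign (x : ℕ) (e : Expr)
  /-- `a[i] := e` -/
  | store (a : ℕ) (i e : Expr)
  /-- `x :=` a uniformly random word -/
  | rand (x : ℕ)
  | seq (P Q : Prog)
  /-- run `P` if `e ≠ 0`, and `Q` otherwise -/
  | ite (e : Expr) (P Q : Prog)
  /-- repeat `P` as long as `e ≠ 0` -/
  | while (e : Expr) (P : Prog)

/-- A program is deterministic if it has no random instruction. -/
def Prog.Deterministic : Prog → Prop
  | skip => True
  | assign _ _ => True
  | store _ _ _ => True
  | rand _ => False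
  | seq P Q => P.Deterministic ∧ Q.Deterministic
  | ite _ P Q => P.Deterministic ∧ Q.Deterministic
  | .while _ P => P.Deterministic

/-- Assignment to a scalar. -/
def State.setVar (s : State) (x v : ℕ) : State :=
  { s with var := Function.update s.var x v }

/-- Assignment to an array cell. -/
def State.setArr (s : State) (a i v : ℕ) : State :=
  { s with arr := Function.update s.arr a (Function.update (s.arr a) i v) }

/-- `Exec w ω P s t s'`: with words of `w` bits and the sequence `ω` of random words, the program
`P` started in `s` halts in the state `s'` after exactly `t` steps. -/
inductive Exec (w : ℕ) (ω : ℕ → Fin (2 ^ w)) : Prog → State → ℕ → State → Prop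
  | skip (s) : Exec w ω .skip s 1 s
  | assign (s x e) : Exec w ω (.assign x e) s (e.cost + 1) (s.setVar x (e.eval w s))
  | store (s a i e) :
      Exec w ω (.store a i e) s (i.cost + e.cost + 1) (s.setArr a (i.eval w s) (e.eval w s))
  | rand (s x) :
      Exec w ω (.rand x) s 1 { s.setVar x (ω s.drawn : ℕ) with drawn := s.drawn + 1 }
  | seq {P Q s t₁ s₁ t₂ s₂} : Exec w ω P s t₁ s₁ → Exec w ω Q s₁ t₂ s₂ →
      Exec w ω (.seq P Q) s (t₁ + t₂) s₂
  | ite_true {e P Q s t s₁} : e.eval w s ≠ 0 → Exec w ω P s t s₁ →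
      Exec w ω (.ite e P Q) s (e.cost + 1 + t) s₁
  | ite_false {e P Q s t s₁} : e.eval w s = 0 → Exec w ω Q s t s₁ →
      Exec w ω (.ite e P Q) s (e.cost + 1 + t) s₁
  | while_true {e P s t₁ s₁ t₂ s₂} : e.eval w s ≠ 0 → Exec w ω P s t₁ s₁ →
      Exec w ω (.while e P) s₁ t₂ s₂ → Exec w ω (.while e P) s (e.cost + 1 + t₁ + t₂) s₂
  | while_false {e P s} : e.eval w s = 0 → Exec w ω (.while e P) s (e.cost + 1) s

/-- The running time of a program; it is `∞` if the program does not halt. -/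
def runTime (w : ℕ) (ω : ℕ → Fin (2 ^ w)) (P : Prog) (s : State) : ℝ≥0∞ :=
  ⨅ (t : ℕ) (_ : ∃ s', Exec w ω P s t s'), (t : ℝ≥0∞)

/-- The law of a sequence of independent uniformly random `w`-bit words. -/
def randomWords (w : ℕ) : MeasureTheory.Measure (ℕ → Fin (2 ^ w)) :=
  MeasureTheory.Measure.infinitePi fun _ => (PMF.uniformOfFintype (Fin (2 ^ w))).toMeasure

end WordRAM

open WordRAM

/-! ## Graph problems -/

/-- A class of (labelled) finite graphs. -/
abbrev GraphClass := ∀ n : ℕ, SimpleGraph (Fin n) → Prop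

/-- A computational problem on graphs: the final memories that count as a correct answer. -/
abbrev GraphProblem := ∀ n : ℕ, SimpleGraph (Fin n) → State → Prop

/-- Adjacency lists of a graph: the neighbours of every vertex, in an arbitrary order. -/
structure AdjLists {n : ℕ} (G : SimpleGraph (Fin n)) where
  nbrs : Fin n → List (Fin n)
  nodup : ∀ u, (nbrs u).Nodup
  mem_nbrs : ∀ u v, v ∈ nbrs u ↔ G.Adj u v

/-- The number of edges. -/
def numEdges {n : ℕ} (G : SimpleGraph (Fin n)) : ℕ := G.edgeSet.ncard

/-- The initial memory on the input `G`, given by adjacency lists. The scalars `0` and `1` hold the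
numbers of vertices and of edges. The array `1` holds the concatenation of the lists of the vertices
`0, …, n - 1`, and the array `0` holds at each index `i ≤ n` the total length of the lists of the
vertices below `i`. Everything else is `0`. -/
def AdjLists.init {n : ℕ} {G : SimpleGraph (Fin n)} (L : AdjLists G) : State where
  var x := if x = 0 then n else if x = 1 then numEdges G else 0
  arr a i :=
    if a = 0 then
      if i ≤ n then ∑ u : Fin n, if (u : ℕ) < i then (L.nbrs u).length else 0 else 0
    else if a = 1 then (((List.finRange n).flatMap L.nbrs).map Fin.val).getD i 0
    else 0
  drawn := 0

/-- The memory `s` contains the signed tree model `M`, whose nodes are numbered `0, …, N - 1`: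
the scalars `0`, `1`, `2` hold the number of nodes, the root and the number of transversal pairs;
the array `0` holds the parent of each node, the array `1` the leaf of each vertex; the arrays `2`
and `3` hold the two nodes of each transversal pair, and the array `4` its sign (`1` for edges, `0`
for anti-edges). Every transversal pair is listed exactly once. -/
structure HoldsModel {n N : ℕ} (s : State) (M : SignedTreeModel (Fin N) (Fin n)) : Prop where
  num_nodes : s.var 0 = N
  root : s.var 1 = M.tree.root
  num_pairs : s.var 2 = M.numPairs
  parent : ∀ x : Fin N, s.arr 0 x = M.tree.parent x
  leaf : ∀ v : Fin n, s.arr 1 v = M.leaf v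
  listed : ∀ i < M.numPairs, ∃ x y : Fin N, s.arr 2 i = x ∧ s.arr 3 i = y ∧
    ((s(x, y) ∈ M.neg ∧ s.arr 4 i = 0) ∨ (s(x, y) ∈ M.pos ∧ s.arr 4 i = 1))
  complete : ∀ e, e ∈ M.neg ∨ e ∈ M.pos → ∃! i, i < M.numPairs ∧
    ∃ x y : Fin N, s.arr 2 i = x ∧ s.arr 3 i = y ∧ e = s(x, y)

/-- The problem of computing a signed tree model of the input graph with at most `p n` transversal
pairs. -/
def TreeModelProblem (p : ℕ → ℕ) : GraphProblem := fun n G s =>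
  ∃ (N : ℕ) (M : SignedTreeModel (Fin N) (Fin n)),
    M.graph = G ∧ M.numPairs ≤ p n ∧ HoldsModel s M

/-- All-Pairs Shortest Path. At the index `u * n + v`, the array `0` holds the distance from `u` to
`v`, and the array `1` holds the parent of `v` in a shortest-path tree rooted at `u`
(for `v = u`, it holds `u`). If `v` is not reachable from `u`, both hold `n`. -/
def APSP : GraphProblem := fun n G s => ∀ u v : Fin n,
  (G.Reachable u v → s.arr 0 (u * n + v) = G.dist u v) ∧
  (G.Reachable u v → u ≠ v → ∃ x : Fin n, s.arr 1 (u * n + v) = x ∧ G.Adj x v ∧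
    G.Reachable u x ∧ G.dist u x + 1 = G.dist u v) ∧
  (u = v → s.arr 1 (u * n + v) = u) ∧
  (¬ G.Reachable u v → s.arr 0 (u * n + v) = n ∧ s.arr 1 (u * n + v) = n)

/-! ## Algorithms

In all three notions the graphs have at least one vertex, the word length is any
`w ≥ k * log₂ (n + 2)` for some constant `k`, the time bound is `O(f n m)` for `n` vertices and `m`
edges, and the adjacency lists may come in any order. -/

/-- `P` is a deterministic algorithm that solves the problem `R` on the class `𝒞` in time
`O(f n m)`. -/
def SolvesDet (𝒞 : GraphClass) (R : GraphProblem) (f : ℕ → ℕ → ℝ) (P : Prog) : Prop :=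
  P.Deterministic ∧ ∃ k c : ℕ, ∀ n, 0 < n → ∀ G : SimpleGraph (Fin n), 𝒞 n G →
    ∀ L : AdjLists G, ∀ w, (n + 2) ^ k ≤ 2 ^ w → ∀ ω : ℕ → Fin (2 ^ w),
      ∃ t s', Exec w ω P L.init t s' ∧ R n G s' ∧ (t : ℝ) ≤ c * f n (numEdges G)

/-- `P` is a randomized algorithm for the problem `R` on the class `𝒞` that halts with a correct
answer in time `O(f n m)` except with probability at most `δ n`, and that halts with a correct
answer, in any time, except with probability at most `ε n`. -/
def SolvesRand (𝒞 : GraphClass) (R : GraphProblem) (f : ℕ → ℕ → ℝ) (δ ε : ℕ → ℝ≥0∞)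
    (P : Prog) : Prop :=
  ∃ k c : ℕ, ∀ n, 0 < n → ∀ G : SimpleGraph (Fin n), 𝒞 n G →
    ∀ L : AdjLists G, ∀ w, (n + 2) ^ k ≤ 2 ^ w →
      randomWords w {ω | ¬ ∃ t s', Exec w ω P L.init t s' ∧ R n G s' ∧
        (t : ℝ) ≤ c * f n (numEdges G)} ≤ δ n ∧
      randomWords w {ω | ¬ ∃ t s', Exec w ω P L.init t s' ∧ R n G s'} ≤ ε n

/-- `P` is a randomized algorithm that almost surely halts with a correct answer to the problem `R`
on the class `𝒞`, in expected time `O(f n m)`. -/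
def SolvesExpected (𝒞 : GraphClass) (R : GraphProblem) (f : ℕ → ℕ → ℝ) (P : Prog) : Prop :=
  ∃ k c : ℕ, ∀ n, 0 < n → ∀ G : SimpleGraph (Fin n), 𝒞 n G →
    ∀ L : AdjLists G, ∀ w, (n + 2) ^ k ≤ 2 ^ w →
      (∀ᵐ ω ∂(randomWords w), ∃ t s', Exec w ω P L.init t s' ∧ R n G s') ∧
      ∫⁻ ω, runTime w ω P L.init ∂(randomWords w) ≤ ENNReal.ofReal (c * f n (numEdges G))

end

/-! ### Word RAM: effect of assignments on the memory -/

noncomputable section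

namespace WordRAM

/-! Order the vertices as the leaves of the tree appear from left to right. The leaves below each
node then form an interval. Write the adjacency matrix in this order, and keep its rows as versions
of a persistent segment tree over `S = 2 ^ L` cells, `n ≤ S < 2 * n`: a subtree that is constantly
false, constantly true, or equal to the corresponding subtree of the preceding row is not stored
again.

The crux is that only `O(n + p(n) log n)` nodes are stored (`card_nodeSet_rowBit_le`). Let `u`, `u'`
be consecutive rows that differ somewhere on an interval `I`. Then some pair `zy` has `z` above
exactly one of `u`, `u'` and `y` above an element of `I`. If no such `y` separates elements of `I`,
then `y` is above all of `I`. As pairs do not cross, the pairs above `u'` and a given element of `I`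
are comparable with `zy`, and it follows that each of them lies above all of `I`; so the row of `u'`
is constant on `I` (`adj_const_of_not_separated`). Hence a new node is stored only where an end of
the interval of `z` lies between the two rows and an end of the interval of `y` lies in the interval
of the node. Each pair allows 8 such combinations, and a cell lies below `L + 1` nodes.

Breadth-first search from a source walks through the stored nodes instead of the edges of the graph.
A node that has been searched once never needs to be searched again for that source, because all
vertices below it have been found (`SearchNet.Inv`). A source therefore costs `O(n + p(n) log n)`,
and `IsTree.correct` turns the invariant at the end into distances and shortest-path trees.
Everything else takes `O(n ^ 2)` steps, which the hypothesis on the size of the output absorbs. The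
transversal pairs themselves are never read by the search: the rows come from the adjacency matrix,
and the pairs matter only for the count.

The matrix is saved under names that the given program does not use, so by `Exec.frame` that program
runs as before, with the same random words. For every fixed random sequence a correct run thus
extends to a correct run of the composed program with a deterministic overhead (`exec_apspProg`),
and this yields the deterministic and both randomized statements. -/

@[simp] theorem State.setVar_var (s : State) (x v y : ℕ) :
    (s.setVar x v).var y = if y = x then v else s.var y := by
  simp [State.setVar, Function.update_apply]

@[simp] theorem State.setVar_arr (s : State) (x v : ℕ) : (s.setVar x v).arr = s.arr := rfl

@[simp] theorem State.setArr_var (s : State) (a i v : ℕ) : (s.setArr a i v).var = s.var := rfl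

@[simp] theorem State.setArr_arr (s : State) (a i v b j : ℕ) :
    (s.setArr a i v).arr b j = if b = a ∧ j = i then v else s.arr b j := by
  by_cases h : b = a
  · subst h; simp [State.setArr, Function.update_apply]
  · simp [State.setArr, h]

theorem State.setArr_arr_ne (s : State) (a i v b : ℕ) (h : b ≠ a) :
    (s.setArr a i v).arr b = s.arr b := by
  funext j; simp [h]

/-! ### Executions are deterministic -/

theorem Exec.det {w : ℕ} {ω : ℕ → Fin (2 ^ w)} {P : Prog} {s : State} {t : ℕ} {s' : State}
    (h : Exec w ω P s t s') : ∀ {t₂ s₂}, Exec w ω P s t₂ s₂ → t = t₂ ∧ s' = s₂ := by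
  induction h with
  | skip s => rintro _ _ ⟨⟩; exact ⟨rfl, rfl⟩
  | assign s x e => rintro _ _ ⟨⟩; exact ⟨rfl, rfl⟩
  | store s a i e => rintro _ _ ⟨⟩; exact ⟨rfl, rfl⟩
  | rand s x => rintro _ _ ⟨⟩; exact ⟨rfl, rfl⟩
  | seq _ _ ih₁ ih₂ =>
    intro t₂ s₂ h
    cases h with
    | seq a b =>
      obtain ⟨rfl, rfl⟩ := ih₁ a
      obtain ⟨rfl, rfl⟩ := ih₂ b
      exact ⟨rfl, rfl⟩
  | ite_true hc _ ih =>
    intro t₂ s₂ h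
    cases h with
    | ite_true hc' a => obtain ⟨rfl, rfl⟩ := ih a; exact ⟨rfl, rfl⟩
    | ite_false hc' a => exact absurd hc' hc
  | ite_false hc _ ih =>
    intro t₂ s₂ h
    cases h with
    | ite_true hc' a => exact absurd hc hc'
    | ite_false hc' a => obtain ⟨rfl, rfl⟩ := ih a; exact ⟨rfl, rfl⟩
  | while_true hc _ _ ih₁ ih₂ =>
    intro t₂ s₂ h
    cases h with
    | while_true hc' a b =>
      obtain ⟨rfl, rfl⟩ := ih₁ a
      obtain ⟨rfl, rfl⟩ := ih₂ b
      exact ⟨rfl, rfl⟩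
    | while_false hc' => exact absurd hc' hc
  | while_false hc =>
    intro t₂ s₂ h
    cases h with
    | while_true hc' a b => exact absurd hc hc'
    | while_false hc' => exact ⟨rfl, rfl⟩

/-- By `Exec.det` the infimum runs over a single number of steps. Expected running times can then be
compared pointwise in `ω`. -/
theorem runTime_eq {w : ℕ} {ω : ℕ → Fin (2 ^ w)} {P : Prog} {s : State} {t : ℕ} {s' : State}
    (h : Exec w ω P s t s') : runTime w ω P s = t := by
  unfold runTime
  apply le_antisymm
  · exact iInf₂_le t ⟨s', h⟩
  · refine le_iInf₂ fun t₂ ⟨s₂, h₂⟩ => ?_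
    rw [(h.det h₂).1]

/-! ### Names used by a program -/

/-- A strict upper bound for the names occurring in an expression. -/
def Expr.bound : Expr → ℕ
  | const _ => 0
  | var x => x + 1
  | get a i => max (a + 1) i.bound
  | op _ e₁ e₂ => max e₁.bound e₂.bound

/-- A strict upper bound for the names occurring in a program. -/
def Prog.bound : Prog → ℕ
  | skip => 0
  | assign x e => max (x + 1) e.bound
  | store a i e => max (a + 1) (max i.bound e.bound)
  | rand x => x + 1
  | seq P Q => max P.bound Q.bound
  | ite e P Q => max e.bound (max P.bound Q.bound)
  | .while e P => max e.bound P.bound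

/-- The two states agree on all names below `B`. -/
def AgreeBelow (B : ℕ) (s s' : State) : Prop :=
  (∀ x < B, s.var x = s'.var x) ∧ (∀ a < B, s.arr a = s'.arr a) ∧ s.drawn = s'.drawn

/-- The two states agree on all names from `B` on. -/
def AgreeAbove (B : ℕ) (s s' : State) : Prop :=
  (∀ x, B ≤ x → s.var x = s'.var x) ∧ (∀ a, B ≤ a → s.arr a = s'.arr a)

theorem AgreeAbove.refl (B : ℕ) (s : State) : AgreeAbove B s s := ⟨fun _ _ => rfl, fun _ _ => rfl⟩

theorem AgreeAbove.trans {B : ℕ} {s₁ s₂ s₃ : State} (h : AgreeAbove B s₁ s₂)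
    (h' : AgreeAbove B s₂ s₃) : AgreeAbove B s₁ s₃ :=
  ⟨fun x hx => (h.1 x hx).trans (h'.1 x hx), fun x hx => (h.2 x hx).trans (h'.2 x hx)⟩

theorem Expr.eval_congr {w B : ℕ} {s s' : State} (h : AgreeBelow B s s') :
    ∀ {e : Expr}, e.bound ≤ B → e.eval w s = e.eval w s' := by
  intro e
  induction e with
  | const c => intro _; rfl
  | var x => intro he; exact h.1 x he
  | get a i ih =>
    intro he
    simp only [Expr.bound, max_le_iff] at he
    simp only [Expr.eval, ih he.2, h.2.1 a he.1]
  | op o e₁ e₂ ih₁ ih₂ =>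
    intro he
    simp only [Expr.bound, max_le_iff] at he
    simp only [Expr.eval, ih₁ he.1, ih₂ he.2]

theorem AgreeBelow.setVar {B : ℕ} {s s' : State} (h : AgreeBelow B s s') (x v : ℕ) :
    AgreeBelow B (s.setVar x v) (s'.setVar x v) := by
  refine ⟨fun y hy => ?_, h.2.1, h.2.2⟩
  simp [h.1 y hy]

theorem AgreeBelow.setArr {B : ℕ} {s s' : State} (h : AgreeBelow B s s') (a i v : ℕ) :
    AgreeBelow B (s.setArr a i v) (s'.setArr a i v) := by
  refine ⟨h.1, fun y hy => ?_, h.2.2⟩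
  funext j
  simp [h.2.1 y hy]

theorem agreeAbove_setVar {B : ℕ} (s : State) {x : ℕ} (v : ℕ) (hx : x + 1 ≤ B) :
    AgreeAbove B s (s.setVar x v) :=
  ⟨fun y hy => by simp [show y ≠ x by omega], fun _ _ => rfl⟩

theorem agreeAbove_setArr {B : ℕ} (s : State) {a : ℕ} (i v : ℕ) (ha : a + 1 ≤ B) :
    AgreeAbove B s (s.setArr a i v) :=
  ⟨fun _ _ => rfl, fun b hb => by rw [State.setArr_arr_ne]; omega⟩

/-- The names that do not occur in a program neither influence its execution nor are they
influenced by it. -/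
theorem Exec.frame {w B : ℕ} {ω : ℕ → Fin (2 ^ w)} {P : Prog} {s : State} {t : ℕ} {s' : State}
    (h : Exec w ω P s t s') : P.bound ≤ B → ∀ {r}, AgreeBelow B s r →
      ∃ r', Exec w ω P r t r' ∧ AgreeBelow B s' r' ∧ AgreeAbove B r r' := by
  induction h with
  | skip s => exact fun _ r hr => ⟨r, .skip r, hr, .refl B r⟩
  | assign s x e =>
    intro hb r hr
    simp only [Prog.bound, max_le_iff] at hb
    refine ⟨_, .assign r x e, ?_, agreeAbove_setVar _ _ hb.1⟩
    rw [Expr.eval_congr hr hb.2]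
    exact hr.setVar _ _
  | store s a i e =>
    intro hb r hr
    simp only [Prog.bound, max_le_iff] at hb
    refine ⟨_, .store r a i e, ?_, agreeAbove_setArr _ _ _ hb.1⟩
    rw [Expr.eval_congr hr hb.2.1, Expr.eval_congr hr hb.2.2]
    exact hr.setArr _ _ _
  | rand s x =>
    intro hb r hr
    refine ⟨_, .rand r x, ?_, agreeAbove_setVar r _ hb⟩
    -- Agreement includes the number of words drawn, so both runs receive the same random word.
    rw [← hr.2.2]
    have := hr.setVar x (ω s.drawn)
    exact ⟨this.1, this.2.1, rfl⟩
  | seq _ _ ih₁ ih₂ =>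
    intro hb r hr
    simp only [Prog.bound, max_le_iff] at hb
    obtain ⟨r₁, e₁, b₁, a₁⟩ := ih₁ hb.1 hr
    obtain ⟨r₂, e₂, b₂, a₂⟩ := ih₂ hb.2 b₁
    exact ⟨r₂, .seq e₁ e₂, b₂, a₁.trans a₂⟩
  | ite_true hc _ ih =>
    intro hb r hr
    simp only [Prog.bound, max_le_iff] at hb
    obtain ⟨r₁, e₁, b₁, a₁⟩ := ih hb.2.1 hr
    exact ⟨r₁, .ite_true (by rwa [← Expr.eval_congr hr hb.1]) e₁, b₁, a₁⟩
  | ite_false hc _ ih =>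
    intro hb r hr
    simp only [Prog.bound, max_le_iff] at hb
    obtain ⟨r₁, e₁, b₁, a₁⟩ := ih hb.2.2 hr
    exact ⟨r₁, .ite_false (by rwa [← Expr.eval_congr hr hb.1]) e₁, b₁, a₁⟩
  | while_true hc _ _ ih₁ ih₂ =>
    intro hb r hr
    have hb' := hb
    simp only [Prog.bound, max_le_iff] at hb
    obtain ⟨r₁, e₁, b₁, a₁⟩ := ih₁ hb.2 hr
    obtain ⟨r₂, e₂, b₂, a₂⟩ := ih₂ hb' b₁
    exact ⟨r₂, .while_true (by rwa [← Expr.eval_congr hr hb.1]) e₁ e₂, b₂, a₁.trans a₂⟩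
  | while_false hc =>
    intro hb r hr
    simp only [Prog.bound, max_le_iff] at hb
    exact ⟨r, .while_false (by rwa [← Expr.eval_congr hr hb.1]), hr, .refl B r⟩

/-! ### Program logic -/

/-- The program `P` started in `s` halts, and the final state and the number of steps satisfy
`R`. -/
def Run (w : ℕ) (ω : ℕ → Fin (2 ^ w)) (P : Prog) (s : State) (R : State → ℕ → Prop) : Prop :=
  ∃ t s', Exec w ω P s t s' ∧ R s' t

section Run

variable {w : ℕ} {ω : ℕ → Fin (2 ^ w)} {s : State} {R : State → ℕ → Prop}

theorem Run.mono {P : Prog} {R' : State → ℕ → Prop} (h : Run w ω P s R)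
    (hR : ∀ s' t, R s' t → R' s' t) : Run w ω P s R' :=
  let ⟨t, s', e, r⟩ := h
  ⟨t, s', e, hR s' t r⟩

theorem Run.skip (h : R s 1) : Run w ω .skip s R := ⟨_, _, .skip s, h⟩

theorem Run.assign {x : ℕ} {e : Expr} {v : ℕ} (he : e.eval w s = v)
    (h : R (s.setVar x v) (e.cost + 1)) : Run w ω (.assign x e) s R :=
  ⟨_, _, .assign s x e, by rwa [he]⟩

theorem Run.store {a : ℕ} {i e : Expr} {j v : ℕ} (hi : i.eval w s = j) (he : e.eval w s = v)
    (h : R (s.setArr a j v) (i.cost + e.cost + 1)) : Run w ω (.store a i e) s R :=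
  ⟨_, _, .store s a i e, by rwa [hi, he]⟩

theorem Run.seq {P Q : Prog}
    (h : Run w ω P s fun s₁ t₁ => Run w ω Q s₁ fun s₂ t₂ => R s₂ (t₁ + t₂)) :
    Run w ω (.seq P Q) s R :=
  let ⟨_, _, e₁, _, _, e₂, r⟩ := h
  ⟨_, _, .seq e₁ e₂, r⟩

theorem Run.ite {e : Expr} {P Q : Prog}
    (h₁ : e.eval w s ≠ 0 → Run w ω P s fun s' t => R s' (e.cost + 1 + t))
    (h₂ : e.eval w s = 0 → Run w ω Q s fun s' t => R s' (e.cost + 1 + t)) :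
    Run w ω (.ite e P Q) s R := by
  by_cases hc : e.eval w s = 0
  · obtain ⟨t, s', e₁, r⟩ := h₂ hc
    exact ⟨_, _, .ite_false hc e₁, r⟩
  · obtain ⟨t, s', e₁, r⟩ := h₁ hc
    exact ⟨_, _, .ite_true hc e₁, r⟩

/-- The rule for loops: `Φ` is a potential that pays for all steps. -/
theorem Run.while {e : Expr} {P : Prog} (Inv : State → Prop) (Φ : State → ℕ)
    (h : ∀ s, Inv s → e.eval w s ≠ 0 →
      Run w ω P s fun s' t => Inv s' ∧ e.cost + 1 + t + Φ s' ≤ Φ s)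
    (h₀ : Inv s) :
    Run w ω (.while e P) s fun s' t =>
      Inv s' ∧ e.eval w s' = 0 ∧ t + Φ s' ≤ Φ s + (e.cost + 1) := by
  induction hn : Φ s using Nat.strong_induction_on generalizing s with
  | _ k ih =>
    by_cases hc : e.eval w s = 0
    · exact ⟨_, _, .while_false hc, h₀, hc, by omega⟩
    · obtain ⟨t, s', e₁, i₁, l₁⟩ := h s h₀ hc
      -- Testing the condition costs at least one step, so the potential strictly decreases and the
      -- induction is well-founded.
      obtain ⟨t₂, s₂, e₂, i₂, c₂, l₂⟩ := ih (Φ s') (by omega) i₁ rfl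
      exact ⟨_, _, .while_true hc e₁ e₂, i₂, c₂, by omega⟩

end Run

/-! ### Counting loops -/

/-- `for I = 0, …, eM - 1 do P`; the scalar `J` holds the bound. -/
def forLoop (I J : ℕ) (eM : Expr) (P : Prog) : Prog :=
  .seq (.assign J eM) (.seq (.assign I (.const 0))
    (.while (.op .lt (.var I) (.var J))
      (.seq P (.assign I (.op .add (.var I) (.const 1))))))

/-- The bound is evaluated once, so its cost is no part of a round. The invariant refers to the
moment of the test, which is why the body has to establish it for the state after the increment. -/
theorem Run.forLoop {w : ℕ} {ω : ℕ → Fin (2 ^ w)} {s : State} {I J : ℕ} {eM : Expr} {P : Prog}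
    (M c : ℕ) (Inv : ℕ → State → Prop) (hM : eM.eval w s = M) (hMw : M < 2 ^ w)
    (h0 : Inv 0 ((s.setVar J M).setVar I 0))
    (hvar : ∀ k s, Inv k s → s.var I = k ∧ s.var J = M)
    (hstep : ∀ k < M, ∀ s, Inv k s →
      Run w ω P s fun s' t => t ≤ c ∧ s'.var I = k ∧ Inv (k + 1) (s'.setVar I (k + 1))) :
    Run w ω (forLoop I J eM P) s fun s' t => Inv M s' ∧ t ≤ (M + 1) * (c + eM.cost + 20) := by
  refine Run.seq (Run.assign hM (Run.seq (Run.assign (v := 0) (by simp [Expr.eval]) ?_)))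
  -- In each round 4 steps go to the test and 4 to the increment, besides at most `c` for the body.
  refine (Run.while (fun s => ∃ k ≤ M, Inv k s) (fun s => (M - s.var I) * (c + 8)) ?_
    ⟨0, Nat.zero_le _, h0⟩).mono ?_
  · rintro s ⟨k, hk, hs⟩ hc
    obtain ⟨hI, hJ⟩ := hvar k s hs
    have hkM : k < M := by
      by_contra hcon
      simp [Expr.eval, BinOp.eval, hI, hJ, hcon] at hc
    refine Run.seq ((hstep k hkM s hs).mono ?_)
    rintro s' t ⟨ht, hk', hs'⟩
    have h1 : 1 % 2 ^ w = 1 := Nat.mod_eq_of_lt (by omega)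
    refine Run.assign (v := k + 1) ?_ ⟨⟨k + 1, hkM, hs'⟩, ?_⟩
    · simp only [Expr.eval, BinOp.eval, hk', h1]
      exact Nat.mod_eq_of_lt (by omega)
    · simp only [Expr.cost, State.setVar_var, if_true, hI]
      have : M - k = (M - (k + 1)) + 1 := by omega
      rw [this, add_mul]
      omega
  · rintro s' t ⟨⟨k, hk, hs⟩, hc, ht⟩
    obtain ⟨hI, hJ⟩ := hvar k s' hs
    have hkM : k = M := by
      by_contra hcon
      have : k < M := by omega
      simp [Expr.eval, BinOp.eval, hI, hJ, this] at hc
    subst hkM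
    refine ⟨hs, ?_⟩
    simp only [Expr.cost, State.setVar_var, if_true, Nat.sub_zero] at ht ⊢
    nlinarith

/-- The states `s` and `s'` differ at most in the scalars `I`, `J` and in the array `a`. -/
def SameExcept (I J a : ℕ) (s s' : State) : Prop :=
  (∀ x, x ≠ I → x ≠ J → s'.var x = s.var x) ∧ (∀ b, b ≠ a → s'.arr b = s.arr b) ∧
    s'.drawn = s.drawn

/-- `for I = 0, …, eM - 1 do a[I] := e` -/
def tab (I J a : ℕ) (eM e : Expr) : Prog := forLoop I J eM (.store a (.var I) e)

/-- When entry `k` is computed, the entries below `k` may be read. This admits tables filled by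
recursion, such as the iterated parents and the names of the segment tree nodes. -/
theorem Run.tab {w : ℕ} {ω : ℕ → Fin (2 ^ w)} {s : State} {I J a : ℕ} {eM e : Expr} (hIJ : I ≠ J)
    (M : ℕ) (f : ℕ → ℕ) (hM : eM.eval w s = M) (hMw : M < 2 ^ w)
    (he : ∀ k < M, ∀ s', SameExcept I J a s s' → s'.var I = k → (∀ j < k, s'.arr a j = f j) →
      e.eval w s' = f k) :
    Run w ω (tab I J a eM e) s fun s' t => SameExcept I J a s s' ∧ (∀ k < M, s'.arr a k = f k) ∧
      t ≤ (M + 1) * (eM.cost + e.cost + 22) := by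
  refine (Run.forLoop M (e.cost + 2) (fun k s' => SameExcept I J a s s' ∧ s'.var I = k ∧
    s'.var J = M ∧ ∀ j < k, s'.arr a j = f j) hM hMw ?_ ?_ ?_).mono ?_
  · refine ⟨⟨?_, ?_, rfl⟩, ?_⟩ <;> simp +contextual [hIJ.symm]
  · exact fun k s h => ⟨h.2.1, h.2.2.1⟩
  · rintro k hk s' ⟨hs, hI, hJ, hf⟩
    refine Run.store (j := k) hI (he k hk s' hs hI hf) ⟨?_, hI, ⟨?_, ?_, hs.2.2⟩, ?_, ?_, ?_⟩
    · simp only [Expr.cost]; omega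
    · intro x h1 h2; simp [h1, hs.1 x h1 h2]
    · intro b hb
      rw [State.setVar_arr, State.setArr_arr_ne _ _ _ _ _ hb, hs.2.1 b hb]
    · simp
    · simp [hIJ.symm, hJ]
    · intro j hj
      simp only [State.setVar_arr, State.setArr_arr, true_and]
      split_ifs with h
      · rw [h]
      · exact hf j (by omega)
  · rintro s' t ⟨⟨hs, _, _, hf⟩, ht⟩
    exact ⟨hs, hf, ht.trans (Nat.mul_le_mul_left _ (by omega))⟩

/-- `for I = 0, …, eM - 1 do a[el] += e` -/
def scatter (I J a : ℕ) (eM el e : Expr) : Prog :=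
  forLoop I J eM (.store a el (.op .add (.get a el) e))

/-- It suffices to bound the final totals: partial sums of natural numbers are no larger, so no
addition overflows on the way. -/
theorem Run.scatter {w : ℕ} {ω : ℕ → Fin (2 ^ w)} {s : State} {I J a : ℕ} {eM el e : Expr}
    (hIJ : I ≠ J) (M : ℕ) (l f : ℕ → ℕ) (hM : eM.eval w s = M) (hMw : M < 2 ^ w)
    (he : ∀ k < M, ∀ s', SameExcept I J a s s' → s'.var I = k →
      el.eval w s' = l k ∧ e.eval w s' = f k)
    (hb : ∀ k < M, s.arr a (l k) + ∑ j ∈ Finset.range M with l j = l k, f j < 2 ^ w) :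
    Run w ω (scatter I J a eM el e) s fun s' t => SameExcept I J a s s' ∧
      (∀ y, s'.arr a y = s.arr a y + ∑ j ∈ Finset.range M with l j = y, f j) ∧
      t ≤ (M + 1) * (eM.cost + 2 * el.cost + e.cost + 24) := by
  refine (Run.forLoop M (2 * el.cost + e.cost + 4) (fun k s' => SameExcept I J a s s' ∧
    s'.var I = k ∧ s'.var J = M ∧
    ∀ y, s'.arr a y = s.arr a y + ∑ j ∈ Finset.range k with l j = y, f j) hM hMw ?_ ?_ ?_).mono ?_
  · refine ⟨⟨?_, ?_, rfl⟩, ?_⟩ <;> simp +contextual [hIJ.symm]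
  · exact fun k s h => ⟨h.2.1, h.2.2.1⟩
  · rintro k hk s' ⟨hs, hI, hJ, hf⟩
    obtain ⟨h1, h2⟩ := he k hk s' hs hI
    have hsum : ∀ y, ∑ j ∈ Finset.range (k + 1) with l j = y, f j =
        (∑ j ∈ Finset.range k with l j = y, f j) + if l k = y then f k else 0 := by
      intro y
      rw [Finset.sum_filter, Finset.sum_range_succ, Finset.sum_filter]
    refine Run.store (j := l k) (v := s'.arr a (l k) + f k) h1 ?_
      ⟨?_, hI, ⟨?_, ?_, hs.2.2⟩, ?_, ?_, ?_⟩
    · simp only [Expr.eval, BinOp.eval, h1, h2]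
      refine Nat.mod_eq_of_lt (lt_of_le_of_lt ?_ (hb k hk))
      have h3 : ∑ j ∈ Finset.range (k + 1) with l j = l k, f j ≤
          ∑ j ∈ Finset.range M with l j = l k, f j :=
        Finset.sum_le_sum_of_subset (Finset.filter_subset_filter _
          (Finset.range_subset_range.2 hk))
      rw [hsum, if_pos rfl] at h3
      rw [hf]
      omega
    · simp only [Expr.cost]; omega
    · intro x h1 h2; simp [h1, hs.1 x h1 h2]
    · intro b hb
      rw [State.setVar_arr, State.setArr_arr_ne _ _ _ _ _ hb, hs.2.1 b hb]
    · simp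
    · simp [hIJ.symm, hJ]
    · intro y
      simp only [State.setVar_arr, State.setArr_arr, true_and]
      rw [hsum]
      split_ifs with h h' h'
      · rw [h, hf]; omega
      · exact absurd h.symm h'
      · exact absurd h'.symm h
      · rw [hf]; rfl
  · rintro s' t ⟨⟨hs, _, _, hf⟩, ht⟩
    exact ⟨hs, hf, ht.trans (Nat.mul_le_mul_left _ (by omega))⟩

/-! ### Conditional expressions -/

namespace Expr

/-- The expression with value `a` if `c` is `1`, and `b` if `c` is `0`. -/
def sel (c a b : Expr) : Expr :=
  .op .add (.op .mul c a) (.op .mul (.op .sub (.const 1) c) b)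

/-- The branch not taken is evaluated too, but it is multiplied by `0`. Hence nothing has to be
known about its value, and each branch is described only under its own condition. -/
theorem eval_sel {w : ℕ} {s : State} {c a b : Expr} {p : Prop} [Decidable p] {x y : ℕ}
    (hw : 1 < 2 ^ w) (hc : c.eval w s = if p then 1 else 0) (ha : p → a.eval w s = x)
    (hb : ¬ p → b.eval w s = y) (hx : p → x < 2 ^ w) (hy : ¬ p → y < 2 ^ w) :
    (sel c a b).eval w s = if p then x else y := by
  by_cases h : p
  · simp [sel, Expr.eval, BinOp.eval, hc, h, ha h, Nat.mod_eq_of_lt hw, Nat.mod_eq_of_lt (hx h)]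
  · simp [sel, Expr.eval, BinOp.eval, hc, h, hb h, Nat.mod_eq_of_lt hw, Nat.mod_eq_of_lt (hy h)]

theorem eval_lt {w : ℕ} {s : State} {a b : Expr} {x y : ℕ} (ha : a.eval w s = x)
    (hb : b.eval w s = y) : (op .lt a b).eval w s = if x < y then 1 else 0 := by
  simp [Expr.eval, BinOp.eval, ha, hb]

theorem eval_eq {w : ℕ} {s : State} {a b : Expr} {x y : ℕ} (ha : a.eval w s = x)
    (hb : b.eval w s = y) : (op .eq a b).eval w s = if x = y then 1 else 0 := by
  simp [Expr.eval, BinOp.eval, ha, hb]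

theorem eval_and {w : ℕ} {s : State} {a b : Expr} {p q : Prop} [Decidable p] [Decidable q]
    (ha : a.eval w s = if p then 1 else 0) (hb : b.eval w s = if q then 1 else 0) :
    (op .and a b).eval w s = if p ∧ q then 1 else 0 := by
  by_cases hp : p <;> by_cases hq : q <;> simp [Expr.eval, BinOp.eval, ha, hb, hp, hq]

theorem eval_not {w : ℕ} {s : State} {a : Expr} {p : Prop} [Decidable p]
    (ha : a.eval w s = if p then 1 else 0) :
    (op .eq a (const 0)).eval w s = if ¬ p then 1 else 0 := by
  by_cases hp : p <;> simp [Expr.eval, BinOp.eval, ha, hp]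

theorem eval_const {w : ℕ} {s : State} {c : ℕ} (h : c < 2 ^ w) : (const c).eval w s = c :=
  Nat.mod_eq_of_lt h

theorem eval_var {w : ℕ} {s : State} {x v : ℕ} (h : s.var x = v) : (var x).eval w s = v := h

theorem eval_get {w : ℕ} {s : State} {a : ℕ} {i : Expr} {j v : ℕ} (hi : i.eval w s = j)
    (h : s.arr a j = v) : (get a i).eval w s = v := by
  rw [Expr.eval, hi, h]

theorem eval_add {w : ℕ} {s : State} {a b : Expr} {x y : ℕ} (ha : a.eval w s = x)
    (hb : b.eval w s = y) (h : x + y < 2 ^ w) : (op .add a b).eval w s = x + y := by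
  simp [Expr.eval, BinOp.eval, ha, hb, Nat.mod_eq_of_lt h]

theorem eval_mul {w : ℕ} {s : State} {a b : Expr} {x y : ℕ} (ha : a.eval w s = x)
    (hb : b.eval w s = y) (h : x * y < 2 ^ w) : (op .mul a b).eval w s = x * y := by
  simp [Expr.eval, BinOp.eval, ha, hb, Nat.mod_eq_of_lt h]

theorem eval_sub {w : ℕ} {s : State} {a b : Expr} {x y : ℕ} (ha : a.eval w s = x)
    (hb : b.eval w s = y) : (op .sub a b).eval w s = x - y := by
  simp [Expr.eval, BinOp.eval, ha, hb]

theorem eval_div {w : ℕ} {s : State} {a b : Expr} {x y : ℕ} (ha : a.eval w s = x)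
    (hb : b.eval w s = y) : (op .div a b).eval w s = x / y := by
  simp [Expr.eval, BinOp.eval, ha, hb]

theorem eval_mod {w : ℕ} {s : State} {a b : Expr} {x y : ℕ} (ha : a.eval w s = x)
    (hb : b.eval w s = y) : (op .mod a b).eval w s = x % y := by
  simp [Expr.eval, BinOp.eval, ha, hb]

end Expr

end WordRAM

end

/-! ### Rooted trees: every node gets an interval, nested along ancestors -/

noncomputable section

section

open Finset

namespace ParentTree

section Basic

variable {ν : Type*} (T : ParentTree ν)

theorem iterate_root (k : ℕ) : T.parent^[k] T.root = T.root := by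
  induction k with
  | zero => rfl
  | succ k ih => rw [Function.iterate_succ_apply, T.parent_root, ih]

theorem anc_refl (x : ν) : T.Anc x x := ⟨0, rfl⟩

variable {T}

theorem Anc.trans {x y z : ν} (h : T.Anc x y) (h' : T.Anc y z) : T.Anc x z := by
  obtain ⟨k, rfl⟩ := h
  obtain ⟨l, rfl⟩ := h'
  exact ⟨k + l, Function.iterate_add_apply _ _ _ _⟩

theorem anc_parent (x : ν) : T.Anc (T.parent x) x := ⟨1, rfl⟩

theorem root_anc (x : ν) : T.Anc T.root x := T.reaches_root x

/-- If the root is reached after `m` steps, going `m` times around the cycle takes `k * m ≥ m`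
steps, so it ends at the root, where the iteration stays. -/
theorem eq_root_of_iterate {x : ν} {k : ℕ} (hk : 0 < k) (h : T.parent^[k] x = x) : x = T.root := by
  obtain ⟨m, hm⟩ := T.reaches_root x
  have h1 : ∀ j, T.parent^[k * j] x = x := by
    intro j
    induction j with
    | zero => rfl
    | succ j ih => rw [Nat.mul_succ, Function.iterate_add_apply, h, ih]
  obtain ⟨d, hd⟩ := Nat.exists_eq_add_of_le (Nat.le_mul_of_pos_left m hk)
  have := h1 m
  rw [hd, add_comm, Function.iterate_add_apply, hm, T.iterate_root] at this
  exact this.symm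

theorem Anc.antisymm {x y : ν} (h : T.Anc x y) (h' : T.Anc y x) : x = y := by
  obtain ⟨k, rfl⟩ := h
  obtain ⟨l, hl⟩ := h'
  rw [← Function.iterate_add_apply] at hl
  rcases Nat.eq_zero_or_pos (l + k) with h0 | h0
  · have : k = 0 := by omega
    subst this; rfl
  · rw [eq_root_of_iterate h0 hl, T.iterate_root]

/-- An ancestor of `y` other than `y` is an ancestor of the parent of `y`. -/
theorem Anc.parent_of_ne {x y : ν} (h : T.Anc x y) (hne : x ≠ y) : T.Anc x (T.parent y) := by
  obtain ⟨k, rfl⟩ := h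
  cases k with
  | zero => exact absurd rfl hne
  | succ k => exact ⟨k, rfl⟩

/-- The root has to be excluded because it is its own parent; any other node that is met twice would
lie on a cycle. -/
theorem iterate_inj {x y : ν} {k l : ℕ} (hx : T.parent^[k] x = y) (hy : T.parent^[l] x = y)
    (hne : y ≠ T.root) : k = l := by
  wlog h : k ≤ l generalizing k l
  · exact (this hy hx (by omega)).symm
  obtain ⟨d, rfl⟩ := Nat.exists_eq_add_of_le h
  rcases Nat.eq_zero_or_pos d with rfl | hd
  · rfl
  · rw [add_comm, Function.iterate_add_apply, hx] at hy
    exact absurd (eq_root_of_iterate hd hy) hne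

/-- Two incomparable nodes lie below two distinct siblings. -/
theorem exists_siblings {x y : ν} (h : ¬ T.Anc x y) (h' : ¬ T.Anc y x) :
    ∃ a b, T.Anc a x ∧ T.Anc b y ∧ a ≠ b ∧ a ≠ T.root ∧ b ≠ T.root ∧ T.parent a = T.parent b := by
  classical
  have hex : ∃ k, T.Anc (T.parent^[k] x) y := by
    obtain ⟨k, hk⟩ := T.reaches_root x
    exact ⟨k, hk ▸ root_anc y⟩
  -- Minimality of `k` makes this the lowest common ancestor. The siblings are the last nodes before
  -- it on the paths from `x` and from `y`.
  obtain ⟨k, hk, hmin⟩ := Nat.findX hex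
  cases k with
  | zero => exact absurd hk h
  | succ k =>
    have ha := hmin k (Nat.lt_succ_self k)
    obtain ⟨l, hl, hlmin⟩ := Nat.findX (p := fun l => T.parent^[l] y = T.parent^[k + 1] x) hk
    cases l with
    | zero => exact absurd ⟨k + 1, hl.symm⟩ h'
    | succ l =>
      have hb := hlmin l (Nat.lt_succ_self l)
      refine ⟨T.parent^[k] x, T.parent^[l] y, ⟨k, rfl⟩, ⟨l, rfl⟩, ?_, ?_, ?_, ?_⟩
      · intro he; exact ha ⟨l, he.symm⟩
      · intro he; exact ha (he ▸ root_anc y)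
      · intro he
        apply hb
        rw [← hl, Function.iterate_succ_apply', he, T.parent_root]
      · rw [← Function.iterate_succ_apply' T.parent l,
          ← Function.iterate_succ_apply' T.parent k, hl]

end Basic

section Fin

variable {N : ℕ} {T : ParentTree (Fin N)}

/-- The iterates up to the first visit of the root are distinct, so there are at most `N` of them.
This uniform height bound allows all paths to be stored in one table. -/
theorem iterate_card (x : Fin N) : T.parent^[N] x = T.root := by
  obtain ⟨m, hm, hmin⟩ := Nat.findX (T.reaches_root x)
  have hinj : Function.Injective fun j : Fin (m + 1) => T.parent^[(j : ℕ)] x := by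
    intro i j hij
    by_contra hne
    wlog h : i < j generalizing i j
    · exact this hij.symm (fun h => hne h.symm) (by omega)
    -- Cutting out the repetition between `i` and `j` would reach the root earlier.
    refine hmin (m - j + i) (by omega) ?_
    simp only at hij
    rw [Function.iterate_add_apply, hij, ← Function.iterate_add_apply,
      Nat.sub_add_cancel (by omega), hm]
  have := Fintype.card_le_of_injective _ hinj
  simp only [Fintype.card_fin] at this
  obtain ⟨d, hd⟩ := Nat.exists_eq_add_of_le' (show m ≤ N by omega)
  have h : T.parent^[d + m] x = T.root := by
    rw [Function.iterate_add_apply, hm, T.iterate_root]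
  rwa [← hd] at h

variable (T) (wt : Fin N → ℕ)

/-- The total weight of the siblings of `y` with a smaller number. -/
def sibSum (y : Fin N) : ℕ :=
  ∑ b, if T.parent b = T.parent y ∧ b < y ∧ b ≠ T.root ∧ y ≠ T.root then wt b else 0

/-- The total weight of the nodes to the left of the path from `x` to the root. -/
def offset (x : Fin N) : ℕ := ∑ k ∈ range N, T.sibSum wt (T.parent^[k] x)

theorem sibSum_root : T.sibSum wt T.root = 0 := by simp [sibSum]

/-- Shifting the sum along the path drops its last term only, and that term belongs to the root,
where it vanishes. -/
theorem offset_eq (x : Fin N) : T.offset wt x = T.sibSum wt x + T.offset wt (T.parent x) := by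
  have h := sum_range_succ' (fun k => T.sibSum wt (T.parent^[k] x)) N
  rw [sum_range_succ, iterate_card, sibSum_root] at h
  simp only [Function.iterate_succ_apply, Function.iterate_zero, id] at h
  unfold offset
  omega

theorem offset_root : T.offset wt T.root = 0 := by
  simp [offset, iterate_root, sibSum_root]

variable {wt}

/-- The node and its smaller siblings are distinct children of one parent, so the parent's weight
dominates their sum. -/
theorem sibSum_add_le (hwt : ∀ x, ∑ c with c ≠ T.root ∧ T.parent c = x, wt c ≤ wt x)
    {c : Fin N} (hc : c ≠ T.root) : T.sibSum wt c + wt c ≤ wt (T.parent c) := by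
  refine le_trans ?_ (hwt (T.parent c))
  rw [sibSum, ← sum_filter, add_comm, ← sum_insert (by simp)]
  refine sum_le_sum_of_subset fun b => ?_
  simp only [mem_insert, mem_filter, mem_univ, true_and]
  rintro (rfl | h)
  · exact ⟨hc, rfl⟩
  · exact ⟨h.2.2.1, h.1⟩

theorem offset_sibling {b c : Fin N} (hb : b ≠ T.root) (hc : c ≠ T.root)
    (hp : T.parent b = T.parent c) (hlt : b < c) :
    T.offset wt b + wt b ≤ T.offset wt c := by
  rw [T.offset_eq wt b, T.offset_eq wt c, hp]
  have : T.sibSum wt b + wt b ≤ T.sibSum wt c := by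
    rw [sibSum, sibSum, ← sum_filter, ← sum_filter, add_comm, ← sum_insert (by simp)]
    refine sum_le_sum_of_subset fun a => ?_
    simp only [mem_insert, mem_filter, mem_univ, true_and]
    rintro (rfl | h)
    · exact ⟨hp, hlt, hb, hc⟩
    · exact ⟨h.1.trans hp, h.2.1.trans hlt, h.2.2.1, hc⟩
  omega

/-- Nesting of the intervals `[offset, offset + wt)`: a child's interval begins after those of its
smaller siblings and, by `sibSum_add_le`, ends within that of the parent. -/
theorem offset_anc (hwt : ∀ x, ∑ c with c ≠ T.root ∧ T.parent c = x, wt c ≤ wt x)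
    {x y : Fin N} (h : T.Anc x y) :
    T.offset wt x ≤ T.offset wt y ∧ T.offset wt y + wt y ≤ T.offset wt x + wt x := by
  obtain ⟨k, rfl⟩ := h
  induction k with
  | zero => exact ⟨le_rfl, le_rfl⟩
  | succ k ih =>
    rw [Function.iterate_succ_apply']
    set z := T.parent^[k] y
    by_cases hz : z = T.root
    · rw [hz, T.parent_root, ← hz]; exact ih
    · have h1 := T.offset_eq wt z
      have h2 := T.sibSum_add_le hwt hz
      omega

/-- Incomparable nodes lie below distinct siblings. Their intervals are disjoint by
`offset_sibling`, and nesting passes this down. -/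
theorem offset_disjoint (hwt : ∀ x, ∑ c with c ≠ T.root ∧ T.parent c = x, wt c ≤ wt x)
    {x y : Fin N} (h : ¬ T.Anc x y) (h' : ¬ T.Anc y x) :
    T.offset wt x + wt x ≤ T.offset wt y ∨ T.offset wt y + wt y ≤ T.offset wt x := by
  obtain ⟨a, b, ha, hb, hne, har, hbr, hp⟩ := exists_siblings h h'
  have h1 := T.offset_anc hwt ha
  have h2 := T.offset_anc hwt hb
  rcases lt_or_gt_of_ne hne with hlt | hlt
  · have := T.offset_sibling (wt := wt) har hbr hp hlt
    omega
  · have := T.offset_sibling (wt := wt) hbr har hp.symm hlt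
    omega

end Fin

end ParentTree

/-! ### The left-to-right order of the vertices -/

namespace SignedTreeModel

open Classical in
/-- The number of vertices whose leaves lie below a node. -/
def weight {N n : ℕ} (M : SignedTreeModel (Fin N) (Fin n)) (x : Fin N) : ℕ :=
  #{v | M.tree.Anc x (M.leaf v)}

variable {N n : ℕ} (M : SignedTreeModel (Fin N) (Fin n))

theorem isLeaf_leaf (v : Fin n) : M.tree.IsLeaf (M.leaf v) := by
  have : M.leaf v ∈ Set.range M.leaf := ⟨v, rfl⟩
  rwa [M.range_leaf] at this

theorem eq_of_leaf_anc {v : Fin n} {x : Fin N} (h : M.tree.Anc (M.leaf v) x) : x = M.leaf v := by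
  obtain ⟨k, hk⟩ := h
  induction k with
  | zero => exact hk
  | succ k ih =>
    rw [Function.iterate_succ_apply'] at hk
    by_cases hr : M.tree.parent^[k] x = M.tree.root
    · rw [hr, M.tree.parent_root] at hk
      exact ih (hr.trans hk)
    · have : M.tree.parent^[k] x ∈ M.tree.children (M.leaf v) := ⟨hr, hk⟩
      rw [M.isLeaf_leaf v] at this
      exact this.elim

theorem sum_weight_le (x : Fin N) :
    ∑ c with c ≠ M.tree.root ∧ M.tree.parent c = x, M.weight c ≤ M.weight x := by
  classical
  unfold weight
  rw [← card_biUnion]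
  · refine card_le_card fun v => ?_
    simp only [mem_biUnion, mem_filter, mem_univ, true_and]
    rintro ⟨c, ⟨_, rfl⟩, hc⟩
    exact (ParentTree.anc_parent c).trans hc
  · intro b hb c hc hne
    simp only [coe_filter, mem_univ, true_and, Set.mem_ofPred_eq] at hb hc
    rw [Function.onFun, disjoint_left]
    intro v hv hv'
    simp only [mem_filter, mem_univ, true_and] at hv hv'
    wlog h : M.tree.Anc b c generalizing b c
    · exact this hne.symm hc hb hv' hv ((M.tree.anc_total hv hv').resolve_left h)
    -- If one child were above another child of the same parent, it would be above the parent, hence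
    -- equal to it, and thus the root.
    have h1 := h.parent_of_ne hne
    rw [hc.2, ← hb.2] at h1
    have h2 := (ParentTree.anc_parent b).antisymm h1
    exact hb.1 (ParentTree.eq_root_of_iterate (k := 1) one_pos h2)

theorem weight_leaf_pos (v : Fin n) : 0 < M.weight (M.leaf v) := by
  classical
  exact card_pos.2 ⟨v, by simp [M.tree.anc_refl]⟩

theorem weight_le (x : Fin N) : M.weight x ≤ n := by
  classical
  exact (card_le_univ _).trans_eq (Fintype.card_fin n)

/-- The position of a vertex in the left-to-right order of the leaves. -/
def position (v : Fin n) : ℕ := M.tree.offset M.weight (M.leaf v)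

/-- The interval of a leaf is nonempty and lies in that of the root, which starts at `0` and has
length at most `n`. -/
theorem position_lt (v : Fin n) : M.position v < n := by
  have h := (M.tree.offset_anc M.sum_weight_le (ParentTree.root_anc (M.leaf v))).2
  rw [M.tree.offset_root] at h
  have := M.weight_leaf_pos v
  have := M.weight_le M.tree.root
  unfold position
  omega

theorem not_leaf_anc_leaf {u v : Fin n} (h : u ≠ v) : ¬ M.tree.Anc (M.leaf u) (M.leaf v) :=
  fun ha => h (M.leaf_injective (M.eq_of_leaf_anc ha)).symm

theorem position_injective : Function.Injective M.position := by
  intro u v huv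
  by_contra h
  have h1 := M.weight_leaf_pos u
  have h2 := M.weight_leaf_pos v
  have := M.tree.offset_disjoint M.sum_weight_le (M.not_leaf_anc_leaf h)
    (M.not_leaf_anc_leaf (Ne.symm h))
  unfold position at huv
  omega

/-- The leaves below a node are consecutive. -/
theorem anc_leaf_iff (x : Fin N) (v : Fin n) : M.tree.Anc x (M.leaf v) ↔
    M.tree.offset M.weight x ≤ M.position v ∧
      M.position v < M.tree.offset M.weight x + M.weight x := by
  have hv := M.weight_leaf_pos v
  unfold position
  constructor
  · intro h
    have := M.tree.offset_anc M.sum_weight_le h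
    omega
  · intro h
    by_contra hx
    by_cases h' : M.tree.Anc (M.leaf v) x
    · exact hx (M.eq_of_leaf_anc h' ▸ M.tree.anc_refl _)
    · have := M.tree.offset_disjoint M.sum_weight_le hx h'
      omega

/-- The permutation of the vertices that sends every vertex to its position. -/
def positionEquiv : Fin n ≃ Fin n :=
  Equiv.ofBijective (fun v => ⟨M.position v, M.position_lt v⟩)
    (Finite.injective_iff_bijective.1 fun _ _ h => M.position_injective (Fin.mk.inj_iff.1 h))

@[simp] theorem val_positionEquiv (v : Fin n) : (M.positionEquiv v : ℕ) = M.position v := rfl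

theorem position_symm (i : Fin n) : M.position (M.positionEquiv.symm i) = i := by
  rw [← val_positionEquiv, Equiv.apply_symm_apply]

/-- A full binary tree has fewer than twice as many nodes as leaves. -/
theorem card_nodes_le (M : SignedTreeModel (Fin N) (Fin n)) : N ≤ 2 * n := by
  classical
  have h1 : #{c : Fin N | c ≠ M.tree.root} = ∑ x : Fin N, #{c | c ≠ M.tree.root ∧
      M.tree.parent c = x} := by
    rw [card_eq_sum_card_fiberwise (f := M.tree.parent) (t := univ) (by simp)]
    simp [filter_filter]
  have h2 : ∀ x, #{c | c ≠ M.tree.root ∧ M.tree.parent c = x} =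
      if M.tree.IsLeaf x then 0 else 2 := by
    intro x
    have h3 : (M.tree.children x).ncard = #{c | c ≠ M.tree.root ∧ M.tree.parent c = x} := by
      rw [← Set.ncard_coe_finset]
      congr 1
      ext; simp [ParentTree.children]
    rw [← h3]
    split_ifs with h
    · rw [h]; simp
    · exact M.fullBinary x h
  have h4 : #{x | M.tree.IsLeaf x} = n := by
    have : univ.image M.leaf = ({x | M.tree.IsLeaf x} : Finset (Fin N)) := by
      ext x
      have := Set.ext_iff.1 M.range_leaf x
      simpa using this
    rw [← this, card_image_of_injective _ M.leaf_injective, card_fin]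
  -- Counting the nodes other than the root by their parents gives `N - 1 = 2 * (N - n)`.
  rw [sum_congr rfl fun x _ => h2 x, sum_ite] at h1
  simp only [sum_const_zero, sum_const, smul_eq_mul, zero_add] at h1
  have h5 := card_filter_add_card_filter_not (s := (univ : Finset (Fin N))) M.tree.IsLeaf
  rw [filter_ne', card_erase_of_mem (mem_univ _), card_fin] at h1
  rw [card_fin] at h5
  have h6 : #(univ.filter M.tree.IsLeaf) = n := by convert h4
  omega

/-- The number of pairs of a vertex and a node at most `N` steps above its leaf. -/
theorem card_iterates_eq {x : Fin N} (hx : x ≠ M.tree.root) :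
    #{kv : Fin N × Fin n | M.tree.parent^[(kv.1 : ℕ)] (M.leaf kv.2) = x} = M.weight x := by
  classical
  refine card_bij (fun kv _ => kv.2) ?_ ?_ ?_
  · simp only [mem_filter, mem_univ, true_and]
    exact fun kv h => ⟨_, h⟩
  · simp only [mem_filter, mem_univ, true_and]
    rintro ⟨k, v⟩ h ⟨l, _⟩ h' rfl
    -- The root would be counted more than once per vertex when the iteration remains there; other
    -- nodes are met at one height only.
    exact Prod.ext (Fin.ext (ParentTree.iterate_inj h h' hx)) rfl
  · simp only [mem_filter, mem_univ, true_and]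
    rintro v ⟨k, hk⟩
    refine ⟨(⟨k, ?_⟩, v), hk, rfl⟩
    by_contra hcon
    obtain ⟨d, rfl⟩ := Nat.exists_eq_add_of_le (not_lt.1 hcon)
    rw [add_comm, Function.iterate_add_apply, ParentTree.iterate_card, M.tree.iterate_root] at hk
    exact hx hk.symm

end SignedTreeModel

end

end

noncomputable section

/-! ### Persistent segment trees

The nodes of a complete binary tree over `S` cells are numbered such that the cells come first and
the node `S + a` has the children `2 * a` and `2 * a + 1`. A version of the tree is determined by a
row of `S` bits; the node `q` of version `i` is stored once for all equal consecutive versions. -/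

namespace SegTree

open Finset

/-- The name of the node `q` in version `i`. Version `0` is constantly false, version `1` constantly
true, and version `i + 2` has the bits `B i`; the name `0` stands for a subtree without true
bits. -/
def nodeId (S : ℕ) (B : ℕ → ℕ → Bool) : ℕ → ℕ → ℕ
  | 0, _ => 0
  | 1, q => 2 * S + q
  | i + 2, q =>
    if q < S then if B i q then 2 * S + q else 0
    -- For `q = S + a` the guard says `a + 1 < S`, that is, `q` is a proper inner node. It makes the
    -- recursion terminate; indices from `2 * S - 1` on get the name `0`.
    else if _ : 2 * (q - S) + 1 < q then
      if nodeId S B (i + 2) (2 * (q - S)) = 0 ∧ nodeId S B (i + 2) (2 * (q - S) + 1) = 0 then 0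
      else if nodeId S B (i + 2) (2 * (q - S)) = 2 * S + 2 * (q - S) ∧
          nodeId S B (i + 2) (2 * (q - S) + 1) = 2 * S + (2 * (q - S) + 1) then 2 * S + q
      else if nodeId S B (i + 2) (2 * (q - S)) = nodeId S B (i + 1) (2 * (q - S)) ∧
          nodeId S B (i + 2) (2 * (q - S) + 1) = nodeId S B (i + 1) (2 * (q - S) + 1) then
        nodeId S B (i + 1) q
      -- A new name is the index of the entry itself; version and node are its quotient and
      -- remainder modulo `2 * S`.
      else (i + 2) * (2 * S) + q
    else 0
termination_by i q => (i, q)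

/-- The bits of the versions. -/
def bit (B : ℕ → ℕ → Bool) : ℕ → ℕ → Bool
  | 0, _ => false
  | 1, _ => true
  | i + 2, j => B i j

/-- The cell `j` lies below the node `q`. -/
inductive Below (S : ℕ) : ℕ → ℕ → Prop
  | cell {j} : j < S → Below S j j
  | left {a j} : a + 1 < S → Below S (2 * a) j → Below S (S + a) j
  | right {a j} : a + 1 < S → Below S (2 * a + 1) j → Below S (S + a) j

variable {S : ℕ} {B : ℕ → ℕ → Bool}

theorem below_cell_iff {q j : ℕ} (hq : q < S) : Below S q j ↔ q = j := by
  constructor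
  · intro h
    cases h with
    | cell _ => rfl
    | left _ _ => omega
    | right _ _ => omega
  · rintro rfl; exact .cell hq

theorem below_add_iff {a j : ℕ} (ha : a + 1 < S) :
    Below S (S + a) j ↔ Below S (2 * a) j ∨ Below S (2 * a + 1) j := by
  constructor
  · intro h
    generalize hq : S + a = q at h
    cases h with
    | cell _ => omega
    | left _ h => obtain rfl := Nat.add_left_cancel hq; exact .inl h
    | right _ h => obtain rfl := Nat.add_left_cancel hq; exact .inr h
  · rintro (h | h)
    · exact .left ha h
    · exact .right ha h

theorem node_cases {q : ℕ} (hq : q + 1 < 2 * S) : q < S ∨ ∃ a, a + 1 < S ∧ q = S + a := by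
  rcases lt_or_ge q S with h | h
  · exact .inl h
  · exact .inr ⟨q - S, by omega, by omega⟩

theorem nodeId_zero (q : ℕ) : nodeId S B 0 q = 0 := by rw [nodeId]

theorem nodeId_one (q : ℕ) : nodeId S B 1 q = 2 * S + q := by rw [nodeId]

theorem nodeId_cell {i q : ℕ} (hq : q < S) :
    nodeId S B (i + 2) q = if B i q then 2 * S + q else 0 := by
  rw [nodeId, if_pos hq]

theorem nodeId_add {i a : ℕ} (ha : a + 1 < S) : nodeId S B (i + 2) (S + a) =
    if nodeId S B (i + 2) (2 * a) = 0 ∧ nodeId S B (i + 2) (2 * a + 1) = 0 then 0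
    else if nodeId S B (i + 2) (2 * a) = 2 * S + 2 * a ∧
        nodeId S B (i + 2) (2 * a + 1) = 2 * S + (2 * a + 1) then 2 * S + (S + a)
    else if nodeId S B (i + 2) (2 * a) = nodeId S B (i + 1) (2 * a) ∧
        nodeId S B (i + 2) (2 * a + 1) = nodeId S B (i + 1) (2 * a + 1) then
      nodeId S B (i + 1) (S + a)
    else (i + 2) * (2 * S) + (S + a) := by
  rw [nodeId, if_neg (by omega), dif_pos (by omega)]
  simp only [Nat.add_sub_cancel_left]

theorem nodeId_lt {i q : ℕ} (hq : q < 2 * S) : nodeId S B i q < (i + 1) * (2 * S) := by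
  induction i with
  | zero => rw [nodeId_zero]; omega
  | succ i ih =>
    cases i with
    | zero => rw [nodeId_one]; omega
    | succ i =>
      have h1 : (i + 1 + 1) * (2 * S) ≤ (i + 2 + 1) * (2 * S) := Nat.mul_le_mul_right _ (by omega)
      have h2 : 2 * (2 * S) ≤ (i + 2 + 1) * (2 * S) := Nat.mul_le_mul_right _ (by omega)
      have h3 : (i + 2 + 1) * (2 * S) = (i + 2) * (2 * S) + 2 * S := by ring
      change nodeId S B (i + 2) q < (i + 2 + 1) * (2 * S)
      rw [nodeId]
      split_ifs <;> omega

theorem eq_mul_add_mod {i q : ℕ} (hq : q < 2 * S) :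
    (i * (2 * S) + q) / (2 * S) = i ∧ (i * (2 * S) + q) % (2 * S) = q := by
  constructor
  · rw [mul_comm, Nat.mul_add_div (by omega), Nat.div_eq_of_lt hq, add_zero]
  · rw [mul_comm, Nat.mul_add_mod, Nat.mod_eq_of_lt hq]

theorem two_mul_add_mod {q : ℕ} (hq : q < 2 * S) :
    (2 * S + q) / (2 * S) = 1 ∧ (2 * S + q) % (2 * S) = q := by
  simpa using eq_mul_add_mod (i := 1) hq

/-- A name may be inherited from an earlier version, but always for the same node. So a name tells
which node it stands for. -/
theorem nodeId_mod {i q : ℕ} (hq : q < 2 * S) (h : nodeId S B i q ≠ 0) :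
    nodeId S B i q % (2 * S) = q := by
  induction i with
  | zero => exact absurd (nodeId_zero q) h
  | succ i ih =>
    cases i with
    | zero => rw [nodeId_one]; exact (two_mul_add_mod hq).2
    | succ i =>
      rw [nodeId] at h ⊢
      split_ifs at h ⊢ with h1 h2 h3 h4 h5 h6
      · exact (two_mul_add_mod hq).2
      · exact absurd rfl h
      · exact absurd rfl h
      · exact (two_mul_add_mod hq).2
      · exact ih h
      · exact (eq_mul_add_mod hq).2
      · exact absurd rfl h

/-- The children of the stored node are the children in all versions that share it. -/
theorem nodeId_children {i a : ℕ} (ha : a + 1 < S) :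
    nodeId S B (nodeId S B i (S + a) / (2 * S)) (2 * a) = nodeId S B i (2 * a) ∧
    nodeId S B (nodeId S B i (S + a) / (2 * S)) (2 * a + 1) = nodeId S B i (2 * a + 1) := by
  induction i with
  | zero => simp [nodeId_zero]
  | succ i ih =>
    cases i with
    | zero => simp [nodeId_one, (two_mul_add_mod (show S + a < 2 * S by omega)).1]
    | succ i =>
      rw [nodeId_add ha]
      split_ifs with h1 h2 h3
      · simp [nodeId_zero, h1]
      · simp [nodeId_one, (two_mul_add_mod (show S + a < 2 * S by omega)).1, h2]
      · rw [h3.1, h3.2]; exact ih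
      · rw [(eq_mul_add_mod (show S + a < 2 * S by omega)).1]; exact ⟨rfl, rfl⟩

/-- The table of all names. -/
def table (S : ℕ) (B : ℕ → ℕ → Bool) (k : ℕ) : ℕ := nodeId S B (k / (2 * S)) (k % (2 * S))

/-- The index in the table of the left child of a stored node. -/
def childIdx (S h : ℕ) : ℕ := h + h % (2 * S) - 2 * S

theorem table_childIdx {i a : ℕ} (ha : a + 1 < S) (h : nodeId S B i (S + a) ≠ 0) :
    table S B (childIdx S (nodeId S B i (S + a))) = nodeId S B i (2 * a) ∧
    table S B (childIdx S (nodeId S B i (S + a)) + 1) = nodeId S B i (2 * a + 1) := by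
  have h1 := nodeId_mod (show S + a < 2 * S by omega) h
  have h2 := nodeId_children (B := B) (i := i) ha
  set x := nodeId S B i (S + a)
  have h3 := Nat.div_add_mod' x (2 * S)
  -- With `x = i * (2 * S) + (S + a)`, adding the remainder `S + a` and subtracting `2 * S` leaves
  -- `i * (2 * S) + 2 * a`.
  have h4 : childIdx S x = x / (2 * S) * (2 * S) + 2 * a := by unfold childIdx; omega
  have h5 := eq_mul_add_mod (S := S) (i := x / (2 * S)) (q := 2 * a) (by omega)
  have h6 := eq_mul_add_mod (S := S) (i := x / (2 * S)) (q := 2 * a + 1) (by omega)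
  unfold table
  rw [h4, h5.1, h5.2, add_assoc, h6.1, h6.2]
  exact h2

/-- `h'` is a child of the stored node `h`. -/
def Edge (S : ℕ) (B : ℕ → ℕ → Bool) (h h' : ℕ) : Prop :=
  S ≤ h % (2 * S) ∧ h' ≠ 0 ∧
    (h' = table S B (childIdx S h) ∨ h' = table S B (childIdx S h + 1))

/-- Sharing loses nothing: the children read from the table at a stored name are the children in
every version that uses the name. Induction works because children have smaller numbers than their
parents. -/
theorem exists_reach_iff {i q j : ℕ} (hq : q + 1 < 2 * S) (hj : j < S) :
    (nodeId S B i q ≠ 0 ∧ ∃ h, Relation.ReflTransGen (Edge S B) (nodeId S B i q) h ∧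
      h % (2 * S) = j) ↔ Below S q j ∧ bit B i j = true := by
  induction q using Nat.strong_induction_on with
  | _ q ih =>
    rcases node_cases hq with hS | ⟨a, ha, rfl⟩
    · rw [below_cell_iff hS]
      have hid : nodeId S B i q = if bit B i q then 2 * S + q else 0 := by
        rcases i with _ | _ | i
        · simp [nodeId_zero, bit]
        · simp [nodeId_one, bit]
        · rw [nodeId_cell hS, bit]
      have hm := (two_mul_add_mod (show q < 2 * S by omega)).2
      constructor
      · rintro ⟨h0, h, hr, rfl⟩
        have hb : bit B i q = true := by
          by_contra hb
          simp [hid, hb] at h0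
        rw [hid, if_pos hb] at hr
        rcases Relation.ReflTransGen.cases_head hr with rfl | ⟨c, hc, _⟩
        · rw [hm]; exact ⟨rfl, hb⟩
        · have := hc.1; omega
      · rintro ⟨rfl, hb⟩
        rw [hid, if_pos hb]
        exact ⟨by omega, _, .refl, hm⟩
    · rw [below_add_iff ha, or_and_right, ← ih (2 * a) (by omega) (by omega),
        ← ih (2 * a + 1) (by omega) (by omega)]
      by_cases h0 : nodeId S B i (S + a) = 0
      · have := nodeId_children (B := B) (i := i) ha
        rw [h0, Nat.zero_div, nodeId_zero, nodeId_zero] at this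
        simp [h0, ← this.1, ← this.2]
      · have hm := nodeId_mod (show S + a < 2 * S by omega) h0
        obtain ⟨t1, t2⟩ := table_childIdx ha h0
        constructor
        · rintro ⟨_, h, hr, hh⟩
          rcases Relation.ReflTransGen.cases_head hr with rfl | ⟨c, ⟨_, hc0, hc⟩, hr'⟩
          · omega
          · rw [t1, t2] at hc
            rcases hc with rfl | rfl
            · exact .inl ⟨hc0, h, hr', hh⟩
            · exact .inr ⟨hc0, h, hr', hh⟩
        · rintro (⟨hc0, h, hr, hh⟩ | ⟨hc0, h, hr, hh⟩)
          · exact ⟨h0, h, .head ⟨by omega, hc0, .inl t1.symm⟩ hr, hh⟩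
          · exact ⟨h0, h, .head ⟨by omega, hc0, .inr t2.symm⟩ hr, hh⟩

/-- The stored nodes of the versions below `m`. -/
def nodeSet (S : ℕ) (B : ℕ → ℕ → Bool) (m : ℕ) : Finset ℕ :=
  ((range m ×ˢ range (2 * S - 1)).image fun x => nodeId S B x.1 x.2).erase 0

theorem nodeId_mem_nodeSet {m i q : ℕ} (hi : i < m) (hq : q + 1 < 2 * S)
    (h : nodeId S B i q ≠ 0) : nodeId S B i q ∈ nodeSet S B m := by
  refine mem_erase.2 ⟨h, mem_image.2 ⟨(i, q), ?_, rfl⟩⟩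
  simp only [mem_product, mem_range]
  omega

theorem exists_of_mem_nodeSet {m h : ℕ} (hh : h ∈ nodeSet S B m) :
    h ≠ 0 ∧ ∃ i q, i < m ∧ q + 1 < 2 * S ∧ nodeId S B i q = h := by
  simp only [nodeSet, mem_erase, mem_image, mem_product, mem_range, Prod.exists] at hh
  obtain ⟨h0, i, q, h1, h2⟩ := hh
  exact ⟨h0, i, q, h1.1, by omega, h2⟩

theorem lt_of_mem_nodeSet {m h : ℕ} (hh : h ∈ nodeSet S B m) : h < m * (2 * S) := by
  obtain ⟨_, i, q, hi, hq, rfl⟩ := exists_of_mem_nodeSet hh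
  exact (nodeId_lt (by omega)).trans_le (Nat.mul_le_mul_right _ hi)

/-- Version `0` contributes only the name `0`. Consequently the subtraction in `childIdx` is never
truncated at a stored node. -/
theorem two_mul_le_of_mem_nodeSet {m h : ℕ} (hh : h ∈ nodeSet S B m) : 2 * S ≤ h := by
  obtain ⟨h0, i, q, -, hq, rfl⟩ := exists_of_mem_nodeSet hh
  clear hh
  induction i with
  | zero => exact absurd (nodeId_zero q) h0
  | succ i ih =>
    cases i with
    | zero => rw [nodeId_one]; omega
    | succ i =>
      rw [nodeId] at h0 ⊢
      split_ifs at h0 ⊢ with h1 h2 h3 h4 h5 h6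
      all_goals first | omega | exact ih h0 | nlinarith

theorem mod_lt_of_mem_nodeSet {m h : ℕ} (hh : h ∈ nodeSet S B m) : h % (2 * S) + 1 < 2 * S := by
  obtain ⟨h0, i, q, hi, hq, rfl⟩ := exists_of_mem_nodeSet hh
  rwa [nodeId_mod (by omega) h0]

theorem table_childIdx_mem {m h : ℕ} (hh : h ∈ nodeSet S B m) (hS : S ≤ h % (2 * S)) :
    (table S B (childIdx S h) = 0 ∨ table S B (childIdx S h) ∈ nodeSet S B m) ∧
    (table S B (childIdx S h + 1) = 0 ∨ table S B (childIdx S h + 1) ∈ nodeSet S B m) := by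
  obtain ⟨h0, i, q, hi, hq, rfl⟩ := exists_of_mem_nodeSet hh
  rw [nodeId_mod (by omega) h0] at hS
  rcases node_cases hq with h1 | ⟨a, ha, rfl⟩
  · omega
  · obtain ⟨t1, t2⟩ := table_childIdx ha h0
    rw [t1, t2]
    exact ⟨or_iff_not_imp_left.2 fun h => nodeId_mem_nodeSet hi (by omega) h,
      or_iff_not_imp_left.2 fun h => nodeId_mem_nodeSet hi (by omega) h⟩

/-! ### The number of stored nodes -/

/-- Constant subtrees always fall back on versions `0` and `1`, whatever the preceding row is. This
and the next two lemmas confine new names to nodes where the row is not constant and differs from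
its predecessor. -/
theorem nodeId_eq_zero {i q : ℕ} (hq : q + 1 < 2 * S) (h : ∀ j, Below S q j → B i j = false) :
    nodeId S B (i + 2) q = 0 := by
  induction q using Nat.strong_induction_on with
  | _ q ih =>
    rcases node_cases hq with hS | ⟨a, ha, rfl⟩
    · rw [nodeId_cell hS, h q (.cell hS)]; rfl
    · rw [nodeId_add ha, if_pos]
      exact ⟨ih _ (by omega) (by omega) fun j hj => h j (.left ha hj),
        ih _ (by omega) (by omega) fun j hj => h j (.right ha hj)⟩

theorem nodeId_eq_full {i q : ℕ} (hq : q + 1 < 2 * S) (h : ∀ j, Below S q j → B i j = true) :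
    nodeId S B (i + 2) q = 2 * S + q := by
  induction q using Nat.strong_induction_on with
  | _ q ih =>
    rcases node_cases hq with hS | ⟨a, ha, rfl⟩
    · rw [nodeId_cell hS, h q (.cell hS)]; rfl
    · have h1 := ih _ (by omega) (by omega) fun j hj => h j (.left ha hj)
      have h2 := ih _ (by omega) (by omega) fun j hj => h j (.right ha hj)
      rw [nodeId_add ha, if_neg (by omega), if_pos ⟨h1, h2⟩]

theorem nodeId_succ_eq {i q : ℕ} (hq : q + 1 < 2 * S)
    (h : ∀ j, Below S q j → B i j = B (i + 1) j) :
    nodeId S B (i + 3) q = nodeId S B (i + 2) q := by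
  induction q using Nat.strong_induction_on with
  | _ q ih =>
    rcases node_cases hq with hS | ⟨a, ha, rfl⟩
    · rw [show i + 3 = i + 1 + 2 from rfl, nodeId_cell hS, nodeId_cell hS, h q (.cell hS)]
    · have h1 := ih _ (by omega) (by omega) fun j hj => h j (.left ha hj)
      have h2 := ih _ (by omega) (by omega) fun j hj => h j (.right ha hj)
      rw [show i + 3 = i + 1 + 2 from rfl] at h1 h2 ⊢
      rw [nodeId_add ha, h1, h2]
      split_ifs with h3 h4 h5
      · rw [nodeId_add ha, if_pos h3]
      · rw [nodeId_add ha, if_neg h3, if_pos h4]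
      · rfl
      · exact absurd ⟨rfl, rfl⟩ h5

/-- Traces an inherited name back to the version `k + 2` that created it, so that only creations
have to be counted. -/
theorem nodeId_eq_or {i q : ℕ} : nodeId S B i q = 0 ∨ nodeId S B i q = 2 * S + q ∨
    ∃ k, k + 2 ≤ i ∧ nodeId S B i q = (k + 2) * (2 * S) + q ∧
      nodeId S B (k + 2) q = (k + 2) * (2 * S) + q := by
  induction i with
  | zero => exact .inl (nodeId_zero q)
  | succ i ih =>
    cases i with
    | zero => exact .inr (.inl (nodeId_one q))
    | succ i =>
      by_cases h : nodeId S B (i + 2) q = (i + 2) * (2 * S) + q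
      · exact .inr (.inr ⟨i, le_rfl, h, h⟩)
      · have h' := h
        rw [nodeId] at h
        rw [show i + 1 + 1 = i + 2 from rfl]
        split_ifs at h with h1 h2 h3 h4 h5 h6
        · right; left; rw [nodeId_cell h1, if_pos h2]
        · left; rw [nodeId_cell h1, if_neg h2]
        · left; rw [nodeId, if_neg h1, dif_pos h3, if_pos h4]
        · right; left; rw [nodeId, if_neg h1, dif_pos h3, if_neg h4, if_pos h5]
        · have h7 : nodeId S B (i + 2) q = nodeId S B (i + 1) q := by
            rw [nodeId, if_neg h1, dif_pos h3, if_neg h4, if_neg h5, if_pos h6]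
          rw [h7]
          rcases ih with h8 | h8 | ⟨k, hk, h8⟩
          · exact .inl h8
          · exact .inr (.inl h8)
          · exact .inr (.inr ⟨k, by omega, h8⟩)
        · exact absurd rfl h
        · left; rw [nodeId, if_neg h1, dif_neg h3]

/-- If `D` contains all pairs of a version and a node below which the version is not constant and
differs from its predecessor, then there are at most `4 * S + #D` stored nodes. -/
theorem card_nodeSet_le (n : ℕ) (D : Finset (ℕ × ℕ))
    (hD : ∀ i q, i + 1 < n → q + 1 < 2 * S → (∃ j, Below S q j ∧ B i j ≠ B (i + 1) j) →
      (∃ j, Below S q j ∧ B (i + 1) j = true) → (∃ j, Below S q j ∧ B (i + 1) j = false) →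
      (i, q) ∈ D) :
    #(nodeSet S B (n + 2)) ≤ 4 * S + #D := by
  have hsub : nodeSet S B (n + 2) ⊆ (range (4 * S)).image (2 * S + ·) ∪
      D.image fun x => (x.1 + 3) * (2 * S) + x.2 := by
    intro h hh
    obtain ⟨h0, i, q, hi, hq, rfl⟩ := exists_of_mem_nodeSet hh
    simp only [mem_union, mem_image, mem_range, Prod.exists]
    rcases nodeId_eq_or (S := S) (B := B) (i := i) (q := q) with h1 | h1 | ⟨k, hk, h1, h2⟩
    · exact absurd h1 h0
    · exact .inl ⟨q, by omega, h1.symm⟩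
    · cases k with
      -- The first row has no preceding row; its names fill the second half of `range (4 * S)`,
      -- after the constantly true nodes.
      | zero => exact .inl ⟨2 * S + q, by omega, by rw [h1]; ring⟩
      | succ k =>
        refine .inr ⟨k, q, ?_, h1.symm⟩
        -- By these estimates a new name of version `k + 3` exceeds `2 * S + q` and all names of
        -- version `k + 2`, so none of the three ways of sharing applied to it.
        have hlt := nodeId_lt (B := B) (i := k + 2) (show q < 2 * S by omega)
        have e1 : (k + 1 + 2) * (2 * S) = (k + 2) * (2 * S) + 2 * S := by ring
        have e2 : (k + 2 + 1) * (2 * S) = (k + 2) * (2 * S) + 2 * S := by ring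
        have e3 : 2 * (2 * S) ≤ (k + 2) * (2 * S) := Nat.mul_le_mul_right _ (by omega)
        refine hD k q (by omega) hq ?_ ?_ ?_
        · by_contra hcon
          push Not at hcon
          have := nodeId_succ_eq (B := B) hq hcon
          rw [show k + 3 = k + 1 + 2 from rfl] at this
          omega
        · by_contra hcon
          push Not at hcon
          have := nodeId_eq_zero (B := B) (i := k + 1) hq (by simpa using hcon)
          omega
        · by_contra hcon
          push Not at hcon
          have := nodeId_eq_full (B := B) (i := k + 1) hq (by simpa using hcon)
          omega
  refine (card_le_card hsub).trans ((card_union_le _ _).trans (add_le_add ?_ card_image_le))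
  exact card_image_le.trans_eq (card_range _)

/-! ### Cells below a node form an interval -/

/-- The node of height `h` above the cells `c * 2 ^ h, …, (c + 1) * 2 ^ h - 1`, in the tree over
`2 ^ L` cells. -/
def node (L h c : ℕ) : ℕ := 2 ^ (L + 1) - 2 ^ (L + 1 - h) + c

/-- Each height occupies a block of consecutive numbers, half as long as the block before. The node
`c` of a height has the nodes `2 * c` and `2 * c + 1` of the height below as children. -/
theorem node_succ {L h c : ℕ} (hh : h < L) :
    node L (h + 1) c = 2 ^ L + (2 ^ L - 2 ^ (L - h) + c) ∧
    2 * (2 ^ L - 2 ^ (L - h) + c) = node L h (2 * c) := by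
  have h1 : 2 ^ (L - h) ≤ 2 ^ L := Nat.pow_le_pow_right (by omega) (by omega)
  have h2 : 2 ^ (L + 1) = 2 * 2 ^ L := by ring
  have h3 : 2 ^ (L + 1 - h) = 2 * 2 ^ (L - h) := by
    rw [show L + 1 - h = (L - h) + 1 by omega]; ring
  unfold node
  rw [show L + 1 - (h + 1) = L - h by omega]
  omega

theorem below_node_iff {L h c j : ℕ} (hh : h ≤ L) (hc : c < 2 ^ (L - h)) :
    Below (2 ^ L) (node L h c) j ↔ j / 2 ^ h = c := by
  induction h generalizing c with
  | zero =>
    have : node L 0 c = c := by simp [node]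
    rw [this, below_cell_iff (by simpa using hc), pow_zero, Nat.div_one, eq_comm]
  | succ h ih =>
    obtain ⟨e1, e2⟩ := node_succ (c := c) (show h < L by omega)
    have h1 : 2 ^ (L - h) ≤ 2 ^ L := Nat.pow_le_pow_right (by omega) (by omega)
    have h3 : 2 ^ (L - h) = 2 * 2 ^ (L - (h + 1)) := by
      rw [show L - h = (L - (h + 1)) + 1 by omega]; ring
    have e3 : node L h (2 * c) + 1 = node L h (2 * c + 1) := rfl
    rw [e1, below_add_iff (by omega), e2, e3, ih (by omega) (by omega), ih (by omega) (by omega),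
      pow_succ, ← Nat.div_div_eq_div_mul]
    omega

theorem exists_node {L q : ℕ} (hq : q + 1 < 2 * 2 ^ L) :
    ∃ h c, h ≤ L ∧ c < 2 ^ (L - h) ∧ q = node L h c := by
  induction q using Nat.strong_induction_on with
  | _ q ih =>
    rcases node_cases hq with hS | ⟨a, ha, rfl⟩
    · exact ⟨0, q, Nat.zero_le _, by simpa using hS, by simp [node]⟩
    · obtain ⟨h, c, hh, hc, he⟩ := ih (2 * a) (by omega) (by omega)
      have h1 : 2 ^ (L - h) ≤ 2 ^ L := Nat.pow_le_pow_right (by omega) (by omega)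
      have h2 : 2 ^ (L + 1) = 2 * 2 ^ L := by ring
      have h3 : 2 ^ (L + 1 - h) = 2 * 2 ^ (L - h) := by
        rw [show L + 1 - h = (L - h) + 1 by omega]; ring
      have hlt : h < L := by
        -- At height `L` the left child `2 * a` would be the root `2 * S - 2`, against `a + 1 < S`.
        by_contra hcon
        obtain rfl : h = L := by omega
        simp only [node, show h + 1 - h = 1 by omega] at he
        simp at hc
        omega
      have h4 : 2 ^ (L - h) = 2 * 2 ^ (L - (h + 1)) := by
        rw [show L - h = (L - (h + 1)) + 1 by omega]; ring
      have e0 : 2 * a = 2 ^ (L + 1) - 2 ^ (L + 1 - h) + c := he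
      refine ⟨h + 1, c / 2, hlt, by omega, ?_⟩
      rw [(node_succ hlt).1]
      omega

end SegTree

end

/-! ### Consecutive rows of the ordered adjacency matrix differ at few nodes -/

noncomputable section

namespace SignedTreeModel

open Finset SegTree

section

variable {ν V : Type*} (M : SignedTreeModel ν V)

/-- The adjacency of two vertices is determined by the pairs above them. -/
theorem adj_congr {u v u' v' : V} (h : ∀ x y, s(x, y) ∈ M.pairs →
    (M.tree.Anc x (M.leaf u) ∧ M.tree.Anc y (M.leaf v) ↔
      M.tree.Anc x (M.leaf u') ∧ M.tree.Anc y (M.leaf v'))) :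
    M.graph.Adj u v ↔ M.graph.Adj u' v' := by
  have key : ∀ {u v u' v' : V}, (∀ x y, s(x, y) ∈ M.pairs →
      (M.tree.Anc x (M.leaf u) ∧ M.tree.Anc y (M.leaf v) ↔
        M.tree.Anc x (M.leaf u') ∧ M.tree.Anc y (M.leaf v'))) →
      M.graph.Adj u v → M.graph.Adj u' v' := by
    rintro u v u' v' h ⟨x, y, hp, hP, hx, hy, hmin⟩
    obtain ⟨hx', hy'⟩ := (h x y hP).1 ⟨hx, hy⟩
    refine ⟨x, y, hp, hP, hx', hy', fun x'' y'' hP'' h1 h2 h3 h4 => ?_⟩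
    obtain ⟨h5, h6⟩ := (h x'' y'' hP'').2 ⟨h2, h4⟩
    exact hmin x'' y'' hP'' h1 h5 h3 h6
  exact ⟨key h, key fun x y hP => (h x y hP).symm⟩

/-- The pairs above two vertices form a chain. -/
theorem pairs_chain {x₁ y₁ x₂ y₂ a b : ν} (h₁ : s(x₁, y₁) ∈ M.pairs) (h₂ : s(x₂, y₂) ∈ M.pairs)
    (hx₁ : M.tree.Anc x₁ a) (hy₁ : M.tree.Anc y₁ b) (hx₂ : M.tree.Anc x₂ a)
    (hy₂ : M.tree.Anc y₂ b) :
    M.tree.Anc x₁ x₂ ∧ M.tree.Anc y₁ y₂ ∨ M.tree.Anc x₂ x₁ ∧ M.tree.Anc y₂ y₁ := by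
  -- If the two coordinates were strictly ordered in opposite directions, the pairs would cross.
  have nc : ∀ {x₁ y₁ x₂ y₂}, s(x₁, y₁) ∈ M.pairs → s(x₂, y₂) ∈ M.pairs → M.tree.Anc x₁ x₂ →
      M.tree.Anc y₂ y₁ → x₁ = x₂ ∨ y₁ = y₂ := by
    intro x₁ y₁ x₂ y₂ h₁ h₂ hx hy
    by_contra hcon
    push Not at hcon
    exact M.nonCrossing _ _ h₁ h₂
      ⟨⟨x₁, by simp, x₂, by simp, hx, hcon.1⟩, ⟨y₂, by simp, y₁, by simp, hy, hcon.2.symm⟩⟩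
  rcases M.tree.anc_total hx₁ hx₂ with hx | hx <;> rcases M.tree.anc_total hy₁ hy₂ with hy | hy
  · exact .inl ⟨hx, hy⟩
  · rcases nc h₁ h₂ hx hy with rfl | rfl
    · exact .inr ⟨M.tree.anc_refl _, hy⟩
    · exact .inl ⟨hx, M.tree.anc_refl _⟩
  · rcases nc h₂ h₁ hx hy with rfl | rfl
    · exact .inl ⟨M.tree.anc_refl _, hy⟩
    · exact .inr ⟨hx, M.tree.anc_refl _⟩
  · exact .inr ⟨hx, hy⟩

/-- Suppose that the second nodes of all pairs whose first node separates `u` from `u'` do not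
separate the elements of `I`. If `u` and `u'` have different neighbours in `I`, then the
neighbourhood of `u'` is trivial on `I`. -/
theorem adj_const_of_not_separated {u u' : V} {I : Set V}
    (hI : ∀ z y, s(z, y) ∈ M.pairs →
      ¬ (M.tree.Anc z (M.leaf u) ↔ M.tree.Anc z (M.leaf u')) →
      ∀ v ∈ I, ∀ v' ∈ I, M.tree.Anc y (M.leaf v) → M.tree.Anc y (M.leaf v'))
    {v : V} (hv : v ∈ I) (hne : ¬ (M.graph.Adj u v ↔ M.graph.Adj u' v)) {v₁ v₂ : V}
    (hv₁ : v₁ ∈ I) (hv₂ : v₂ ∈ I) (h : M.graph.Adj u' v₁) : M.graph.Adj u' v₂ := by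
  -- Without such a pair, `u` and `u'` would see the same pairs above `v`, and `adj_congr` would
  -- give equal adjacencies.
  obtain ⟨z, y, hP, hsep, hyv⟩ : ∃ z y, s(z, y) ∈ M.pairs ∧
      ¬ (M.tree.Anc z (M.leaf u) ↔ M.tree.Anc z (M.leaf u')) ∧ M.tree.Anc y (M.leaf v) := by
    by_contra hcon
    simp only [not_exists, not_and] at hcon
    refine hne (M.adj_congr fun x y hP => ?_)
    by_cases hs : M.tree.Anc x (M.leaf u) ↔ M.tree.Anc x (M.leaf u')
    · rw [hs]
    · simp [hcon x y hP hs]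
  have hy : ∀ v' ∈ I, M.tree.Anc y (M.leaf v') := fun v' hv' => hI z y hP hsep v hv v' hv' hyv
  -- If `x` separates `u` and `u'`, this is the assumption on `I`. Otherwise `x` is above both, and
  -- the pair is comparable with `zy`. It cannot lie below `zy`, as then `z` would be above both `u`
  -- and `u'`; so `t` is above `y`, which is above all of `I`.
  have key : ∀ a ∈ I, ∀ b ∈ I, ∀ x t, s(x, t) ∈ M.pairs → M.tree.Anc x (M.leaf u') →
      M.tree.Anc t (M.leaf a) → M.tree.Anc t (M.leaf b) := by
    intro a ha b hb x t hxt hx ht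
    by_cases hxu : M.tree.Anc x (M.leaf u)
    · by_cases hz : M.tree.Anc z (M.leaf u)
      · rcases M.pairs_chain hxt hP hxu ht hz (hy a ha) with h | h
        · exact h.2.trans (hy b hb)
        · exact absurd ⟨fun _ => h.1.trans hx, fun _ => hz⟩ hsep
      · have hz' : M.tree.Anc z (M.leaf u') := by
          by_contra hz'; exact hsep (by simp [hz, hz'])
        rcases M.pairs_chain hxt hP hx ht hz' (hy a ha) with h | h
        · exact h.2.trans (hy b hb)
        · exact absurd (h.1.trans hxu) hz
    · exact hI x t hxt (by simp [hxu, hx]) a ha b hb ht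
  refine (M.adj_congr fun x t hxt => ?_).1 h
  exact ⟨fun h => ⟨h.1, key _ hv₁ _ hv₂ x t hxt h.1 h.2⟩,
    fun h => ⟨h.1, key _ hv₂ _ hv₁ x t hxt h.1 h.2⟩⟩

end

variable {N n : ℕ} (M : SignedTreeModel (Fin N) (Fin n))

/-- The pairs of the model in both orientations. -/
def orientedPairs : Finset (Fin N × Fin N) :=
  ((M.neg ∪ M.pos) ×ˢ (univ : Finset Bool)).image fun x =>
    if x.2 then Quot.out x.1 else (Quot.out x.1).swap

theorem mem_orientedPairs {x y : Fin N} (h : s(x, y) ∈ M.pairs) : (x, y) ∈ M.orientedPairs := by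
  have h1 : s(x, y) ∈ M.neg ∪ M.pos := mem_union.2 h
  have h2 : s((Quot.out s(x, y)).1, (Quot.out s(x, y)).2) = s(x, y) := Quot.out_eq _
  rw [Sym2.eq_iff] at h2
  simp only [orientedPairs, mem_image, mem_product, mem_univ, and_true]
  rcases h2 with h2 | h2
  · exact ⟨(s(x, y), true), h1, Prod.ext h2.1 h2.2⟩
  · exact ⟨(s(x, y), false), h1, Prod.ext h2.2 h2.1⟩

theorem card_orientedPairs_le : #M.orientedPairs ≤ 2 * M.numPairs := by
  refine card_image_le.trans ?_
  rw [card_product, card_univ, Fintype.card_bool, mul_comm]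
  exact Nat.mul_le_mul_left _ (card_union_le _ _)

/-- The vertex of a cell; the cells from `n` on are copies of the last vertex. -/
def cellVertex (M : SignedTreeModel (Fin N) (Fin n)) (hn : 0 < n) (j : ℕ) : Fin n :=
  M.positionEquiv.symm ⟨min j (n - 1), by omega⟩

theorem position_cellVertex (hn : 0 < n) (j : ℕ) :
    M.position (M.cellVertex hn j) = min j (n - 1) := M.position_symm _

open Classical in
/-- The rows of the adjacency matrix, with the vertices in left-to-right order. -/
def rowBit (M : SignedTreeModel (Fin N) (Fin n)) (hn : 0 < n) (i j : ℕ) : Bool :=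
  decide (M.graph.Adj (M.cellVertex hn i) (M.cellVertex hn j))

/-- The two ends of the interval of leaves below a node. -/
def intervalEnd (x : Fin N) (b : Bool) : ℕ :=
  if b then M.tree.offset M.weight x else M.tree.offset M.weight x + M.weight x

/-- The leaves below `x` form an interval, so membership changes only at its two ends, and `j` is
the last position before the change. The padding cells repeat the last vertex and cause no further
change. -/
theorem succ_eq_intervalEnd (hn : 0 < n) {x : Fin N} {j : ℕ}
    (h : ¬ (M.tree.Anc x (M.leaf (M.cellVertex hn j)) ↔
      M.tree.Anc x (M.leaf (M.cellVertex hn (j + 1))))) :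
    ∃ b, j = M.intervalEnd x b - 1 := by
  rw [M.anc_leaf_iff, M.anc_leaf_iff, M.position_cellVertex, M.position_cellVertex] at h
  by_contra hcon
  push Not at hcon
  have h1 := hcon true
  have h2 := hcon false
  simp only [intervalEnd, if_true, Bool.false_eq_true, if_false] at h1 h2
  omega

/-- There are only few positions at which the segment trees of consecutive rows differ. -/
theorem card_nodeSet_rowBit_le (hn : 0 < n) (L : ℕ) :
    #(nodeSet (2 ^ L) (M.rowBit hn) (n + 2)) ≤ 4 * 2 ^ L + 8 * M.numPairs * (L + 1) := by
  classical
  -- For each oriented pair and each choice of an end for either node: the row after which the first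
  -- node changes, and the nodes of all `L + 1` heights above the cell after which the second node
  -- changes. The factor 8 comes from 2 orientations and 4 choices of ends.
  let D : Finset (ℕ × ℕ) :=
    (M.orientedPairs ×ˢ (univ : Finset (Bool × Bool)) ×ˢ range (L + 1)).image fun x =>
      (M.intervalEnd x.1.1 x.2.1.1 - 1,
        node L x.2.2 ((M.intervalEnd x.1.2 x.2.1.2 - 1) / 2 ^ x.2.2))
  have hD : #D ≤ 8 * M.numPairs * (L + 1) := by
    refine card_image_le.trans ?_
    rw [card_product, card_product, card_range, card_univ, Fintype.card_prod, Fintype.card_bool]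
    have := Nat.mul_le_mul_right (2 * 2 * (L + 1)) M.card_orientedPairs_le
    linarith
  refine (card_nodeSet_le n D ?_).trans (Nat.add_le_add_left hD _)
  rintro i q hi hq ⟨j, hj, hne⟩ ⟨j₁, hj₁, h₁⟩ ⟨j₂, hj₂, h₂⟩
  obtain ⟨h, c, hh, hc, rfl⟩ := exists_node hq
  rw [below_node_iff hh hc] at hj hj₁ hj₂
  simp only [rowBit, decide_eq_true_eq, decide_eq_false_iff_not, ne_eq, decide_eq_decide]
    at hne h₁ h₂
  by_contra hcon
  refine h₂ (M.adj_const_of_not_separated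
    (I := {v | ∃ j, j / 2 ^ h = c ∧ v = M.cellVertex hn j}) ?_ ⟨j, hj, rfl⟩ hne
    ⟨j₁, hj₁, rfl⟩ ⟨j₂, hj₂, rfl⟩ h₁)
  intro z y hP hsep
  obtain ⟨b, hb⟩ := M.succ_eq_intervalEnd hn hsep
  -- A change after a cell of the interval would put the node into `D`, since `z` changes after row
  -- `i`.
  have hstep : ∀ j, j / 2 ^ h = c → (M.tree.Anc y (M.leaf (M.cellVertex hn j)) ↔
      M.tree.Anc y (M.leaf (M.cellVertex hn (j + 1)))) := by
    intro j hj
    by_contra hs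
    obtain ⟨b', hb'⟩ := M.succ_eq_intervalEnd hn hs
    refine hcon (mem_image.2 ⟨((z, y), (b, b'), h), ?_, ?_⟩)
    · simp [M.mem_orientedPairs hP]; omega
    · simp only [← hb, ← hb', hj]
  have hmono : ∀ d j, j / 2 ^ h = c → (j + d) / 2 ^ h = c →
      (M.tree.Anc y (M.leaf (M.cellVertex hn j)) ↔
        M.tree.Anc y (M.leaf (M.cellVertex hn (j + d)))) := by
    intro d
    induction d with
    | zero => intro j _ _; rfl
    | succ d ih =>
      intro j hj hjd
      have h3 : (j + d) / 2 ^ h = c := by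
        apply le_antisymm
        · rw [← hjd]; exact Nat.div_le_div_right (by omega)
        · rw [← hj]; exact Nat.div_le_div_right (by omega)
      rw [ih j hj h3, hstep _ h3]; rfl
  rintro _ ⟨k, hk, rfl⟩ _ ⟨l, hl, rfl⟩
  rcases le_total k l with hkl | hkl
  · obtain ⟨d, rfl⟩ := Nat.exists_eq_add_of_le hkl
    exact (hmono d k hk hl).1
  · obtain ⟨d, rfl⟩ := Nat.exists_eq_add_of_le hkl
    exact (hmono d l hl hk).2

end SignedTreeModel

end

noncomputable section

/-! ### Breadth-first search in an implicitly given graph -/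

section

open Finset Relation

/-- A digraph without duplicates that represents the relation `A` on the numbers below `n`: the
vertex `v` is related to `x` iff a cell with label `v` can be reached from the node `root x`. The
number `0` stands for a missing node. -/
structure SearchNet (n : ℕ) (A : ℕ → ℕ → Prop) where
  root : ℕ → ℕ
  left : ℕ → ℕ
  right : ℕ → ℕ
  cell : ℕ → Prop
  label : ℕ → ℕ
  nodes : Finset ℕ
  root_mem : ∀ x < n, root x = 0 ∨ root x ∈ nodes
  left_mem : ∀ h ∈ nodes, ¬ cell h → left h = 0 ∨ left h ∈ nodes
  right_mem : ∀ h ∈ nodes, ¬ cell h → right h = 0 ∨ right h ∈ nodes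
  label_lt : ∀ h ∈ nodes, cell h → label h < n
  iff_reach : ∀ x < n, ∀ v < n, A x v ↔ root x ≠ 0 ∧ ∃ h,
    ReflTransGen (fun a b => ¬ cell a ∧ b ≠ 0 ∧ (b = left a ∨ b = right a)) (root x) h ∧
      cell h ∧ label h = v

namespace SearchNet

variable {n : ℕ} {A : ℕ → ℕ → Prop} (X : SearchNet n A)

/-- `b` is a child of `a`. -/
def Edge (a b : ℕ) : Prop := ¬ X.cell a ∧ b ≠ 0 ∧ (b = X.left a ∨ b = X.right a)

/-- `b` can be reached from `a`. -/
def Reach (a b : ℕ) : Prop := ReflTransGen X.Edge a b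

theorem related_iff {x v : ℕ} (hx : x < n) (hv : v < n) : A x v ↔
    X.root x ≠ 0 ∧ ∃ h, X.Reach (X.root x) h ∧ X.cell h ∧ X.label h = v :=
  X.iff_reach x hx v hv

variable {X} in
theorem edge_mem {a b : ℕ} (ha : a ∈ X.nodes) (h : X.Edge a b) : b ∈ X.nodes := by
  obtain ⟨hc, hb, rfl | rfl⟩ := h
  · exact (X.left_mem a ha hc).resolve_left hb
  · exact (X.right_mem a ha hc).resolve_left hb

open Classical in
/-- The invariant of the breadth-first search from `u`. The distances `d` and the parents `p` are
`n` at the vertices not yet found; the queue consists of `qu 0, …, qu (tl - 1)`, of which the first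
`hd` have been removed, the last of them being `x`; the nodes `st 0, …, st (sp - 1)` remain to be
searched for the neighbours of `x`; the nodes in `mk` have been searched. -/
structure Inv (u : ℕ) (d p qu st : ℕ → ℕ) (hd tl x sp : ℕ) (mk : ℕ → Prop) : Prop where
  u_lt : u < n
  hd_le : hd ≤ tl
  tl_le : tl ≤ n
  qu_lt : ∀ i < tl, qu i < n
  qu_inj : ∀ i < tl, ∀ j < tl, qu i = qu j → i = j
  found_iff : ∀ v < n, d v ≠ n ↔ ∃ i < tl, qu i = v
  d_u : d u = 0
  p_u : p u = u
  p_eq : ∀ v < n, d v = n → p v = n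
  start : hd = 0 → tl = 1 ∧ sp = 0 ∧ qu 0 = u
  x_eq : 0 < hd → x = qu (hd - 1)
  d_qu_le : ∀ i < tl, d (qu i) ≤ i
  d_mono : ∀ i j, i ≤ j → j < tl → d (qu i) ≤ d (qu j)
  d_le_x : 0 < hd → ∀ i < tl, d (qu i) ≤ d x + 1
  parent : ∀ v < n, d v ≠ n → v ≠ u → p v < n ∧ A (p v) v ∧ d (p v) ≠ n ∧ d (p v) + 1 = d v
  finished : ∀ i, i + 1 < hd → ∀ v < n, A (qu i) v → d v ≠ n ∧ d v ≤ d (qu i) + 1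
  mk_mem : ∀ h, mk h → h ∈ X.nodes
  mk_cell : ∀ h, mk h → X.cell h → d (X.label h) ≠ n
  mk_edge : ∀ h, mk h → ∀ h', X.Edge h h' → mk h' ∨ ∃ i < sp, st i = h'
  mk_root : ∀ i < hd, X.root (qu i) ≠ 0 → mk (X.root (qu i)) ∨ ∃ k < sp, st k = X.root (qu i)
  stack : ∀ i < sp, st i ≠ 0 → st i ∈ X.nodes ∧ X.root x ≠ 0 ∧ X.Reach (X.root x) (st i)
  sp_le : sp + 2 * #{h ∈ X.nodes | ¬ mk h} ≤ 2 * #X.nodes + 1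

namespace Inv

variable {X} {u : ℕ} {d p qu st : ℕ → ℕ} {hd tl x sp : ℕ} {mk : ℕ → Prop}

theorem hd_pos (I : X.Inv u d p qu st hd tl x sp mk) (h : 0 < sp) : 0 < hd := by
  by_contra hc
  have := (I.start (by omega)).2.1
  omega

theorem x_lt (I : X.Inv u d p qu st hd tl x sp mk) (h : 0 < hd) : x < n := by
  rw [I.x_eq h]
  have := I.hd_le
  exact I.qu_lt _ (by omega)

theorem d_x_ne (I : X.Inv u d p qu st hd tl x sp mk) (h : 0 < hd) : d x ≠ n := by
  have := I.hd_le
  refine (I.found_iff x (I.x_lt h)).2 ⟨hd - 1, by omega, (I.x_eq h).symm⟩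

/-- The queue holds distinct vertices, and `v` is not among them. This also keeps true distances
below the marker `n`, because the distance at place `i` of the queue is at most `i`. -/
theorem tl_lt (I : X.Inv u d p qu st hd tl x sp mk) {v : ℕ} (hv : v < n) (hd : d v = n) :
    tl < n := by
  have h1 : #((range tl).image qu) = tl := by
    rw [card_image_of_injOn, card_range]
    intro i hi j hj h
    exact I.qu_inj i (by simpa using hi) j (by simpa using hj) h
  have h2 : (range tl).image qu ⊂ range n := by
    refine (ssubset_iff_of_subset ?_).2 ⟨v, by simpa using hv, ?_⟩
    · intro y hy
      obtain ⟨i, hi, rfl⟩ := mem_image.1 hy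
      simpa using I.qu_lt i (by simpa using hi)
    · intro hy
      obtain ⟨i, hi, he⟩ := mem_image.1 hy
      exact (I.found_iff v hv).2 ⟨i, by simpa using hi, he⟩ hd
  have := card_lt_card h2
  rwa [h1, card_range] at this

open Classical in
theorem sp_bound (I : X.Inv u d p qu st hd tl x sp mk) : sp ≤ 2 * #X.nodes + 1 := by
  have := I.sp_le
  omega

/-- A neighbour of `x` is found. -/
theorem discover (I : X.Inv u d p qu st hd tl x sp mk) (h0 : 0 < hd) {v : ℕ} (hv : v < n)
    (hdv : d v = n) (ha : A x v) :
    X.Inv u (fun y => if y = v then d x + 1 else d y) (fun y => if y = v then x else p y)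
      (fun i => if i = tl then v else qu i) st hd (tl + 1) x sp mk := by
  have htl := I.tl_lt hv hdv
  have hdle := I.hd_le
  have hxe := I.x_eq h0
  have hx := I.x_lt h0
  have hdx := I.d_x_ne h0
  have hxv : x ≠ v := by rintro rfl; exact hdx hdv
  -- Hence `d x + 1 ≤ hd ≤ tl < n`: the new distance differs from the marker `n`.
  have hdx' : d x ≤ hd - 1 := by
    have := I.d_qu_le (hd - 1) (by omega)
    rwa [← hxe] at this
  have huv : u ≠ v := by
    rintro rfl
    have := I.d_u
    omega
  have hquv : ∀ i < tl, qu i ≠ v := by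
    rintro i hi rfl
    exact (I.found_iff _ hv).2 ⟨i, hi, rfl⟩ hdv
  constructor
  · exact I.u_lt
  · omega
  · omega
  · intro i hi
    split_ifs with h
    · exact hv
    · exact I.qu_lt i (by omega)
  · intro i hi j hj
    split_ifs with h1 h2 h2
    · omega
    · exact fun h => absurd h.symm (hquv j (by omega))
    · exact fun h => absurd h (hquv i (by omega))
    · exact I.qu_inj i (by omega) j (by omega)
  · intro y hy
    constructor
    · intro h
      by_cases hyv : y = v
      · exact ⟨tl, by omega, by simp [hyv]⟩
      · rw [if_neg hyv] at h
        obtain ⟨i, hi, he⟩ := (I.found_iff y hy).1 h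
        exact ⟨i, by omega, by rw [if_neg (by omega), he]⟩
    · rintro ⟨i, hi, he⟩
      by_cases hyv : y = v
      · rw [if_pos hyv]; omega
      · have : i ≠ tl := by rintro rfl; rw [if_pos rfl] at he; exact hyv he.symm
        rw [if_neg this] at he
        rw [if_neg hyv]
        exact (I.found_iff y hy).2 ⟨i, by omega, he⟩
  · rw [if_neg huv]; exact I.d_u
  · rw [if_neg huv]; exact I.p_u
  · intro y hy
    split_ifs
    · omega
    · exact I.p_eq y hy
  · omega
  · intro _
    rw [if_neg (by omega)]
    exact hxe
  · intro i hi
    by_cases h : i = tl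
    · rw [if_pos (if_pos h)]; omega
    · rw [if_neg h, if_neg (hquv i (by omega))]
      exact I.d_qu_le i (by omega)
  · intro i j hij hj
    by_cases h : j = tl
    · rw [if_pos h, if_pos rfl]
      by_cases h' : i = tl
      · rw [if_pos h', if_pos rfl]
      · rw [if_neg h', if_neg (hquv i (by omega))]
        exact I.d_le_x h0 i (by omega)
    · rw [if_neg h, if_neg (hquv j (by omega)), if_neg (show i ≠ tl by omega),
        if_neg (hquv i (by omega))]
      exact I.d_mono i j hij (by omega)
  · intro _ i hi
    rw [if_neg hxv]
    by_cases h : i = tl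
    · rw [if_pos h, if_pos rfl]
    · rw [if_neg h, if_neg (hquv i (by omega))]
      exact I.d_le_x h0 i (by omega)
  · intro y hy
    by_cases h : y = v
    · subst h
      intro _ _
      rw [if_pos rfl, if_pos rfl, if_neg hxv]
      exact ⟨hx, ha, hdx, rfl⟩
    · rw [if_neg h, if_neg h]
      intro h1 h2
      obtain ⟨h3, h4, h5, h6⟩ := I.parent y hy h1 h2
      have : p y ≠ v := by intro he; exact h5 (he ▸ hdv)
      rw [if_neg this]
      exact ⟨h3, h4, h5, h6⟩
  · intro i hi y hy
    rw [if_neg (by omega), if_neg (hquv i (by omega))]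
    intro hA
    have h1 := I.finished i hi y hy hA
    have : y ≠ v := by rintro rfl; exact h1.1 hdv
    rw [if_neg this]
    exact h1
  · exact I.mk_mem
  · intro h h1 h2
    split_ifs
    · omega
    · exact I.mk_cell h h1 h2
  · exact I.mk_edge
  · intro i hi
    rw [if_neg (by omega)]
    exact I.mk_root i hi
  · exact I.stack
  · exact I.sp_le

/-- A node on the stack is skipped. -/
theorem pop (I : X.Inv u d p qu st hd tl x (sp + 1) mk) (h : st sp = 0 ∨ mk (st sp)) :
    X.Inv u d p qu st hd tl x sp mk := by
  have key : ∀ b, b ≠ 0 → (mk b ∨ ∃ i < sp + 1, st i = b) → mk b ∨ ∃ i < sp, st i = b := by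
    rintro b hb (h1 | ⟨i, hi, rfl⟩)
    · exact .inl h1
    · rcases Nat.lt_succ_iff_lt_or_eq.1 hi with h2 | rfl
      · exact .inr ⟨i, h2, rfl⟩
      · exact .inl (h.resolve_left hb)
  exact { I with
    start := fun h => by have := (I.start h).2.1; omega
    mk_edge := fun h h1 h' h2 => key _ h2.2.1 (I.mk_edge h h1 h' h2)
    mk_root := fun i hi h => key _ h (I.mk_root i hi h)
    stack := fun i hi => I.stack i (by omega)
    sp_le := by have := I.sp_le; omega }

open Classical in
theorem card_mark {mk : ℕ → Prop} {S : Finset ℕ} {h : ℕ} (hS : h ∈ S) (hm : ¬ mk h) :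
    #{a ∈ S | ¬ (mk a ∨ a = h)} + 1 = #{a ∈ S | ¬ mk a} := by
  have : ({a ∈ S | ¬ mk a} : Finset ℕ) = insert h {a ∈ S | ¬ (mk a ∨ a = h)} := by
    ext a
    simp only [mem_filter, mem_insert]
    by_cases hah : a = h
    · subst hah; simp [hS, hm]
    · simp [hah]
  rw [this, card_insert_of_notMem (by simp)]

/-- A cell whose label has been found is marked. -/
theorem mark_cell' (I : X.Inv u d p qu st hd tl x (sp + 1) mk) {h : ℕ} (hh : st sp = h)
    (h0 : h ≠ 0) (hm : ¬ mk h) (hc : X.cell h) (hl : d (X.label h) ≠ n) :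
    X.Inv u d p qu st hd tl x sp (fun a => mk a ∨ a = h) := by
  classical
  have hmem := (I.stack sp (by omega) (hh ▸ h0)).1
  rw [hh] at hmem
  have key : ∀ b, (mk b ∨ ∃ i < sp + 1, st i = b) → (mk b ∨ b = h) ∨ ∃ i < sp, st i = b := by
    rintro b (h1 | ⟨i, hi, rfl⟩)
    · exact .inl (.inl h1)
    · rcases Nat.lt_succ_iff_lt_or_eq.1 hi with h2 | rfl
      · exact .inr ⟨i, h2, rfl⟩
      · exact .inl (.inr hh)
  exact { I with
    start := fun h => by have := (I.start h).2.1; omega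
    mk_mem := by rintro a (ha | rfl); exacts [I.mk_mem a ha, hmem]
    mk_cell := by rintro a (ha | rfl) h1; exacts [I.mk_cell a ha h1, hl]
    mk_edge := by
      rintro a (ha | rfl) b hb
      · exact key _ (I.mk_edge a ha b hb)
      · exact absurd hc hb.1
    mk_root := fun i hi h => key _ (I.mk_root i hi h)
    stack := fun i hi => I.stack i (by omega)
    sp_le := by
      have := I.sp_le
      have h2 := card_mark hmem hm
      convert (show sp + 2 * #{a ∈ X.nodes | ¬ (mk a ∨ a = h)} ≤ 2 * #X.nodes + 1 by omega) }

/-- An inner node is marked, and its children are put on the stack. -/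
theorem mark_inner (I : X.Inv u d p qu st hd tl x (sp + 1) mk) {h : ℕ} (hh : st sp = h)
    (h0 : h ≠ 0) (hm : ¬ mk h) (hc : ¬ X.cell h) :
    X.Inv u d p qu
      (fun i => if i = sp + 1 then X.right h else if i = sp then X.left h else st i)
      hd tl x (sp + 2) (fun a => mk a ∨ a = h) := by
  classical
  obtain ⟨hmem, hr, hreach⟩ := I.stack sp (by omega) (hh ▸ h0)
  rw [hh] at hmem hreach
  have key : ∀ b, (mk b ∨ ∃ i < sp + 1, st i = b) → (mk b ∨ b = h) ∨ ∃ i < sp + 2,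
      (if i = sp + 1 then X.right h else if i = sp then X.left h else st i) = b := by
    rintro b (h1 | ⟨i, hi, rfl⟩)
    · exact .inl (.inl h1)
    · rcases Nat.lt_succ_iff_lt_or_eq.1 hi with h2 | rfl
      · exact .inr ⟨i, by omega, by rw [if_neg (by omega), if_neg (by omega)]⟩
      · exact .inl (.inr hh)
  exact { I with
    start := fun h => by have := (I.start h).2.1; omega
    mk_mem := by rintro a (ha | rfl); exacts [I.mk_mem a ha, hmem]
    mk_cell := by rintro a (ha | rfl) h1; exacts [I.mk_cell a ha h1, absurd h1 hc]
    mk_edge := by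
      rintro a (ha | rfl) b hb
      · exact key _ (I.mk_edge a ha b hb)
      · right
        obtain ⟨_, _, rfl | rfl⟩ := hb
        · exact ⟨sp, by omega, by rw [if_neg (by omega), if_pos rfl]⟩
        · exact ⟨sp + 1, by omega, by rw [if_pos rfl]⟩
    mk_root := fun i hi h => key _ (I.mk_root i hi h)
    stack := by
      intro i hi
      split_ifs with h1 h2
      · intro h3
        have he : X.Edge h (X.right h) := ⟨hc, h3, .inr rfl⟩
        exact ⟨edge_mem hmem he, hr, hreach.tail he⟩
      · intro h3
        have he : X.Edge h (X.left h) := ⟨hc, h3, .inl rfl⟩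
        exact ⟨edge_mem hmem he, hr, hreach.tail he⟩
      · exact I.stack i (by omega)
    -- One entry is popped and two are pushed; the marked node counted twice among the unmarked ones
    -- and pays for this.
    sp_le := by
      have := I.sp_le
      have h2 := card_mark hmem hm
      convert (show sp + 2 + 2 * #{a ∈ X.nodes | ¬ (mk a ∨ a = h)} ≤ 2 * #X.nodes + 1 by omega) }

/-- When the stack is empty, all neighbours of `x` have been found. -/
theorem finished_of_stack_empty (I : X.Inv u d p qu st hd tl x 0 mk) {i : ℕ} (hi : i < hd)
    {v : ℕ} (hv : v < n) (hA : A (qu i) v) : d v ≠ n ∧ d v ≤ d (qu i) + 1 := by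
  have hle := I.hd_le
  rcases Nat.lt_or_ge (i + 1) hd with h | h
  · exact I.finished i h v hv hA
  · have hx : x = qu i := by
      rw [I.x_eq (by omega)]; congr 1; omega
    obtain ⟨h0, c, hr, hc, rfl⟩ := (X.related_iff (I.qu_lt i (by omega)) hv).1 hA
    -- With an empty stack the marked nodes are closed under edges. Nodes marked on behalf of
    -- earlier vertices do no harm: their labels were found, and no found distance exceeds `d x +
    -- 1`.
    have hmk : ∀ c, X.Reach (X.root (qu i)) c → mk c := by
      intro c hr
      induction hr with
      | refl => exact (I.mk_root i hi h0).resolve_right (by simp)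
      | tail _ he ih => exact (I.mk_edge _ ih _ he).resolve_right (by simp)
    have hd := I.mk_cell c (hmk c hr) hc
    obtain ⟨j, hj, he⟩ := (I.found_iff _ hv).1 hd
    refine ⟨hd, ?_⟩
    have := I.d_le_x (by omega) j hj
    rwa [he, hx] at this

/-- The next vertex of the queue is processed. -/
theorem dequeue (I : X.Inv u d p qu st hd tl x 0 mk) (h : hd < tl) :
    X.Inv u d p qu (fun i => if i = 0 then X.root (qu hd) else st i) (hd + 1) tl (qu hd) 1 mk := by
  classical
  have hlt := I.qu_lt hd h
  exact { I with
    hd_le := h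
    start := by omega
    x_eq := fun _ => rfl
    d_le_x := by
      intro _ i hi
      rcases Nat.eq_zero_or_pos hd with h0 | h0
      · have := (I.start h0).1
        obtain rfl : i = hd := by omega
        omega
      · have h1 := I.d_le_x h0 i hi
        -- Distances increase along the queue, so the bound in terms of the old `x` carries over to
        -- the new one.
        have h2 := I.d_mono (hd - 1) hd (by omega) h
        rw [← I.x_eq h0] at h2
        omega
    finished := fun i hi v hv hA => I.finished_of_stack_empty (by omega) hv hA
    mk_edge := fun a ha b hb => .inl ((I.mk_edge a ha b hb).resolve_right (by simp))
    mk_root := by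
      intro i hi h1
      rcases Nat.lt_succ_iff_lt_or_eq.1 hi with h2 | rfl
      · exact .inl ((I.mk_root i h2 h1).resolve_right (by simp))
      · exact .inr ⟨0, by omega, rfl⟩
    stack := by
      intro i hi
      rw [if_pos (by omega)]
      exact fun h0 => ⟨(X.root_mem _ hlt).resolve_left h0, h0, .refl⟩
    sp_le := by
      have := card_filter_le X.nodes (fun h => ¬ mk h)
      omega }

theorem congr {d' p' qu' st' : ℕ → ℕ} {mk' : ℕ → Prop} (I : X.Inv u d p qu st hd tl x sp mk)
    (h1 : ∀ v, d' v = d v) (h2 : ∀ v, p' v = p v) (h3 : ∀ i, qu' i = qu i)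
    (h4 : ∀ i, st' i = st i) (h5 : ∀ h, mk' h ↔ mk h) :
    X.Inv u d' p' qu' st' hd tl x sp mk' := by
  obtain rfl := funext h1
  obtain rfl := funext h2
  obtain rfl := funext h3
  obtain rfl := funext h4
  obtain rfl := funext fun h => propext (h5 h)
  exact I

theorem init (X : SearchNet n A) {u x : ℕ} (hu : u < n) {d p qu st : ℕ → ℕ} (hd0 : d u = 0)
    (hp0 : p u = u) (hd : ∀ v < n, v ≠ u → d v = n)
    (hp : ∀ v < n, v ≠ u → p v = n) (hq : qu 0 = u) :
    X.Inv u d p qu st 0 1 x 0 (fun _ => False) := by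
  classical
  constructor
  case found_iff =>
    intro v hv
    by_cases h : v = u
    · subst h
      exact ⟨fun _ => ⟨0, by omega, hq⟩, fun _ => by omega⟩
    · refine ⟨fun h1 => absurd (hd v hv h) h1, ?_⟩
      rintro ⟨i, hi, rfl⟩
      obtain rfl : i = 0 := by omega
      exact absurd hq h
  case d_qu_le =>
    intro i hi
    obtain rfl : i = 0 := by omega
    rw [hq, hd0]
  case d_mono =>
    intro i j _ hj
    obtain rfl : j = 0 := by omega
    obtain rfl : i = 0 := by omega
    rfl
  case p_eq =>
    intro v hv h
    by_cases h' : v = u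
    · subst h'; omega
    · exact hp v hv h'
  case parent => exact fun v hv h1 h2 => absurd (hd v hv h2) h1
  case qu_lt =>
    intro i hi
    obtain rfl : i = 0 := by omega
    rwa [hq]
  case qu_inj => intros; omega
  case start => exact fun _ => ⟨rfl, rfl, hq⟩
  case sp_le => simp
  all_goals first | assumption | omega | simp

end Inv

/-- The result of a breadth-first search from `u`. -/
structure IsTree (n : ℕ) (A : ℕ → ℕ → Prop) (u : ℕ) (d p : ℕ → ℕ) : Prop where
  d_u : d u = 0
  p_u : p u = u
  p_eq : ∀ v < n, d v = n → p v = n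
  parent : ∀ v < n, d v ≠ n → v ≠ u → p v < n ∧ A (p v) v ∧ d (p v) ≠ n ∧ d (p v) + 1 = d v
  closed : ∀ v < n, d v ≠ n → ∀ v' < n, A v v' → d v' ≠ n ∧ d v' ≤ d v + 1

theorem Inv.isTree {X : SearchNet n A} {u : ℕ} {d p qu st : ℕ → ℕ} {tl x : ℕ} {mk : ℕ → Prop}
    (I : X.Inv u d p qu st tl tl x 0 mk) : IsTree n A u d p where
  d_u := I.d_u
  p_u := I.p_u
  p_eq := I.p_eq
  parent := I.parent
  closed := by
    intro v hv h v' hv' hA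
    obtain ⟨i, hi, rfl⟩ := (I.found_iff v hv).1 h
    exact I.finished_of_stack_empty hi hv' hA

theorem IsTree.congr {u : ℕ} {d p d' p' : ℕ → ℕ} (hu : u < n) (h : IsTree n A u d p)
    (hd : ∀ v < n, d' v = d v) (hp : ∀ v < n, p' v = p v) : IsTree n A u d' p' where
  d_u := (hd u hu).trans h.d_u
  p_u := (hp u hu).trans h.p_u
  p_eq v hv := by rw [hd v hv, hp v hv]; exact h.p_eq v hv
  parent v hv h1 h2 := by
    rw [hd v hv] at h1
    obtain ⟨h3, h4⟩ := h.parent v hv h1 h2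
    rw [hp v hv, hd v hv, hd _ h3]
    exact ⟨h3, h4⟩
  closed v hv h1 v' hv' hA := by
    rw [hd v hv] at h1 ⊢
    rw [hd v' hv']
    exact h.closed v hv h1 v' hv' hA

end SearchNet

/-- Following parents from a found vertex yields a walk from `u` of length `d`, so `d` is at least
the distance (`low`). As `d` grows by at most one along each edge, it is at most the length of every
walk from `u` (`up`). -/
theorem SearchNet.IsTree.correct {n : ℕ} {G : SimpleGraph (Fin n)} {u : Fin n} {d p : ℕ → ℕ}
    (h : IsTree n (fun x v => ∃ a b : Fin n, (a : ℕ) = x ∧ (b : ℕ) = v ∧ G.Adj a b) u d p)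
    (v : Fin n) :
    (G.Reachable u v → d v = G.dist u v) ∧
    (G.Reachable u v → u ≠ v → ∃ x : Fin n, p v = x ∧ G.Adj x v ∧
      G.Reachable u x ∧ G.dist u x + 1 = G.dist u v) ∧
    (u = v → p v = u) ∧ (¬ G.Reachable u v → d v = n ∧ p v = n) := by
  have hn : d u ≠ n := by have := h.d_u; have := u.2; omega
  have low : ∀ k (v : Fin n), d v = k → d v ≠ n → G.Reachable u v ∧ G.dist u v ≤ k := by
    intro k
    induction k with
    | zero =>
      intro v hv hne
      by_cases huv : u = v
      · subst huv; exact ⟨.refl _, by simp⟩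
      · obtain ⟨_, _, _, h4⟩ := h.parent v v.2 hne (fun he => huv (Fin.ext he.symm))
        omega
    | succ k ih =>
      intro v hv hne
      have huv : (v : ℕ) ≠ u := by
        intro he
        rw [he, h.d_u] at hv
        omega
      obtain ⟨_, ⟨a, b, ha, hb, hab⟩, h3, h4⟩ := h.parent v v.2 hne huv
      obtain rfl := Fin.ext hb
      rw [← ha] at h3 h4
      obtain ⟨h5, h6⟩ := ih a (by omega) h3
      refine ⟨h5.trans hab.reachable, ?_⟩
      obtain ⟨W, hW⟩ := h5.exists_walk_length_eq_dist
      have := SimpleGraph.dist_le (W.concat hab)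
      rw [SimpleGraph.Walk.length_concat] at this
      omega
  have up : ∀ {a b : Fin n} (W : G.Walk a b), d a ≠ n → d b ≠ n ∧ d b ≤ d a + W.length := by
    intro a b W
    induction W with
    | nil => exact fun h => ⟨h, by simp⟩
    | @cons a c b hac W ih =>
      intro ha
      obtain ⟨h1, h2⟩ := h.closed a a.2 ha c c.2 ⟨a, c, rfl, rfl, hac⟩
      obtain ⟨h3, h4⟩ := ih h1
      refine ⟨h3, ?_⟩
      rw [SimpleGraph.Walk.length_cons]
      omega
  have eq : ∀ v, G.Reachable u v → d v ≠ n ∧ d v = G.dist u v := by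
    intro v hr
    obtain ⟨W, hW⟩ := hr.exists_walk_length_eq_dist
    obtain ⟨h1, h2⟩ := up W hn
    have h3 := (low _ v rfl h1).2
    have h4 := h.d_u
    exact ⟨h1, by omega⟩
  refine ⟨fun hr => (eq v hr).2, fun hr huv => ?_, ?_, fun hr => ?_⟩
  · obtain ⟨h1, h2⟩ := eq v hr
    obtain ⟨_, ⟨a, b, ha, hb, hab⟩, h3, h4⟩ := h.parent v v.2 h1 (fun he => huv (Fin.ext he.symm))
    obtain rfl := Fin.ext hb
    rw [← ha] at h3 h4
    have h5 := (low _ a rfl h3).1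
    exact ⟨a, ha.symm, hab, h5, by rw [← (eq a h5).2, h4, h2]⟩
  · rintro rfl; exact h.p_u
  · have : d v = n := by
      by_contra hne
      exact hr (low _ v rfl hne).1
    exact ⟨this, h.p_eq v v.2 this⟩

end

end

noncomputable section

/-! ### The breadth-first search as a program

The scalars `10`, `11`, `12` hold the number `n` of vertices, `2 * S` and `S`; the scalar `30` holds
the source. The arrays `8`, `10`, `12` hold the positions of the vertices, the table of the segment
trees, and the vertices of the cells. The array `11` holds the last source for which a node has been
searched, the arrays `13` and `14` hold the queue and the stack. -/

namespace WordRAM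

open WordRAM.Expr Prog BinOp Finset

/-- The index of the vertex `y` in the row of the source. -/
def rowIdx (y : ℕ) : Expr := op add (op mul (var 30) (var 10)) (var y)

/-- The index of the left child of a node. -/
def leftIdx : Expr := op sub (op add (var 36) (var 37)) (var 11)

/-- Find the vertex of a cell. -/
def bfsVisit : Prog :=
  seq (assign 38 (get 12 (var 37)))
    (ite (op eq (get 0 (rowIdx 38)) (var 10))
      (seq (store 0 (rowIdx 38) (op add (get 0 (rowIdx 34)) (const 1)))
      (seq (store 1 (rowIdx 38) (var 34))
      (seq (store 13 (var 33) (var 38))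
        (assign 33 (op add (var 33) (const 1))))))
      skip)

/-- Put the children of a node on the stack. -/
def bfsExpand : Prog :=
  seq (store 14 (var 35) (get 10 leftIdx))
  (seq (store 14 (op add (var 35) (const 1)) (get 10 (op add leftIdx (const 1))))
    (assign 35 (op add (var 35) (const 2))))

/-- Process the topmost node of the stack. -/
def bfsPop : Prog :=
  seq (assign 35 (op sub (var 35) (const 1)))
  (seq (assign 36 (get 14 (var 35)))
  (ite (var 36)
    (ite (op eq (get 11 (var 36)) (op add (var 30) (const 1)))
      skip
      (seq (store 11 (var 36) (op add (var 30) (const 1)))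
      (seq (assign 37 (op mod (var 36) (var 11)))
        (ite (op lt (var 37) (var 12)) bfsVisit bfsExpand))))
    skip))

/-- Process the next vertex of the queue. -/
def bfsDequeue : Prog :=
  seq (assign 34 (get 13 (var 32)))
  (seq (assign 32 (op add (var 32) (const 1)))
  (seq (store 14 (const 0) (get 10 (op add
      (op mul (op add (get 8 (var 34)) (const 2)) (var 11)) (op sub (var 11) (const 2)))))
    (assign 35 (const 1))))

/-- The main loop of the search. -/
def bfsLoop : Prog :=
  .while (op or (op lt (const 0) (var 35)) (op lt (var 32) (var 33)))
    (ite (var 35) bfsPop bfsDequeue)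

/-- The search from the source. -/
def bfsFrom : Prog :=
  seq (store 0 (rowIdx 30) (const 0))
  (seq (store 1 (rowIdx 30) (var 30))
  (seq (store 13 (const 0) (var 30))
  (seq (assign 32 (const 0))
  (seq (assign 33 (const 1))
  (seq (assign 35 (const 0)) bfsLoop)))))

/-- The searches from all sources. -/
def bfsAll : Prog := forLoop 30 31 (var 10) bfsFrom

variable {n : ℕ} {A : ℕ → ℕ → Prop} {X : SearchNet n A} {S w : ℕ}

/-- The memory contains the net `X`. -/
structure HoldsNet (X : SearchNet n A) (S : ℕ) (s : State) : Prop where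
  n_eq : s.var 10 = n
  S2_eq : s.var 11 = 2 * S
  S_eq : s.var 12 = S
  S_pos : 0 < S
  pos_lt : ∀ x < n, s.arr 8 x < n
  root : ∀ x < n, s.arr 10 ((s.arr 8 x + 2) * (2 * S) + (2 * S - 2)) = X.root x
  cell : ∀ h ∈ X.nodes, X.cell h ↔ h % (2 * S) < S
  left : ∀ h ∈ X.nodes, ¬ X.cell h → s.arr 10 (h + h % (2 * S) - 2 * S) = X.left h
  right : ∀ h ∈ X.nodes, ¬ X.cell h → s.arr 10 (h + h % (2 * S) - 2 * S + 1) = X.right h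
  label : ∀ h ∈ X.nodes, X.cell h → s.arr 12 (h % (2 * S)) = X.label h
  lt : ∀ h ∈ X.nodes, h < (n + 2) * (2 * S)

theorem HoldsNet.congr {s s' : State} (H : HoldsNet X S s) (h1 : s'.var 10 = s.var 10)
    (h2 : s'.var 11 = s.var 11) (h3 : s'.var 12 = s.var 12) (h4 : ∀ i, s'.arr 8 i = s.arr 8 i)
    (h5 : ∀ i, s'.arr 10 i = s.arr 10 i) (h6 : ∀ i, s'.arr 12 i = s.arr 12 i) :
    HoldsNet X S s' := by
  replace h4 := funext h4
  replace h5 := funext h5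
  replace h6 := funext h6
  constructor
  · rw [h1]; exact H.n_eq
  · rw [h2]; exact H.S2_eq
  · rw [h3]; exact H.S_eq
  · exact H.S_pos
  · rw [h4]; exact H.pos_lt
  · rw [h4, h5]; exact H.root
  · exact H.cell
  · rw [h5]; exact H.left
  · rw [h5]; exact H.right
  · rw [h6]; exact H.label
  · exact H.lt

theorem HoldsNet.card_le {s : State} (H : HoldsNet X S s) : #X.nodes ≤ (n + 2) * (2 * S) := by
  have : X.nodes ⊆ range ((n + 2) * (2 * S)) := fun h hh => mem_range.2 (H.lt h hh)
  simpa using card_le_card this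

/-- The words are long enough for the search. -/
def Fits (n S w : ℕ) : Prop := 4 * ((n + 2) * (2 * S)) + n * n + 10 ≤ 2 ^ w

/-- The state of the memory `s` during the search from `u` that was started in `s₀`. -/
structure BfsState (X : SearchNet n A) (S u : ℕ) (s₀ s : State) : Prop where
  net : HoldsNet X S s
  u_eq : s.var 30 = u
  bound_eq : s.var 31 = s₀.var 31
  row0 : ∀ k, k < u * n ∨ u * n + n ≤ k → s.arr 0 k = s₀.arr 0 k
  row1 : ∀ k, k < u * n ∨ u * n + n ≤ k → s.arr 1 k = s₀.arr 1 k
  -- A mark records the source, shifted by one to differ from the initial `0`, so the marks need not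
  -- be erased between two sources.
  marks : ∀ h, s.arr 11 h = s₀.arr 11 h ∨ s.arr 11 h = u + 1
  inv : X.Inv u (fun v => s.arr 0 (u * n + v)) (fun v => s.arr 1 (u * n + v)) (s.arr 13)
    (s.arr 14) (s.var 32) (s.var 33) (s.var 34) (s.var 35)
    (fun h => h ∈ X.nodes ∧ s.arr 11 h = u + 1)

/-- The potential that pays for the search. -/
def bfsPotential (X : SearchNet n A) (u : ℕ) (s : State) : ℕ :=
  -- Every round loses at least one unit of 100 steps. Dequeuing loses 2 and pushes one entry;
  -- skipping pops one entry; marking loses 3 and enlarges the stack by at most one.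
  100 * (2 * (n - s.var 32) + s.var 35 + 3 * #{h ∈ X.nodes | ¬ s.arr 11 h = u + 1})

theorem card_unmarked {a : ℕ → ℕ} {c h : ℕ} {T : Finset ℕ} (hT : h ∈ T) (hm : a h ≠ c) :
    #{x ∈ T | ¬ (if x = h then c else a x) = c} + 1 = #{x ∈ T | ¬ a x = c} := by
  have : ({x ∈ T | ¬ a x = c} : Finset ℕ) =
      insert h {x ∈ T | ¬ (if x = h then c else a x) = c} := by
    ext x
    simp only [mem_filter, mem_insert]
    by_cases hx : x = h
    · subst hx; simp [hT, hm]
    · simp [hx]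
  rw [this, card_insert_of_notMem (by simp)]

theorem bfsPotential_same {u hd sp : ℕ} {s s' : State} (h1 : s'.var 32 = hd) (h2 : s'.var 35 = sp)
    (h3 : ∀ h, s'.arr 11 h = s.arr 11 h) :
    bfsPotential X u s' + 100 * (2 * (n - s.var 32) + s.var 35) =
      bfsPotential X u s + 100 * (2 * (n - hd) + sp) := by
  simp only [bfsPotential, funext h3, h1, h2]
  omega

theorem bfsPotential_mark {u hd sp h : ℕ} {s s' : State} (h1 : s'.var 32 = hd)
    (h2 : s'.var 35 = sp) (h3 : ∀ x, s'.arr 11 x = if x = h then u + 1 else s.arr 11 x)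
    (hh : h ∈ X.nodes) (hm : s.arr 11 h ≠ u + 1) :
    bfsPotential X u s' + 300 + 100 * (2 * (n - s.var 32) + s.var 35) =
      bfsPotential X u s + 100 * (2 * (n - hd) + sp) := by
  have := card_unmarked hh hm
  simp only [bfsPotential, funext h3, h1, h2]
  omega

section

variable {ω : ℕ → Fin (2 ^ w)} {u : ℕ} {s₀ s : State}

theorem row_lt (hu : u < n) {v : ℕ} (hv : v < n) : u * n + v < n * n := by
  have : (u + 1) * n ≤ n * n := Nat.mul_le_mul_right _ hu
  rw [add_mul, one_mul] at this
  omega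

theorem eval_rowIdx {y v : ℕ} (hfit : Fits n S w) (h30 : s.var 30 = u) (h10 : s.var 10 = n)
    (hy : s.var y = v) (hu : u < n) (hv : v < n) : (rowIdx y).eval w s = u * n + v := by
  have h1 := row_lt hu hv
  unfold Fits at hfit
  exact eval_add (eval_mul (eval_var h30) (eval_var h10) (by omega)) (eval_var hy) (by omega)

theorem run_bfsDequeue (hfit : Fits n S w) (B : BfsState X S u s₀ s) (hsp : s.var 35 = 0)
    (hlt : s.var 32 < s.var 33) :
    Run w ω bfsDequeue s fun s' t => t ≤ 50 ∧ BfsState X S u s₀ s' ∧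
      bfsPotential X u s' + 100 ≤ bfsPotential X u s := by
  have I := B.inv
  rw [hsp] at I
  have I' := I.dequeue hlt
  have htl := I.tl_le
  have hx := I.qu_lt _ hlt
  have hpos := B.net.pos_lt _ hx
  have hS := B.net.S_pos
  unfold Fits at hfit
  set x := s.arr 13 (s.var 32) with hxdef
  -- The row of `x` is version `position + 2`, and its root is the node `2 * S - 2`; the bound keeps
  -- this entry inside the table.
  have hmul : (s.arr 8 x + 2) * (2 * S) + 2 * S ≤ (n + 2) * (2 * S) := by
    have : (s.arr 8 x + 2 + 1) * (2 * S) ≤ (n + 2) * (2 * S) := Nat.mul_le_mul_right _ (by omega)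
    rw [add_mul _ 1] at this
    omega
  have hn2 : n + 2 ≤ (n + 2) * (2 * S) := Nat.le_mul_of_pos_right _ (by omega)
  refine Run.seq (Run.assign (v := x) rfl (Run.seq (Run.assign (v := s.var 32 + 1) ?_
    (Run.seq (Run.store (j := 0) (v := X.root x) ?_ ?_ (Run.assign (v := 1) ?_ ?_))))))
  · exact eval_add (eval_var (by simp)) (eval_const (by omega)) (by omega)
  · exact eval_const (by omega)
  · refine eval_get (j := (s.arr 8 x + 2) * (2 * S) + (2 * S - 2)) ?_ ?_
    · refine eval_add (eval_mul (eval_add (eval_get (eval_var (v := x) (by simp)) ?_)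
        (eval_const ?_) ?_) (eval_var ?_) ?_) (eval_sub (eval_var ?_) (eval_const ?_)) ?_
      any_goals first | rfl | omega
      all_goals simp [B.net.S2_eq]
    · simpa using B.net.root x hx
  · exact eval_const (by omega)
  · refine ⟨by simp [Expr.cost], ⟨?_, ?_, ?_, ?_, ?_, ?_, ?_⟩, ?_⟩
    · refine B.net.congr ?_ ?_ ?_ ?_ ?_ ?_ <;> simp
    · simp [B.u_eq]
    · simp [B.bound_eq]
    · simpa using B.row0
    · simpa using B.row1
    · simpa using B.marks
    · simp only [State.setVar_var, State.setArr_var, State.setVar_arr]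
      refine I'.congr ?_ ?_ ?_ ?_ ?_ <;> simp
    · have h1 := bfsPotential_same (X := X) (u := u) (s := s) (s' := (((s.setVar 34 x).setVar 32
        (s.var 32 + 1)).setArr 14 0 (X.root x)).setVar 35 1) (hd := s.var 32 + 1) (sp := 1)
        (by simp) (by simp) (by simp)
      omega

theorem run_bfsPop (hfit : Fits n S w) (B : BfsState X S u s₀ s) (hsp : s.var 35 ≠ 0) :
    Run w ω bfsPop s fun s' t => t ≤ 80 ∧ BfsState X S u s₀ s' ∧
      bfsPotential X u s' + 100 ≤ bfsPotential X u s := by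
  obtain ⟨sp, hsp⟩ := Nat.exists_eq_succ_of_ne_zero hsp
  have I := B.inv
  rw [hsp] at I
  have hu := I.u_lt
  have hcard := B.net.card_le
  have hspb := I.sp_bound
  have hhd := I.hd_pos (Nat.succ_pos _)
  have hx := I.x_lt hhd
  have hS := B.net.S_pos
  have hn2 : n + 2 ≤ (n + 2) * (2 * S) := Nat.le_mul_of_pos_right _ (by omega)
  have hfit' := hfit
  unfold Fits at hfit'
  have e1 : ∀ s' : State, s'.var 30 = u →
      (op add (var 30) (const 1)).eval w s' = u + 1 := fun s' h =>
    eval_add (eval_var h) (eval_const (by omega)) (by omega)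
  refine Run.seq (Run.assign (v := sp) ?_ (Run.seq (Run.assign (v := s.arr 14 sp) ?_ ?_)))
  · exact (eval_sub (eval_var hsp) (eval_const (by omega))).trans (by omega)
  · exact eval_get (j := sp) (eval_var (by simp)) (by simp)
  set h := s.arr 14 sp with hh
  have skipped : h = 0 ∨ (h ∈ X.nodes ∧ s.arr 11 h = u + 1) →
      BfsState X S u s₀ ((s.setVar 35 sp).setVar 36 h) ∧
        bfsPotential X u ((s.setVar 35 sp).setVar 36 h) + 100 ≤ bfsPotential X u s := by
    intro hcase
    have I' := I.pop hcase
    refine ⟨⟨?_, ?_, ?_, ?_, ?_, ?_, ?_⟩, ?_⟩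
    · refine B.net.congr ?_ ?_ ?_ ?_ ?_ ?_ <;> simp
    · simp [B.u_eq]
    · simp [B.bound_eq]
    · simpa using B.row0
    · simpa using B.row1
    · simpa using B.marks
    · simpa using I'
    · have h1 := bfsPotential_same (X := X) (u := u) (s := s) (s' := (s.setVar 35 sp).setVar 36 h)
        (hd := s.var 32) (sp := sp) (by simp) (by simp) (by simp)
      omega
  refine Run.ite (fun hne => ?_) (fun heq => ?_)
  swap
  · have h0 : h = 0 := by simpa [Expr.eval] using heq
    exact Run.skip ⟨by simp [Expr.cost], skipped (.inl h0)⟩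
  have h0 : h ≠ 0 := by simpa [Expr.eval] using hne
  have hmem : h ∈ X.nodes := (I.stack sp (Nat.lt_succ_self _) h0).1
  have hhlt := B.net.lt h hmem
  have hmodlt : h % (2 * S) < 2 * S := Nat.mod_lt _ (by omega)
  have emark : (op eq (get 11 (var 36)) (op add (var 30) (const 1))).eval w
      ((s.setVar 35 sp).setVar 36 h) = if s.arr 11 h = u + 1 then 1 else 0 :=
    eval_eq (eval_get (j := h) (eval_var (by simp)) (by simp)) (e1 _ (by simp [B.u_eq]))
  refine Run.ite (fun hne => ?_) (fun heq => ?_)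
  · have hmk : s.arr 11 h = u + 1 := by
      by_contra hc
      rw [emark, if_neg hc] at hne
      exact hne rfl
    exact Run.skip ⟨by simp [Expr.cost], skipped (.inr ⟨hmem, hmk⟩)⟩
  have hmk : s.arr 11 h ≠ u + 1 := by
    intro hc
    rw [emark, if_pos hc] at heq
    exact one_ne_zero heq
  have hcardm := card_unmarked hmem hmk
  have hmarkiff : ∀ a, (a ∈ X.nodes ∧ (if a = h then u + 1 else s.arr 11 a) = u + 1) ↔
      (a ∈ X.nodes ∧ s.arr 11 a = u + 1) ∨ a = h := by
    intro a
    by_cases ha : a = h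
    · simp [ha, hmem]
    · simp [ha]
  have potential_drop : ∀ {s' : State} {sp' : ℕ}, s'.var 32 = s.var 32 → s'.var 35 = sp' →
      (∀ x, s'.arr 11 x = if x = h then u + 1 else s.arr 11 x) → sp' ≤ sp + 2 →
      bfsPotential X u s' + 100 ≤ bfsPotential X u s := by
    intro s' sp' h1 h2 h3 h4
    have h5 := bfsPotential_mark h1 h2 h3 hmem hmk
    omega
  refine Run.seq (Run.store (j := h) (v := u + 1) (eval_var (by simp)) (e1 _ (by simp [B.u_eq]))
    (Run.seq (Run.assign (v := h % (2 * S)) ?_ ?_)))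
  · exact eval_mod (eval_var (by simp)) (eval_var (by simp [B.net.S2_eq]))
  set q := h % (2 * S) with hq
  set s₁ := (((s.setVar 35 sp).setVar 36 h).setArr 11 h (u + 1)).setVar 37 q with hs₁
  have ecell : (op lt (var 37) (var 12)).eval w s₁ = if q < S then 1 else 0 :=
    eval_lt (eval_var (by simp [hs₁])) (eval_var (by simp [hs₁, B.net.S_eq]))
  have hmarks : ∀ a, (if a = h then u + 1 else s.arr 11 a) = s₀.arr 11 a ∨
      (if a = h then u + 1 else s.arr 11 a) = u + 1 := by
    intro a
    split_ifs
    · exact .inr rfl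
    · exact B.marks a
  refine Run.ite (fun hne => ?_) (fun heq => ?_)
  · have hqS : q < S := by
      by_contra hc
      rw [ecell, if_neg hc] at hne
      exact hne rfl
    have hcell : X.cell h := (B.net.cell h hmem).2 hqS
    have hlab := B.net.label h hmem hcell
    have hvn := X.label_lt h hmem hcell
    set v := X.label h with hv
    refine Run.seq (Run.assign (v := v) (eval_get (j := q) (eval_var (by simp [hs₁]))
      (by simpa [hs₁] using hlab)) ?_)
    have erow : (op eq (get 0 (rowIdx 38)) (var 10)).eval w (s₁.setVar 38 v) =
        if s.arr 0 (u * n + v) = n then 1 else 0 :=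
      eval_eq (eval_get (eval_rowIdx hfit (by simp [hs₁, B.u_eq]) (by simp [hs₁, B.net.n_eq])
        (by simp) hu hvn) (by simp [hs₁])) (eval_var (by simp [hs₁, B.net.n_eq]))
    refine Run.ite (fun hne => ?_) (fun heq => ?_)
    · have hdv : s.arr 0 (u * n + v) = n := by
        by_contra hc
        rw [erow, if_neg hc] at hne
        exact hne rfl
      obtain ⟨_, hr0, hreach⟩ := I.stack sp (Nat.lt_succ_self _) h0
      have hA : A (s.var 34) v := (X.related_iff hx hvn).2 ⟨hr0, h, hreach, hcell, rfl⟩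
      have I₁ := I.discover hhd hvn hdv hA
      -- After the discovery the label has distance `d x + 1 ≤ hd ≤ tl < n`, so it counts as found
      -- and its cell may be marked.
      have I₂ := I₁.mark_cell' hh.symm h0 (fun hc => hmk hc.2) hcell (by
        have hdx := I.d_qu_le (s.var 32 - 1) (by have := I.hd_le; omega)
        rw [← I.x_eq hhd] at hdx
        have := I.hd_le
        have := I.tl_lt hvn hdv
        rw [if_pos rfl]
        omega)
      have htl := I.tl_lt hvn hdv
      have hdx : s.arr 0 (u * n + s.var 34) + 1 < 2 ^ w := by
        have h1 := I.d_qu_le (s.var 32 - 1) (by have := I.hd_le; omega)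
        rw [← I.x_eq hhd] at h1
        have := I.hd_le
        omega
      refine Run.seq (Run.store (j := u * n + v) (v := s.arr 0 (u * n + s.var 34) + 1) ?_ ?_
        (Run.seq (Run.store (j := u * n + v) (v := s.var 34) ?_ ?_
        (Run.seq (Run.store (j := s.var 33) (v := v) ?_ ?_
        (Run.assign (v := s.var 33 + 1) ?_ ?_))))))
      · exact eval_rowIdx hfit (by simp [hs₁, B.u_eq]) (by simp [hs₁, B.net.n_eq])
          (by simp) hu hvn
      · exact eval_add (eval_get (eval_rowIdx hfit (by simp [hs₁, B.u_eq])
          (by simp [hs₁, B.net.n_eq]) (v := s.var 34) (by simp [hs₁]) hu hx) (by simp [hs₁]))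
          (eval_const (by omega)) hdx
      · exact eval_rowIdx hfit (by simp [hs₁, B.u_eq]) (by simp [hs₁, B.net.n_eq])
          (by simp) hu hvn
      · exact eval_var (by simp [hs₁])
      · exact eval_var (by simp [hs₁])
      · exact eval_var (by simp)
      · exact eval_add (eval_var (by simp [hs₁])) (eval_const (by omega)) (by omega)
      · refine ⟨by simp [Expr.cost, rowIdx], ⟨?_, ?_, ?_, ?_, ?_, ?_, ?_⟩, ?_⟩
        · refine B.net.congr ?_ ?_ ?_ ?_ ?_ ?_ <;> simp [hs₁]
        · simp [hs₁, B.u_eq]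
        · simp [hs₁, B.bound_eq]
        · intro k hk
          have : k ≠ u * n + v := by omega
          simpa [hs₁, this] using B.row0 k hk
        · intro k hk
          have : k ≠ u * n + v := by omega
          simpa [hs₁, this] using B.row1 k hk
        · simpa [hs₁] using hmarks
        · simp only [hs₁, State.setVar_var, State.setArr_var, State.setVar_arr]
          refine I₂.congr ?_ ?_ ?_ ?_ ?_ <;> first | (simp; done) | simpa using hmarkiff
        · refine potential_drop (sp' := sp) ?_ ?_ ?_ ?_ <;> simp [hs₁]
    · have hdv : s.arr 0 (u * n + v) ≠ n := by
        intro hc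
        rw [erow, if_pos hc] at heq
        exact one_ne_zero heq
      have I₂ := I.mark_cell' hh.symm h0 (fun hc => hmk hc.2) hcell hdv
      refine Run.skip ⟨by simp [Expr.cost, rowIdx], ⟨?_, ?_, ?_, ?_, ?_, ?_, ?_⟩, ?_⟩
      · refine B.net.congr ?_ ?_ ?_ ?_ ?_ ?_ <;> simp [hs₁]
      · simp [hs₁, B.u_eq]
      · simp [hs₁, B.bound_eq]
      · simpa [hs₁] using B.row0
      · simpa [hs₁] using B.row1
      · simpa [hs₁] using hmarks
      · simp only [hs₁, State.setVar_var, State.setArr_var, State.setVar_arr]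
        refine I₂.congr ?_ ?_ ?_ ?_ ?_ <;> first | (simp; done) | simpa using hmarkiff
      · refine potential_drop (sp' := sp) ?_ ?_ ?_ ?_ <;> simp [hs₁]
  · have hqS : ¬ q < S := by
      intro hc
      rw [ecell, if_pos hc] at heq
      exact one_ne_zero heq
    have hcell : ¬ X.cell h := fun hc => hqS ((B.net.cell h hmem).1 hc)
    have I₂ := I.mark_inner hh.symm h0 (fun hc => hmk hc.2) hcell
    have hl := B.net.left h hmem hcell
    have hr := B.net.right h hmem hcell
    rw [← hq] at hl hr
    have hS2 : 2 * S ≤ (n + 2) * (2 * S) := Nat.le_mul_of_pos_left _ (by omega)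
    have eleft : ∀ s' : State, s'.var 36 = h → s'.var 37 = q → s'.var 11 = 2 * S →
        leftIdx.eval w s' = h + q - 2 * S := fun s' h1 h2 h3 =>
      eval_sub (eval_add (eval_var (v := h) h1) (eval_var (v := q) h2) (by omega)) (eval_var h3)
    refine Run.seq (Run.store (j := sp) (v := X.left h) ?_ ?_
      (Run.seq (Run.store (j := sp + 1) (v := X.right h) ?_ ?_ (Run.assign (v := sp + 2) ?_ ?_))))
    · exact eval_var (by simp [hs₁])
    · exact eval_get (eleft _ (by simp [hs₁]) (by simp [hs₁]) (by simp [hs₁, B.net.S2_eq]))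
        (by simpa [hs₁] using hl)
    · exact eval_add (eval_var (by simp [hs₁])) (eval_const (by omega)) (by omega)
    · exact eval_get (eval_add (eleft _ (by simp [hs₁]) (by simp [hs₁])
        (by simp [hs₁, B.net.S2_eq])) (eval_const (by omega)) (by omega))
        (by simpa [hs₁] using hr)
    · exact eval_add (eval_var (by simp [hs₁])) (eval_const (by omega)) (by omega)
    · refine ⟨by simp [Expr.cost, leftIdx], ⟨?_, ?_, ?_, ?_, ?_, ?_, ?_⟩, ?_⟩
      · refine B.net.congr ?_ ?_ ?_ ?_ ?_ ?_ <;> simp [hs₁]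
      · simp [hs₁, B.u_eq]
      · simp [hs₁, B.bound_eq]
      · simpa [hs₁] using B.row0
      · simpa [hs₁] using B.row1
      · simpa [hs₁] using hmarks
      · simp only [hs₁, State.setVar_var, State.setArr_var, State.setVar_arr]
        refine I₂.congr ?_ ?_ ?_ ?_ ?_ <;> first | (simp; done) | simpa using hmarkiff
      · refine potential_drop (sp' := sp + 2) ?_ ?_ ?_ ?_ <;> simp [hs₁]

theorem run_bfsLoop (hfit : Fits n S w) (B : BfsState X S u s₀ s) :
    Run w ω bfsLoop s fun s' t => BfsState X S u s₀ s' ∧ s'.var 35 = 0 ∧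
      s'.var 32 = s'.var 33 ∧ t ≤ bfsPotential X u s + 20 := by
  have hw : 1 < 2 ^ w := by unfold Fits at hfit; omega
  have econd : ∀ s : State, (op or (op lt (const 0) (var 35)) (op lt (var 32) (var 33))).eval w s =
      (if 0 < s.var 35 then 1 else 0) ||| (if s.var 32 < s.var 33 then 1 else 0) := by
    intro s
    by_cases h1 : 0 < s.var 35 <;> by_cases h2 : s.var 32 < s.var 33 <;>
      simp [Expr.eval, BinOp.eval, h1, h2]
  refine (Run.while (BfsState X S u s₀) (bfsPotential X u) ?_ B).mono ?_
  · intro s B hc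
    refine (Run.ite (R := fun s' t => t ≤ 90 ∧ BfsState X S u s₀ s' ∧
      bfsPotential X u s' + 100 ≤ bfsPotential X u s) (fun hne => ?_) (fun heq => ?_)).mono ?_
    · refine (run_bfsPop hfit B hne).mono ?_
      rintro s' t ⟨h1, h2⟩
      exact ⟨by simp [Expr.cost]; omega, h2⟩
    · have hsp : s.var 35 = 0 := heq
      have hlt : s.var 32 < s.var 33 := by
        by_contra hcon
        rw [econd] at hc
        simp [hsp, hcon] at hc
      refine (run_bfsDequeue hfit B hsp hlt).mono ?_
      rintro s' t ⟨h1, h2⟩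
      exact ⟨by simp [Expr.cost]; omega, h2⟩
    · rintro s' t ⟨h1, h2, h3⟩
      exact ⟨h2, by simp [Expr.cost]; omega⟩
  · rintro s' t ⟨B', hc, ht⟩
    rw [econd] at hc
    have hle := B'.inv.hd_le
    refine ⟨B', ?_, ?_, ?_⟩
    · by_contra h
      simp [Nat.pos_of_ne_zero h] at hc
    · by_contra h
      have : s'.var 32 < s'.var 33 := by omega
      simp [this] at hc
    · simp [Expr.cost] at ht
      omega

end

/-- The trees from all sources are stored. -/
theorem run_bfsAll {ω : ℕ → Fin (2 ^ w)} {s : State} (hfit : Fits n S w) (hnet : HoldsNet X S s)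
    (h0 : ∀ k < n * n, s.arr 0 k = n) (h1 : ∀ k < n * n, s.arr 1 k = n)
    (hm : ∀ h ∈ X.nodes, s.arr 11 h = 0) :
    Run w ω bfsAll s fun s' t =>
      (∀ u < n, SearchNet.IsTree n A u (fun v => s'.arr 0 (u * n + v))
        (fun v => s'.arr 1 (u * n + v))) ∧
      t ≤ (n + 1) * (300 * (n + #X.nodes) + 200) := by
  have hfit' := hfit
  unfold Fits at hfit'
  have hS := hnet.S_pos
  have hn2 : n + 2 ≤ (n + 2) * (2 * S) := Nat.le_mul_of_pos_right _ (by omega)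
  refine (Run.forLoop n (300 * (n + #X.nodes) + 150) (fun u s' => HoldsNet X S s' ∧ s'.var 30 = u ∧
    s'.var 31 = n ∧ (∀ k, u * n ≤ k → k < n * n → s'.arr 0 k = n) ∧
    (∀ k, u * n ≤ k → k < n * n → s'.arr 1 k = n) ∧ (∀ h ∈ X.nodes, s'.arr 11 h ≤ u) ∧
    ∀ u' < u, SearchNet.IsTree n A u' (fun v => s'.arr 0 (u' * n + v))
        (fun v => s'.arr 1 (u' * n + v))) (eval_var hnet.n_eq) (by omega) ?_ ?_ ?_).mono ?_
  · refine ⟨?_, by simp, by simp, ?_, ?_, ?_, by simp⟩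
    · refine hnet.congr ?_ ?_ ?_ ?_ ?_ ?_ <;> simp
    · simpa using h0
    · simpa using h1
    · simpa using hm
  · exact fun k s h => ⟨h.2.1, h.2.2.1⟩
  · rintro u hu s ⟨hnet, h30, h31, h0, h1, hm, hT⟩
    have hrow : ∀ v < n, u * n + v < n * n := fun v hv => row_lt hu hv
    have erow : ∀ s' : State, s'.var 30 = u → s'.var 10 = n →
        (rowIdx 30).eval w s' = u * n + u := fun s' a b => eval_rowIdx hfit a b a hu hu
    refine Run.seq (Run.store (j := u * n + u) (v := 0) (erow _ h30 hnet.n_eq)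
      (eval_const (by omega))
      (Run.seq (Run.store (j := u * n + u) (v := u) (erow _ h30 hnet.n_eq) (eval_var h30)
      (Run.seq (Run.store (j := 0) (v := u) (eval_const (by omega)) (eval_var h30)
      (Run.seq (Run.assign (v := 0) (eval_const (by omega))
      (Run.seq (Run.assign (v := 1) (eval_const (by omega))
      (Run.seq (Run.assign (v := 0) (eval_const (by omega)) ?_)))))))))))
    set s₁ := ((((((s.setArr 0 (u * n + u) 0).setArr 1 (u * n + u) u).setArr 13 0 u).setVar 32
      0).setVar 33 1).setVar 35 0) with hs₁
    have B : BfsState X S u s s₁ := by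
      refine ⟨?_, ?_, ?_, ?_, ?_, ?_, ?_⟩
      · refine hnet.congr ?_ ?_ ?_ ?_ ?_ ?_ <;> simp [hs₁]
      · simp [hs₁, h30]
      · simp [hs₁]
      · intro k hk
        have : k ≠ u * n + u := by omega
        simp [hs₁, this]
      · intro k hk
        have : k ≠ u * n + u := by omega
        simp [hs₁, this]
      · simp [hs₁]
      · simp only [hs₁, State.setVar_var, State.setArr_var, State.setVar_arr]
        refine SearchNet.Inv.congr (SearchNet.Inv.init X (u := u) hu (d := fun v =>
          if v = u then 0 else s.arr 0 (u * n + v)) (p := fun v => if v = u then u else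
          s.arr 1 (u * n + v)) (qu := fun i => if i = 0 then u else s.arr 13 i)
          (st := s.arr 14) ?_ ?_ ?_ ?_ ?_) ?_ ?_ ?_ ?_ ?_
        any_goals simp
        · intro v hv hne
          rw [if_neg hne]
          exact h0 _ (by omega) (hrow v hv)
        · intro v hv hne
          rw [if_neg hne]
          exact h1 _ (by omega) (hrow v hv)
        -- Marks left by earlier sources are at most `u`, so initially nothing is marked with `u +
        -- 1`.
        · intro h hh he
          have := hm h hh
          omega
    refine (run_bfsLoop hfit B).mono ?_
    rintro s' t ⟨B', hsp, hq, ht⟩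
    have hT' := B'.inv
    rw [hsp, hq] at hT'
    refine ⟨?_, B'.u_eq, ?_, by simp, ?_, ?_, ?_, ?_, ?_⟩
    · have hc : #{h ∈ X.nodes | ¬ s₁.arr 11 h = u + 1} ≤ #X.nodes := card_filter_le _ _
      simp only [bfsPotential] at ht
      have h32 : s₁.var 32 = 0 := by simp [hs₁]
      have h35 : s₁.var 35 = 0 := by simp [hs₁]
      rw [h32, h35] at ht
      simp only [Expr.cost, rowIdx]
      omega
    · refine B'.net.congr ?_ ?_ ?_ ?_ ?_ ?_ <;> simp
    · simpa [B'.bound_eq] using h31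
    · intro k hk hk'
      rw [add_mul, one_mul] at hk
      rw [State.setVar_arr, B'.row0 k (by omega)]
      exact h0 k (by omega) hk'
    · intro k hk hk'
      rw [add_mul, one_mul] at hk
      rw [State.setVar_arr, B'.row1 k (by omega)]
      exact h1 k (by omega) hk'
    · intro h hh
      have := hm h hh
      rw [State.setVar_arr]
      rcases B'.marks h with h2 | h2 <;> omega
    · intro u' hu'
      rw [State.setVar_arr]
      rcases Nat.lt_succ_iff_lt_or_eq.1 hu' with h2 | rfl
      · have h3 := hT u' h2
        have h4 : (u' + 1) * n ≤ u * n := Nat.mul_le_mul_right _ h2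
        rw [add_mul, one_mul] at h4
        have e : ∀ v < n, s'.arr 0 (u' * n + v) = s.arr 0 (u' * n + v) ∧
            s'.arr 1 (u' * n + v) = s.arr 1 (u' * n + v) := fun v hv =>
          ⟨B'.row0 _ (by omega), B'.row1 _ (by omega)⟩
        exact h3.congr (by omega) (fun v hv => (e v hv).1) (fun v hv => (e v hv).2)
      · exact hT'.isTree
  · rintro s' t ⟨⟨_, _, _, _, _, _, hT⟩, ht⟩
    refine ⟨hT, ht.trans (Nat.mul_le_mul_left _ ?_)⟩
    simp only [Expr.cost]
    omega

end WordRAM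

end

noncomputable section

namespace WordRAM

open WordRAM.Expr Prog BinOp Finset

/-- The states `s` and `s'` differ at most in the scalars `20`, `21` and in the arrays in `l`. -/
def SameOutside (l : List ℕ) (s s' : State) : Prop :=
  (∀ x, x ≠ 20 → x ≠ 21 → s'.var x = s.var x) ∧ (∀ b, b ∉ l → s'.arr b = s.arr b)

theorem SameExcept.outside {a : ℕ} {s s' : State} (h : SameExcept 20 21 a s s') :
    SameOutside [a] s s' :=
  ⟨h.1, fun b hb => h.2.1 b (by simpa using hb)⟩

theorem SameOutside.trans {l l' : List ℕ} {s₁ s₂ s₃ : State} (h : SameOutside l s₁ s₂)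
    (h' : SameOutside l' s₂ s₃) : SameOutside (l ++ l') s₁ s₃ := by
  refine ⟨fun x h1 h2 => (h'.1 x h1 h2).trans (h.1 x h1 h2), fun b hb => ?_⟩
  rw [List.mem_append, not_or] at hb
  exact (h'.2 b hb.2).trans (h.2 b hb.1)

/-- Double loops run over a single index `j = k * b + v`; grouping by remainder, or by quotient as
in the next lemma, recovers the inner sums. -/
theorem sum_filter_mod_eq {a b v : ℕ} (hv : v < b) (f : ℕ → ℕ) :
    ∑ j ∈ range (a * b) with j % b = v, f j = ∑ k ∈ range a, f (k * b + v) := by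
  refine sum_nbij' (fun j => j / b) (fun k => k * b + v) ?_ ?_ ?_ ?_ ?_
  · intro j hj
    simp only [mem_filter, mem_range] at hj ⊢
    exact Nat.div_lt_of_lt_mul (by rw [mul_comm]; exact hj.1)
  · intro k hk
    simp only [mem_filter, mem_range] at hk ⊢
    have h : (k + 1) * b ≤ a * b := Nat.mul_le_mul_right _ hk
    rw [add_mul, one_mul] at h
    exact ⟨by omega, by rw [Nat.mul_add_mod', Nat.mod_eq_of_lt hv]⟩
  · intro j hj
    simp only [mem_filter, mem_range] at hj
    rw [← hj.2, Nat.div_add_mod']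
  · intro k _
    rw [mul_comm, Nat.mul_add_div (by omega), Nat.div_eq_of_lt hv, add_zero]
  · intro j hj
    simp only [mem_filter, mem_range] at hj
    rw [← hj.2, Nat.div_add_mod']

theorem sum_filter_div_eq {a b y : ℕ} (hy : y < a) (f : ℕ → ℕ) :
    ∑ j ∈ range (a * b) with j / b = y, f j = ∑ k ∈ range b, f (y * b + k) := by
  have hle : (y + 1) * b ≤ a * b := Nat.mul_le_mul_right _ hy
  rw [add_mul, one_mul] at hle
  rcases Nat.eq_zero_or_pos b with rfl | hb
  · simp
  refine sum_nbij' (fun j => j % b) (fun k => y * b + k) ?_ ?_ ?_ ?_ ?_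
  · intro j _
    simp only [mem_range]
    exact Nat.mod_lt _ hb
  · intro k hk
    simp only [mem_filter, mem_range] at hk ⊢
    exact ⟨by omega, by rw [mul_comm, Nat.mul_add_div hb, Nat.div_eq_of_lt hk, add_zero]⟩
  · intro j hj
    simp only [mem_filter, mem_range] at hj
    rw [← hj.2, Nat.div_add_mod']
  · intro k hk
    rw [mem_range] at hk
    rw [Nat.mul_add_mod', Nat.mod_eq_of_lt hk]
  · intro j hj
    simp only [mem_filter, mem_range] at hj
    rw [← hj.2, Nat.div_add_mod']

/-! ### The left-to-right order of the leaves -/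

/-- The array `5` gets the iterated parents of the leaves. -/
def iterProg : Prog :=
  tab 20 21 5 (op mul (var 0) (var 10))
    (sel (op lt (var 20) (var 10)) (get 1 (var 20)) (get 0 (get 5 (op sub (var 20) (var 10)))))

/-- The array `6` gets the numbers of leaves below the nodes. -/
def weightProg : Prog :=
  seq (tab 20 21 6 (var 0) (const 0))
    (scatter 20 21 6 (op mul (var 0) (var 10)) (get 5 (var 20)) (const 1))

/-- The loop variable divided by the number of nodes. -/
def quotExpr : Expr := op div (var 20) (var 0)

/-- The loop variable modulo the number of nodes. -/
def remExpr : Expr := op mod (var 20) (var 0)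

/-- The array `7` gets the numbers of leaves below smaller siblings. -/
def sibProg : Prog :=
  seq (tab 20 21 7 (var 0) (const 0))
    (scatter 20 21 7 (op mul (var 0) (var 0)) quotExpr
      (sel (op and (op eq (get 0 remExpr) (get 0 quotExpr)) (op and (op lt remExpr quotExpr)
        (op and (op eq (op eq remExpr (var 1)) (const 0))
          (op eq (op eq quotExpr (var 1)) (const 0)))))
        (get 6 remExpr) (const 0)))

/-- The array `8` gets the positions of the vertices. -/
def posProg : Prog :=
  seq (tab 20 21 8 (var 10) (const 0))
    (scatter 20 21 8 (op mul (var 0) (var 10)) (op mod (var 20) (var 10)) (get 7 (get 5 (var 20))))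

/-- The array `9` gets the vertices at the positions. -/
def ordProg : Prog :=
  seq (tab 20 21 9 (var 10) (const 0)) (scatter 20 21 9 (var 10) (get 8 (var 20)) (var 20))

/-- The program that computes the left-to-right order of the leaves. -/
def orderProg : Prog :=
  seq iterProg (seq weightProg (seq sibProg (seq posProg ordProg)))

section

variable {N n w : ℕ} [NeZero N] [NeZero n] {M : SignedTreeModel (Fin N) (Fin n)}
  {ω : ℕ → Fin (2 ^ w)} {s : State}

/-- The memory contains the tree of the model `M`. -/
structure HoldsTree (M : SignedTreeModel (Fin N) (Fin n)) (s : State) : Prop where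
  N_eq : s.var 0 = N
  root : s.var 1 = M.tree.root
  n_eq : s.var 10 = n
  parent : ∀ x : Fin N, s.arr 0 x = M.tree.parent x
  leaf : ∀ v : Fin n, s.arr 1 v = M.leaf v

omit [NeZero N] [NeZero n] in
theorem HoldsTree.congr {l : List ℕ} {s' : State} (H : HoldsTree M s) (h : SameOutside l s s')
    (h0 : 0 ∉ l) (h1 : 1 ∉ l) : HoldsTree M s' where
  N_eq := (h.1 0 (by decide) (by decide)).trans H.N_eq
  root := (h.1 1 (by decide) (by decide)).trans H.root
  n_eq := (h.1 10 (by decide) (by decide)).trans H.n_eq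
  parent x := by rw [h.2 0 h0]; exact H.parent x
  leaf v := by rw [h.2 1 h1]; exact H.leaf v

/-- The iterated parents of the leaves, in one sequence. -/
def iterSeq (M : SignedTreeModel (Fin N) (Fin n)) (k : ℕ) : Fin N :=
  M.tree.parent^[k / n] (M.leaf (Fin.ofNat n k))

/-- The summands of `ParentTree.sibSum`, in one sequence. -/
def sibSeq (M : SignedTreeModel (Fin N) (Fin n)) (k : ℕ) : ℕ :=
  if M.tree.parent (Fin.ofNat N k) = M.tree.parent (Fin.ofNat N (k / N)) ∧
    Fin.ofNat N k < Fin.ofNat N (k / N) ∧ Fin.ofNat N k ≠ M.tree.root ∧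
    Fin.ofNat N (k / N) ≠ M.tree.root then M.weight (Fin.ofNat N k) else 0

omit [NeZero N] [NeZero n] in
theorem sibSum_le (y : Fin N) : M.tree.sibSum M.weight y ≤ n := by
  by_cases h : y = M.tree.root
  · rw [h, M.tree.sibSum_root]; exact Nat.zero_le _
  · have := M.tree.sibSum_add_le M.sum_weight_le h
    have := M.weight_le (M.tree.parent y)
    omega

theorem ofNat_val {m k : ℕ} [NeZero m] (h : k < m) : ((Fin.ofNat m k : Fin m) : ℕ) = k := by
  simp [Nat.mod_eq_of_lt h]

theorem ofNat_fin {m : ℕ} [NeZero m] (x : Fin m) : Fin.ofNat m x = x := Fin.ext (ofNat_val x.2)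

omit [NeZero n] in
theorem sum_sibSeq (y : Fin N) :
    ∑ j ∈ range (N * N) with j / N = (y : ℕ), sibSeq M j = M.tree.sibSum M.weight y := by
  rw [sum_filter_div_eq y.2, sum_range, ParentTree.sibSum]
  refine sum_congr rfl fun b _ => ?_
  have h1 : Fin.ofNat N ((y : ℕ) * N + b) = b := by
    ext; simp [Nat.mod_eq_of_lt b.2]
  have h2 : ((y : ℕ) * N + b) / N = y := by
    rw [mul_comm, Nat.mul_add_div (NeZero.pos N), Nat.div_eq_of_lt b.2, add_zero]
  rw [sibSeq, h1, h2, ofNat_fin]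

omit [NeZero N] in
theorem card_iterSeq {x : Fin N} (hx : x ≠ M.tree.root) :
    ∑ j ∈ range (N * n) with (iterSeq M j : ℕ) = x, 1 = M.weight x := by
  rw [← M.card_iterates_eq hx, card_eq_sum_ones]
  refine sum_bij' (fun j hj => (⟨j / n, ?_⟩, Fin.ofNat n j)) (fun kv _ => kv.1 * n + kv.2)
    ?_ ?_ ?_ ?_ ?_
  · simp only [mem_filter, mem_range] at hj
    exact Nat.div_lt_of_lt_mul (by rw [mul_comm]; exact hj.1)
  · intro j hj
    simp only [mem_filter, mem_range, mem_univ, true_and] at hj ⊢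
    exact Fin.ext hj.2
  · rintro ⟨k, v⟩ hkv
    simp only [mem_filter, mem_range, mem_univ, true_and] at hkv ⊢
    have h : ((k : ℕ) + 1) * n ≤ N * n := Nat.mul_le_mul_right _ k.2
    rw [add_mul, one_mul] at h
    refine ⟨by omega, ?_⟩
    have h1 : Fin.ofNat n ((k : ℕ) * n + v) = v := by ext; simp [Nat.mod_eq_of_lt v.2]
    have h2 : ((k : ℕ) * n + v) / n = k := by
      rw [mul_comm, Nat.mul_add_div (NeZero.pos n), Nat.div_eq_of_lt v.2, add_zero]
    rw [iterSeq, h1, h2, hkv]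
  · intro j hj
    simp [Nat.div_add_mod']
  · rintro ⟨k, v⟩ _
    have h1 : Fin.ofNat n ((k : ℕ) * n + v) = v := by ext; simp [Nat.mod_eq_of_lt v.2]
    have h2 : ((k : ℕ) * n + v) / n = k := by
      rw [mul_comm, Nat.mul_add_div (NeZero.pos n), Nat.div_eq_of_lt v.2, add_zero]
    simp only [Prod.mk.injEq]
    exact ⟨Fin.ext h2, h1⟩
  · intro _ _; rfl

omit [NeZero N] in
theorem sum_sibSum_iterSeq (v : Fin n) :
    ∑ j ∈ range (N * n) with j % n = (v : ℕ), M.tree.sibSum M.weight (iterSeq M j) =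
      M.position v := by
  rw [sum_filter_mod_eq v.2]
  refine sum_congr rfl fun k _ => ?_
  have h1 : Fin.ofNat n ((k : ℕ) * n + v) = v := by ext; simp [Nat.mod_eq_of_lt v.2]
  have h2 : ((k : ℕ) * n + v) / n = k := by
    rw [mul_comm, Nat.mul_add_div (NeZero.pos n), Nat.div_eq_of_lt v.2, add_zero]
  rw [iterSeq, h1, h2]

/-- The words are long enough for the preparations. -/
def Roomy (n w : ℕ) : Prop := 729 * ((n + 2) * (n + 2)) ≤ 2 ^ w

omit [NeZero N] [NeZero n] in
theorem size_bounds (M : SignedTreeModel (Fin N) (Fin n)) :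
    N ≤ 2 * n ∧ N * n ≤ 2 * (n * n) ∧ N * N ≤ 4 * (n * n) := by
  have h := M.card_nodes_le
  refine ⟨h, ?_, ?_⟩
  · calc N * n ≤ 2 * n * n := Nat.mul_le_mul_right _ h
      _ = _ := by ring
  · calc N * N ≤ (2 * n) * (2 * n) := Nat.mul_le_mul h h
      _ = _ := by ring

omit [NeZero N] [NeZero n] in
theorem Roomy.bound (h : Roomy n w) : 729 * (n * n) + 2000 * n + 2000 ≤ 2 ^ w := by
  unfold Roomy at h
  have : 729 * ((n + 2) * (n + 2)) = 729 * (n * n) + 2916 * n + 2916 := by ring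
  omega

omit [NeZero N] in
theorem le_sq : n ≤ n * n ∧ 1 ≤ n * n :=
  ⟨Nat.le_mul_of_pos_left _ (NeZero.pos n), Nat.mul_pos (NeZero.pos n) (NeZero.pos n)⟩

omit [NeZero N] in
theorem run_iterProg (hw : Roomy n w) (H : HoldsTree M s) :
    Run w ω iterProg s fun s' t => SameOutside [5] s s' ∧
      (∀ k < N * n, s'.arr 5 k = iterSeq M k) ∧ t ≤ 1000 * (n * n) := by
  obtain ⟨b1, b2, b3⟩ := size_bounds M
  have b4 := hw.bound
  have hn := NeZero.pos n
  obtain ⟨b5, b6⟩ := le_sq (n := n)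
  refine (Run.tab (by decide) (N * n) (fun k => iterSeq M k)
    (eval_mul (eval_var H.N_eq) (eval_var H.n_eq) (by omega)) (by omega) ?_).mono ?_
  · intro k hk s' hs hI hf
    have H' := H.congr hs.outside (by simp) (by simp)
    -- Both branches are specified by the same value, so the conditional disappears by `ite_self`.
    -- Entries from `n` on are parents of the entry `n` places earlier.
    rw [eval_sel (p := k < n) (x := iterSeq M k) (y := iterSeq M k) (by omega)
      (eval_lt (eval_var hI) (eval_var H'.n_eq)) ?_ ?_ ?_ ?_, ite_self]
    · intro hkn
      refine eval_get (eval_var hI) ?_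
      have := H'.leaf ⟨k, hkn⟩
      rw [this, iterSeq, Nat.div_eq_of_lt hkn]
      congr 2
      ext
      simp [Nat.mod_eq_of_lt hkn]
    · intro hkn
      refine eval_get (eval_get (j := k - n) (eval_sub (eval_var hI) (eval_var H'.n_eq)) rfl) ?_
      rw [hf _ (by omega), H'.parent, iterSeq, iterSeq]
      obtain ⟨d, rfl⟩ := Nat.exists_eq_add_of_le' (not_lt.1 hkn)
      rw [Nat.add_sub_cancel, Nat.add_div_right _ hn, Function.iterate_succ_apply']
      congr 4
      ext
      simp
    · intro _
      have := (iterSeq M k).2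
      omega
    · intro _
      have := (iterSeq M k).2
      omega
  · rintro s' t ⟨hs, hf, ht⟩
    refine ⟨hs.outside, hf, ht.trans ?_⟩
    simp only [Expr.cost, sel]
    omega

omit [NeZero N] in
-- Each leaf adds one at each node on its path. The root may be counted repeatedly, as the iteration
-- stays there; its entry only has to avoid overflow, since offsets never use the weight of the
-- root.
theorem run_weightProg (hw : Roomy n w) (H : HoldsTree M s)
    (h5 : ∀ k < N * n, s.arr 5 k = iterSeq M k) :
    Run w ω weightProg s fun s' t => SameOutside [6] s s' ∧
      (∀ x : Fin N, x ≠ M.tree.root → s'.arr 6 x = M.weight x) ∧ t ≤ 1000 * (n * n) := by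
  obtain ⟨b1, b2, b3⟩ := size_bounds M
  have b4 := hw.bound
  obtain ⟨b5, b6⟩ := le_sq (n := n)
  refine Run.seq ((Run.tab (by decide) N (fun _ => 0) (eval_var H.N_eq) (by omega)
    (fun _ _ _ _ _ _ => eval_const (by omega))).mono ?_)
  rintro s₁ t₁ ⟨hs₁, hf₁, ht₁⟩
  have H₁ := H.congr hs₁.outside (by simp) (by simp)
  refine (Run.scatter (by decide) (N * n) (fun k => iterSeq M k) (fun _ => 1)
    (eval_mul (eval_var H₁.N_eq) (eval_var H₁.n_eq) (by omega)) (by omega) ?_ ?_).mono ?_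
  · intro k hk s' hs hI
    refine ⟨eval_get (eval_var hI) ?_, eval_const (by omega)⟩
    rw [hs.2.1 5 (by decide), hs₁.2.1 5 (by decide)]
    exact h5 k hk
  · intro k hk
    rw [hf₁ _ (iterSeq M k).2, zero_add, sum_const, smul_eq_mul, mul_one]
    refine lt_of_le_of_lt (card_filter_le _ _) ?_
    rw [card_range]
    omega
  · rintro s' t ⟨hs, hf, ht⟩
    refine ⟨?_, ?_, ?_⟩
    · have := hs₁.outside.trans hs.outside
      exact ⟨this.1, fun b hb => this.2 b (by simpa using hb)⟩
    · intro x hx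
      rw [hf, hf₁ _ x.2, zero_add]
      exact card_iterSeq hx
    · simp only [Expr.cost] at ht ht₁
      omega

/-- Trying all `N * N` pairs of nodes is affordable because `N ≤ 2 * n`. The condition on the
summand excludes the root, whose stored weight is unreliable. -/
theorem run_sibProg (hw : Roomy n w) (H : HoldsTree M s)
    (h6 : ∀ x : Fin N, x ≠ M.tree.root → s.arr 6 x = M.weight x) :
    Run w ω sibProg s fun s' t => SameOutside [7] s s' ∧
      (∀ x : Fin N, s'.arr 7 x = M.tree.sibSum M.weight x) ∧ t ≤ 2000 * (n * n) := by
  obtain ⟨b1, b2, b3⟩ := size_bounds M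
  have b4 := hw.bound
  obtain ⟨b5, b6⟩ := le_sq (n := n)
  have hN := NeZero.pos N
  refine Run.seq ((Run.tab (by decide) N (fun _ => 0) (eval_var H.N_eq) (by omega)
    (fun _ _ _ _ _ _ => eval_const (by omega))).mono ?_)
  rintro s₁ t₁ ⟨hs₁, hf₁, ht₁⟩
  have H₁ := H.congr hs₁.outside (by simp) (by simp)
  refine (Run.scatter (by decide) (N * N) (fun k => k / N) (sibSeq M)
    (eval_mul (eval_var H₁.N_eq) (eval_var H₁.N_eq) (by omega)) (by omega) ?_ ?_).mono ?_
  · intro k hk s' hs hI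
    have H₂ := H₁.congr hs.outside (by simp) (by simp)
    have hq : k / N < N := Nat.div_lt_of_lt_mul hk
    have hr : k % N < N := Nat.mod_lt _ hN
    have eq : quotExpr.eval w s' = (Fin.ofNat N (k / N) : Fin N) := by
      rw [ofNat_val hq]; exact eval_div (eval_var hI) (eval_var H₂.N_eq)
    have er : remExpr.eval w s' = (Fin.ofNat N k : Fin N) :=
      eval_mod (eval_var hI) (eval_var H₂.N_eq)
    refine ⟨eval_div (eval_var hI) (eval_var H₂.N_eq), ?_⟩
    refine (eval_sel (p := M.tree.parent (Fin.ofNat N k) = M.tree.parent (Fin.ofNat N (k / N)) ∧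
      Fin.ofNat N k < Fin.ofNat N (k / N) ∧ Fin.ofNat N k ≠ M.tree.root ∧
      Fin.ofNat N (k / N) ≠ M.tree.root) (x := M.weight (Fin.ofNat N k)) (y := 0)
      (by omega) ?_ ?_ ?_ ?_ ?_)
    · refine eval_and ?_ (eval_and ?_ (eval_and ?_ ?_))
      · simp only [Fin.ext_iff]
        exact eval_eq (eval_get er (H₂.parent _)) (eval_get eq (H₂.parent _))
      · simp only [Fin.lt_def]
        exact eval_lt er eq
      · simp only [ne_eq, Fin.ext_iff]
        exact eval_not (eval_eq er (eval_var H₂.root))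
      · simp only [ne_eq, Fin.ext_iff]
        exact eval_not (eval_eq eq (eval_var H₂.root))
    · intro hp
      refine eval_get er ?_
      rw [hs.2.1 6 (by decide), hs₁.2.1 6 (by decide)]
      exact h6 _ hp.2.2.1
    · exact fun _ => eval_const (by omega)
    · intro _
      have := M.weight_le (Fin.ofNat N k)
      omega
    · intro _; omega
  · intro k hk
    have hq : k / N < N := Nat.div_lt_of_lt_mul hk
    rw [hf₁ _ hq, zero_add]
    have := sum_sibSeq (M := M) ⟨k / N, hq⟩
    have h2 := sibSum_le (M := M) ⟨k / N, hq⟩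
    dsimp only at this
    omega
  · rintro s' t ⟨hs, hf, ht⟩
    refine ⟨?_, ?_, ?_⟩
    · have := hs₁.outside.trans hs.outside
      exact ⟨this.1, fun b hb => this.2 b (by simpa using hb)⟩
    · intro x
      rw [hf, hf₁ _ x.2, zero_add]
      exact sum_sibSeq x
    · simp only [Expr.cost, sel, quotExpr, remExpr] at ht ht₁
      omega

omit [NeZero N] in
-- The iterated parents of the vertex `v` occupy the indices congruent to `v` modulo `n`, and its
-- position is the sum of `sibSum` over them.
theorem run_posProg (hw : Roomy n w) (H : HoldsTree M s)
    (h5 : ∀ k < N * n, s.arr 5 k = iterSeq M k)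
    (h7 : ∀ x : Fin N, s.arr 7 x = M.tree.sibSum M.weight x) :
    Run w ω posProg s fun s' t => SameOutside [8] s s' ∧
      (∀ v : Fin n, s'.arr 8 v = M.position v) ∧ t ≤ 1000 * (n * n) := by
  obtain ⟨b1, b2, b3⟩ := size_bounds M
  have b4 := hw.bound
  obtain ⟨b5, b6⟩ := le_sq (n := n)
  have hn := NeZero.pos n
  refine Run.seq ((Run.tab (by decide) n (fun _ => 0) (eval_var H.n_eq) (by omega)
    (fun _ _ _ _ _ _ => eval_const (by omega))).mono ?_)
  rintro s₁ t₁ ⟨hs₁, hf₁, ht₁⟩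
  have H₁ := H.congr hs₁.outside (by simp) (by simp)
  refine (Run.scatter (by decide) (N * n) (fun k => k % n)
    (fun k => M.tree.sibSum M.weight (iterSeq M k))
    (eval_mul (eval_var H₁.N_eq) (eval_var H₁.n_eq) (by omega)) (by omega) ?_ ?_).mono ?_
  · intro k hk s' hs hI
    have H₂ := H₁.congr hs.outside (by simp) (by simp)
    refine ⟨eval_mod (eval_var hI) (eval_var H₂.n_eq),
      eval_get (eval_get (v := iterSeq M k) (eval_var hI) ?_) ?_⟩
    · rw [hs.2.1 5 (by decide), hs₁.2.1 5 (by decide)]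
      exact h5 k hk
    · rw [hs.2.1 7 (by decide), hs₁.2.1 7 (by decide)]
      exact h7 _
  · intro k hk
    have hr : k % n < n := Nat.mod_lt _ hn
    rw [hf₁ _ hr, zero_add]
    have := sum_sibSum_iterSeq (M := M) ⟨k % n, hr⟩
    have h2 := M.position_lt ⟨k % n, hr⟩
    dsimp only at this
    omega
  · rintro s' t ⟨hs, hf, ht⟩
    refine ⟨?_, ?_, ?_⟩
    · have := hs₁.outside.trans hs.outside
      exact ⟨this.1, fun b hb => this.2 b (by simpa using hb)⟩
    · intro v
      rw [hf, hf₁ _ v.2, zero_add]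
      exact sum_sibSum_iterSeq v
    · simp only [Expr.cost] at ht ht₁
      omega

omit [NeZero N] in
-- Positions form a permutation, so each cell receives exactly one summand, namely the vertex at
-- that position.
theorem run_ordProg (hw : Roomy n w) (H : HoldsTree M s)
    (h8 : ∀ v : Fin n, s.arr 8 v = M.position v) :
    Run w ω ordProg s fun s' t => SameOutside [9] s s' ∧
      (∀ i : Fin n, s'.arr 9 i = M.positionEquiv.symm i) ∧ t ≤ 1000 * (n * n) := by
  have b4 := hw.bound
  obtain ⟨b5, b6⟩ := le_sq (n := n)
  refine Run.seq ((Run.tab (by decide) n (fun _ => 0) (eval_var H.n_eq) (by omega)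
    (fun _ _ _ _ _ _ => eval_const (by omega))).mono ?_)
  rintro s₁ t₁ ⟨hs₁, hf₁, ht₁⟩
  have H₁ := H.congr hs₁.outside (by simp) (by simp)
  have hsum : ∀ i : Fin n, ∑ j ∈ range n with M.position (Fin.ofNat n j) = (i : ℕ), j =
      M.positionEquiv.symm i := by
    intro i
    have : ({j ∈ range n | M.position (Fin.ofNat n j) = (i : ℕ)} : Finset ℕ) =
        {((M.positionEquiv.symm i : Fin n) : ℕ)} := by
      ext j
      simp only [mem_filter, mem_range, mem_singleton]
      constructor
      · rintro ⟨hj, he⟩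
        rw [← M.position_symm i] at he
        rw [← M.position_injective he, ofNat_val hj]
      · rintro rfl
        exact ⟨(M.positionEquiv.symm i).2, by rw [ofNat_fin, M.position_symm]⟩
    rw [this, sum_singleton]
  refine (Run.scatter (by decide) n (fun k => M.position (Fin.ofNat n k)) (fun k => k)
    (eval_var H₁.n_eq) (by omega) ?_ ?_).mono ?_
  · intro k hk s' hs hI
    refine ⟨eval_get (eval_var hI) ?_, eval_var hI⟩
    rw [hs.2.1 8 (by decide), hs₁.2.1 8 (by decide)]
    have := h8 (Fin.ofNat n k)
    rwa [ofNat_val hk] at this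
  · intro k hk
    rw [hf₁ _ (M.position_lt _), zero_add]
    have := hsum ⟨M.position (Fin.ofNat n k), M.position_lt _⟩
    dsimp only at this
    rw [this]
    exact (Fin.is_lt _).trans (by omega)
  · rintro s' t ⟨hs, hf, ht⟩
    refine ⟨?_, ?_, ?_⟩
    · have := hs₁.outside.trans hs.outside
      exact ⟨this.1, fun b hb => this.2 b (by simpa using hb)⟩
    · intro i
      rw [hf, hf₁ _ i.2, zero_add]
      exact hsum i
    · simp only [Expr.cost] at ht ht₁
      omega

theorem run_orderProg (hw : Roomy n w) (H : HoldsTree M s) :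
    Run w ω orderProg s fun s' t => SameOutside [5, 6, 7, 8, 9] s s' ∧
      (∀ v : Fin n, s'.arr 8 v = M.position v) ∧
      (∀ i : Fin n, s'.arr 9 i = M.positionEquiv.symm i) ∧ t ≤ 6000 * (n * n) := by
  refine Run.seq ((run_iterProg hw H).mono ?_)
  rintro s₁ t₁ ⟨hs₁, h5, ht₁⟩
  have H₁ := H.congr hs₁ (by simp) (by simp)
  refine Run.seq ((run_weightProg hw H₁ h5).mono ?_)
  rintro s₂ t₂ ⟨hs₂, h6, ht₂⟩
  have H₂ := H₁.congr hs₂ (by simp) (by simp)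
  refine Run.seq ((run_sibProg hw H₂ h6).mono ?_)
  rintro s₃ t₃ ⟨hs₃, h7, ht₃⟩
  have H₃ := H₂.congr hs₃ (by simp) (by simp)
  refine Run.seq ((run_posProg hw H₃ ?_ h7).mono ?_)
  · intro k hk
    rw [hs₃.2 5 (by decide), hs₂.2 5 (by decide)]
    exact h5 k hk
  rintro s₄ t₄ ⟨hs₄, h8, ht₄⟩
  have H₄ := H₃.congr hs₄ (by simp) (by simp)
  refine (run_ordProg hw H₄ h8).mono ?_
  rintro s₅ t₅ ⟨hs₅, h9, ht₅⟩
  refine ⟨?_, ?_, h9, by omega⟩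
  · have := (((hs₁.trans hs₂).trans hs₃).trans hs₄).trans hs₅
    exact ⟨this.1, fun b hb => this.2 b (by simpa using hb)⟩
  · intro v
    rw [hs₅.2 8 (by decide)]
    exact h8 v

end

end WordRAM

end

noncomputable section

namespace WordRAM

open WordRAM.Expr Prog BinOp Finset SegTree

/-! ### The table of the segment trees -/

/-- The scalar `12` gets the least power of two that is at least the scalar `10`, and the scalar
`11` gets its double. -/
def sizeProg : Prog :=
  seq (assign 12 (const 1))
  (seq (.while (op lt (var 12) (var 10)) (assign 12 (op add (var 12) (var 12))))
    (assign 11 (op add (var 12) (var 12))))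

/-- The array `12` gets the vertices of the cells. -/
def cellProg : Prog :=
  tab 20 21 12 (var 12)
    (get 9 (sel (op lt (var 20) (var 10)) (var 20) (op sub (var 10) (const 1))))

/-- The node of the current entry of the table. -/
def nodeExpr : Expr := op mod (var 20) (var 11)

/-- The left child of the node of the current entry of the table. -/
def childExpr : Expr := op mul (const 2) (op sub nodeExpr (var 12))

/-- The index of the left child in the same row of the table. -/
def childPos : Expr := op add (op sub (var 20) nodeExpr) childExpr

/-- The entry of the table of a cell; the array `B` holds the adjacency matrix. -/
def cellEntry (B : ℕ) : Expr :=
  sel (get B (op add (op mul (get 9 (op sub (op div (var 20) (var 11)) (const 2))) (var 10))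
    (get 12 nodeExpr))) (op add (var 11) nodeExpr) (const 0)

/-- The entry of the table of an inner node. -/
def innerEntry : Expr :=
  sel (op and (op eq (get 10 childPos) (const 0))
      (op eq (get 10 (op add childPos (const 1))) (const 0)))
    (const 0)
  (sel (op and (op eq (get 10 childPos) (op add (var 11) childExpr))
      (op eq (get 10 (op add childPos (const 1))) (op add (var 11) (op add childExpr (const 1)))))
    (op add (var 11) nodeExpr)
  (sel (op and (op eq (get 10 childPos) (get 10 (op sub childPos (var 11))))
      (op eq (get 10 (op add childPos (const 1)))
        (get 10 (op add (op sub childPos (var 11)) (const 1)))))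
    (get 10 (op sub (var 20) (var 11)))
    (var 20)))

/-- The array `10` gets the table of the segment trees. -/
def tableProg (B : ℕ) : Prog :=
  tab 20 21 10 (op mul (op add (var 10) (const 2)) (var 11))
    (sel (op lt (var 20) (var 11)) (const 0)
    (sel (op lt (var 20) (op add (var 11) (var 11))) (var 20)
    (sel (op lt nodeExpr (var 12)) (cellEntry B)
    (sel (op lt (op add childExpr (const 1)) nodeExpr) innerEntry (const 0)))))

/-- The arrays `0`, `1` and `11` get their initial values for the search. -/
def clearProg : Prog :=
  seq (tab 20 21 11 (op mul (op add (var 10) (const 2)) (var 11)) (const 0))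
  (seq (tab 20 21 0 (op mul (var 10) (var 10)) (var 10))
    (tab 20 21 1 (op mul (var 10) (var 10)) (var 10)))

/-- All-Pairs Shortest Path from a signed tree model; the scalar `B` holds the number of vertices
and the array `B` the adjacency matrix. -/
def modelApsp (B : ℕ) : Prog :=
  seq (assign 10 (var B))
  (seq orderProg (seq sizeProg (seq cellProg (seq (tableProg B) (seq clearProg bfsAll)))))

section

variable {N n w : ℕ} {M : SignedTreeModel (Fin N) (Fin n)} {ω : ℕ → Fin (2 ^ w)} {s : State}

theorem run_sizeProg (hw : Roomy n w) (hn : 0 < n) (h10 : s.var 10 = n) :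
    Run w ω sizeProg s fun s' t => (∀ x, x ≠ 11 → x ≠ 12 → s'.var x = s.var x) ∧
      s'.arr = s.arr ∧ (∃ L, s'.var 12 = 2 ^ L ∧ s'.var 11 = 2 * 2 ^ L ∧ n ≤ 2 ^ L ∧
        2 ^ L < 2 * n) ∧ t ≤ 100 * n := by
  have b4 := hw.bound
  refine Run.seq (Run.assign (eval_const (by omega)) (Run.seq ((Run.while (fun s' =>
    (∀ x, x ≠ 12 → s'.var x = s.var x) ∧ s'.arr = s.arr ∧ ∃ L, s'.var 12 = 2 ^ L ∧ 2 ^ L < 2 * n)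
    -- Doubling raises the scalar by at least one, and a bound linear in `n` is good enough here.
    (fun s' => 20 * (2 * n - s'.var 12)) ?_ ?_).mono ?_)))
  · rintro s' ⟨h1, h2, L, h3, h4⟩ hc
    have h10' : s'.var 10 = n := (h1 10 (by decide)).trans h10
    have hlt : 2 ^ L < n := by
      by_contra hcon
      simp [Expr.eval, BinOp.eval, h3, h10', hcon] at hc
    have hpos : 0 < 2 ^ L := by positivity
    refine Run.assign (eval_add (eval_var h3) (eval_var h3) (by omega))
      ⟨⟨?_, by simpa using h2, L + 1, ?_, ?_⟩, ?_⟩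
    · intro x hx; simp [hx, h1 x hx]
    · simp [pow_succ]; ring
    · rw [pow_succ]; omega
    · simp only [Expr.cost, State.setVar_var, if_true, h3]
      omega
  · refine ⟨?_, rfl, 0, by simp, by simp; omega⟩
    intro x hx; simp [hx]
  · rintro s' t ⟨⟨h1, h2, L, h3, h4⟩, hc, ht⟩
    have h10' : s'.var 10 = n := (h1 10 (by decide)).trans h10
    have hlt : n ≤ 2 ^ L := by
      by_contra hcon
      simp [Expr.eval, BinOp.eval, h3, h10', not_le.1 hcon] at hc
    refine Run.assign (eval_add (eval_var h3) (eval_var h3) (by omega)) ⟨?_, ?_, ?_, ?_⟩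
    · intro x h5 h6; simp [h5, h1 x h6]
    · simpa using h2
    · exact ⟨L, by simp [h3], by simp; ring, hlt, h4⟩
    · simp only [Expr.cost] at ht ⊢
      omega

/-- The memory during the construction of the table. -/
structure HoldsOrder (M : SignedTreeModel (Fin N) (Fin n)) (B S : ℕ) (s : State) : Prop where
  n_eq : s.var 10 = n
  S2_eq : s.var 11 = 2 * S
  S_eq : s.var 12 = S
  pos : ∀ v : Fin n, s.arr 8 v = M.position v
  ord : ∀ i : Fin n, s.arr 9 i = M.positionEquiv.symm i
  adj : ∀ u v : Fin n, M.graph.Adj u v → s.arr B (u * n + v) = 1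
  not_adj : ∀ u v : Fin n, ¬ M.graph.Adj u v → s.arr B (u * n + v) = 0

theorem HoldsOrder.congr {B S : ℕ} {l : List ℕ} {s' : State} (H : HoldsOrder M B S s)
    (h : SameOutside l s s') (h8 : 8 ∉ l) (h9 : 9 ∉ l) (hB : B ∉ l) : HoldsOrder M B S s' where
  n_eq := (h.1 10 (by decide) (by decide)).trans H.n_eq
  S2_eq := (h.1 11 (by decide) (by decide)).trans H.S2_eq
  S_eq := (h.1 12 (by decide) (by decide)).trans H.S_eq
  pos := by rw [h.2 8 h8]; exact H.pos
  ord := by rw [h.2 9 h9]; exact H.ord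
  adj := by rw [h.2 B hB]; exact H.adj
  not_adj := by rw [h.2 B hB]; exact H.not_adj

theorem run_cellProg {B S : ℕ} (hw : Roomy n w) (hn : 0 < n) (hS : S < 2 * n)
    (H : HoldsOrder M B S s) :
    Run w ω cellProg s fun s' t => SameOutside [12] s s' ∧
      (∀ j < S, s'.arr 12 j = M.cellVertex hn j) ∧ t ≤ 100 * (n * n) := by
  have b4 := hw.bound
  have : NeZero n := ⟨hn.ne'⟩
  obtain ⟨b5, b6⟩ := le_sq (n := n)
  refine (Run.tab (by decide) S (fun j => M.cellVertex hn j) (eval_var H.S_eq) (by omega)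
    ?_).mono ?_
  · intro k hk s' hs hI _
    have h10 : s'.var 10 = n := (hs.1 10 (by decide) (by decide)).trans H.n_eq
    refine eval_get (eval_sel (p := k < n) (x := k) (y := n - 1) (by omega)
      (eval_lt (eval_var hI) (eval_var h10)) (fun _ => eval_var hI)
      (fun _ => eval_sub (eval_var h10) (eval_const (by omega))) (by omega) (by omega)) ?_
    have h2 : (if k < n then k else n - 1) = min k (n - 1) := by
      split_ifs <;> omega
    rw [h2, hs.2.1 9 (by decide)]
    exact H.ord ⟨min k (n - 1), by omega⟩
  · rintro s' t ⟨hs, hf, ht⟩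
    refine ⟨hs.outside, hf, ht.trans ?_⟩
    simp only [Expr.cost, sel]
    omega

theorem table_eq_zero {S : ℕ} {R : ℕ → ℕ → Bool} {k : ℕ} (hk : k < 2 * S) : table S R k = 0 := by
  rw [table, Nat.div_eq_of_lt hk, nodeId_zero]

theorem table_eq_self {S : ℕ} {R : ℕ → ℕ → Bool} {k : ℕ} (hk : 2 * S ≤ k) (hk' : k < 4 * S) :
    table S R k = k := by
  obtain ⟨q, rfl⟩ := Nat.exists_eq_add_of_le hk
  have := two_mul_add_mod (S := S) (q := q) (by omega)
  rw [table, this.1, this.2, nodeId_one]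

theorem table_add {S i q : ℕ} {R : ℕ → ℕ → Bool} (hq : q < 2 * S) :
    table S R (i * (2 * S) + q) = nodeId S R i q := by
  have := eq_mul_add_mod (S := S) (i := i) hq
  rw [table, this.1, this.2]

/-- The recursion of `nodeId` refers only to smaller indices: the children in the same row, and the
node and its children in the preceding row. So one pass fills the table, in time proportional to its
`(n + 2) * (2 * S)` entries. -/
theorem run_tableProg {B S : ℕ} (hw : Roomy n w) (hn : 0 < n) (hS : S < 2 * n) (hnS : n ≤ S)
    (hB : 100 ≤ B) (H : HoldsOrder M B S s) (h12 : ∀ j < S, s.arr 12 j = M.cellVertex hn j) :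
    Run w ω (tableProg B) s fun s' t => SameOutside [10] s s' ∧
      (∀ k < (n + 2) * (2 * S), s'.arr 10 k = table S (M.rowBit hn) k) ∧
      t ≤ 7000 * (n * n) := by
  have b4 := hw.bound
  have : NeZero n := ⟨hn.ne'⟩
  obtain ⟨b5, b6⟩ := le_sq (n := n)
  have b7 : (n + 2) * (2 * S) ≤ 12 * (n * n) := by
    calc (n + 2) * (2 * S) ≤ (n + 2) * (4 * n) := Nat.mul_le_mul_left _ (by omega)
      _ = 4 * (n * n) + 8 * n := by ring
      _ ≤ _ := by omega
  have hw1 : 1 < 2 ^ w := by omega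
  refine (Run.tab (by decide) ((n + 2) * (2 * S)) (table S (M.rowBit hn))
    (eval_mul (eval_add (eval_var H.n_eq) (eval_const (by omega)) (by omega)) (eval_var H.S2_eq)
      (by omega)) (by omega) ?_).mono ?_
  · intro k hk s' hs hI hf
    have H' := H.congr hs.outside (by simp) (by simp) (by simp; omega)
    -- A name created at some index is that index, and inherited names are older; so every name fits
    -- into a word.
    have bound : ∀ j, j ≤ k → table S (M.rowBit hn) j < 2 ^ w := by
      intro j hj
      have h1 : j / (2 * S) < n + 2 := Nat.div_lt_of_lt_mul (by rw [mul_comm]; omega)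
      have h2 := nodeId_lt (B := M.rowBit hn) (i := j / (2 * S)) (q := j % (2 * S))
        (Nat.mod_lt _ (by omega))
      have h3 : (j / (2 * S) + 1) * (2 * S) ≤ (n + 2) * (2 * S) := Nat.mul_le_mul_right _ h1
      unfold table
      omega
    rw [eval_sel (p := k < 2 * S) (x := table S (M.rowBit hn) k) (y := table S (M.rowBit hn) k)
      hw1 (eval_lt (eval_var hI) (eval_var H'.S2_eq)) ?_ ?_ (fun _ => bound k le_rfl)
      (fun _ => bound k le_rfl), ite_self]
    · intro hk2
      rw [table_eq_zero hk2]; exact eval_const (by omega)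
    intro hk2
    rw [eval_sel (p := k < 2 * S + 2 * S) (x := table S (M.rowBit hn) k)
      (y := table S (M.rowBit hn) k) hw1
      (eval_lt (eval_var hI) (eval_add (eval_var H'.S2_eq) (eval_var H'.S2_eq) (by omega))) ?_ ?_
      (fun _ => bound k le_rfl) (fun _ => bound k le_rfl), ite_self]
    · intro hk4
      rw [table_eq_self (by omega) (by omega)]; exact eval_var hI
    intro hk4
    obtain ⟨i, q, hi, hq, hki⟩ : ∃ i q, i < n ∧ q < 2 * S ∧ k = (i + 2) * (2 * S) + q := by
      have h1 : k / (2 * S) < n + 2 := Nat.div_lt_of_lt_mul (by rw [mul_comm]; omega)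
      have h2 : 2 ≤ k / (2 * S) := (Nat.le_div_iff_mul_le (by omega)).2 (by omega)
      refine ⟨k / (2 * S) - 2, k % (2 * S), by omega, Nat.mod_lt _ (by omega), ?_⟩
      rw [Nat.sub_add_cancel h2, Nat.div_add_mod']
    have hkdm := eq_mul_add_mod (S := S) (i := i + 2) hq
    rw [← hki] at hkdm
    have htk : table S (M.rowBit hn) k = nodeId S (M.rowBit hn) (i + 2) q := by
      rw [hki, table_add hq]
    have ei2 : (i + 2) * (2 * S) = i * (2 * S) + 4 * S := by ring
    have ei1 : (i + 1) * (2 * S) = i * (2 * S) + 2 * S := by ring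
    have enode : nodeExpr.eval w s' = q :=
      (eval_mod (eval_var hI) (eval_var H'.S2_eq)).trans hkdm.2
    have echild : childExpr.eval w s' = 2 * (q - S) :=
      eval_mul (eval_const (by omega)) (eval_sub enode (eval_var H'.S_eq)) (by omega)
    have eS2q : (op add (var 11) nodeExpr).eval w s' = 2 * S + q :=
      eval_add (eval_var H'.S2_eq) enode (by omega)
    rw [eval_sel (p := q < S) (x := table S (M.rowBit hn) k)
      (y := table S (M.rowBit hn) k) hw1 (eval_lt enode (eval_var H'.S_eq)) ?_ ?_
      (fun _ => bound k le_rfl) (fun _ => bound k le_rfl), ite_self]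
    · intro hqS
      rw [htk, nodeId_cell hqS]
      refine (eval_sel (p := M.rowBit hn i q = true) (x := 2 * S + q) (y := 0) hw1 ?_
        (fun _ => eS2q) (fun _ => eval_const (by omega)) (fun _ => by omega) (fun _ => by omega))
      have h9 : s'.arr 9 i = M.cellVertex hn i := by
        rw [hs.2.1 9 (by decide), H.ord ⟨i, hi⟩, SignedTreeModel.cellVertex]
        congr 3
        omega
      have h12' : s'.arr 12 q = M.cellVertex hn q := by
        rw [hs.2.1 12 (by decide)]; exact h12 q hqS
      have hrow := row_lt (M.cellVertex hn i).2 (M.cellVertex hn q).2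
      refine eval_get (eval_add (eval_mul (x := M.cellVertex hn i) (eval_get (eval_sub (y := 2)
        (eval_div (eval_var hI) (eval_var H'.S2_eq)) (eval_const (by omega))) ?_)
        (eval_var H'.n_eq) ?_) (eval_get enode h12') ?_) ?_
      · rw [hkdm.1]; exact h9
      · omega
      · omega
      · unfold SignedTreeModel.rowBit
        by_cases hadj : M.graph.Adj (M.cellVertex hn i) (M.cellVertex hn q)
        · simp [hadj, H'.adj _ _ hadj]
        · simp [hadj, H'.not_adj _ _ hadj]
    intro hqS
    rw [eval_sel (p := 2 * (q - S) + 1 < q) (x := table S (M.rowBit hn) k)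
      (y := table S (M.rowBit hn) k) hw1
      (eval_lt (eval_add echild (eval_const (by omega)) (by omega)) enode) ?_ ?_
      (fun _ => bound k le_rfl) (fun _ => bound k le_rfl), ite_self]
    swap
    · intro hc
      rw [htk, nodeId, if_neg hqS, dif_neg hc]
      exact eval_const (by omega)
    intro hc
    obtain ⟨a, rfl⟩ := Nat.exists_eq_add_of_le (not_lt.1 hqS)
    rw [Nat.add_sub_cancel_left] at hc echild
    have ha : a + 1 < S := by omega
    have epos : childPos.eval w s' = (i + 2) * (2 * S) + 2 * a := by
      refine (eval_add (x := (i + 2) * (2 * S)) ?_ echild (by omega))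
      exact (eval_sub (eval_var hI) enode).trans (by omega)
    have epos1 : (op add childPos (const 1)).eval w s' = (i + 2) * (2 * S) + (2 * a + 1) :=
      (eval_add epos (eval_const (by omega)) (by omega)).trans (add_assoc _ _ _)
    have gl : (get 10 childPos).eval w s' = nodeId S (M.rowBit hn) (i + 2) (2 * a) :=
      eval_get epos ((hf _ (by omega)).trans (table_add (by omega)))
    have gr : (get 10 (op add childPos (const 1))).eval w s' =
        nodeId S (M.rowBit hn) (i + 2) (2 * a + 1) :=
      eval_get epos1 ((hf _ (by omega)).trans (table_add (by omega)))
    have eprev : (op sub childPos (var 11)).eval w s' = (i + 1) * (2 * S) + 2 * a :=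
      (eval_sub epos (eval_var H'.S2_eq)).trans (by omega)
    have gl' : (get 10 (op sub childPos (var 11))).eval w s' =
        nodeId S (M.rowBit hn) (i + 1) (2 * a) :=
      eval_get eprev ((hf _ (by omega)).trans (table_add (by omega)))
    have gr' : (get 10 (op add (op sub childPos (var 11)) (const 1))).eval w s' =
        nodeId S (M.rowBit hn) (i + 1) (2 * a + 1) :=
      eval_get (j := (i + 1) * (2 * S) + (2 * a + 1))
        ((eval_add eprev (eval_const (by omega)) (by omega)).trans (add_assoc _ _ _))
        ((hf _ (by omega)).trans (table_add (by omega)))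
    have gq : (get 10 (op sub (var 20) (var 11))).eval w s' =
        nodeId S (M.rowBit hn) (i + 1) (S + a) :=
      eval_get (j := (i + 1) * (2 * S) + (S + a))
        ((eval_sub (eval_var hI) (eval_var H'.S2_eq)).trans (by omega))
        ((hf _ (by omega)).trans (table_add (by omega)))
    have hb' : nodeId S (M.rowBit hn) (i + 1) (S + a) < 2 ^ w := by
      have := bound ((i + 1) * (2 * S) + (S + a)) (by omega)
      rwa [table_add (by omega)] at this
    rw [htk, nodeId_add ha]
    refine eval_sel hw1 (eval_and (eval_eq gl (eval_const (by omega)))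
      (eval_eq gr (eval_const (by omega)))) (fun _ => eval_const (by omega))
      (fun _ => eval_sel hw1 (eval_and (eval_eq gl (eval_add (eval_var H'.S2_eq) echild (by omega)))
        (eval_eq gr (eval_add (eval_var H'.S2_eq) (eval_add echild (eval_const (by omega))
          (by omega)) (by omega)))) (fun _ => eS2q)
        (fun _ => eval_sel hw1 (eval_and (eval_eq gl gl') (eval_eq gr gr')) (fun _ => gq)
          (fun _ => eval_var (hI.trans hki)) (fun _ => hb') (fun _ => by omega))
        (fun _ => by omega) ?_) (fun _ => by omega) ?_
    · intro _; split_ifs <;> omega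
    · intro _; split_ifs <;> omega
  · rintro s' t ⟨hs, hf, ht⟩
    refine ⟨hs.outside, hf, ht.trans ?_⟩
    simp only [Expr.cost, sel, cellEntry, innerEntry, childPos, childExpr, nodeExpr]
    omega

theorem run_clearProg {S : ℕ} (hw : Roomy n w) (hn : 0 < n) (hS : S < 2 * n)
    (h10 : s.var 10 = n) (h11 : s.var 11 = 2 * S) :
    Run w ω clearProg s fun s' t => SameOutside [0, 1, 11] s s' ∧
      (∀ k < n * n, s'.arr 0 k = n) ∧ (∀ k < n * n, s'.arr 1 k = n) ∧
      (∀ k < (n + 2) * (2 * S), s'.arr 11 k = 0) ∧ t ≤ 1000 * (n * n) := by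
  have b4 := hw.bound
  have : NeZero n := ⟨hn.ne'⟩
  obtain ⟨b5, b6⟩ := le_sq (n := n)
  have b7 : (n + 2) * (2 * S) ≤ 12 * (n * n) := by
    calc (n + 2) * (2 * S) ≤ (n + 2) * (4 * n) := Nat.mul_le_mul_left _ (by omega)
      _ = 4 * (n * n) + 8 * n := by ring
      _ ≤ _ := by omega
  refine Run.seq ((Run.tab (by decide) ((n + 2) * (2 * S)) (fun _ => 0)
    (eval_mul (eval_add (eval_var h10) (eval_const (by omega)) (by omega)) (eval_var h11)
      (by omega)) (by omega) (fun _ _ _ _ _ _ => eval_const (by omega))).mono ?_)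
  rintro s₁ t₁ ⟨hs₁, hf₁, ht₁⟩
  have h10₁ : s₁.var 10 = n := (hs₁.1 10 (by decide) (by decide)).trans h10
  refine Run.seq ((Run.tab (by decide) (n * n) (fun _ => n)
    (eval_mul (eval_var h10₁) (eval_var h10₁) (by omega)) (by omega)
    (fun _ _ s' hs' _ _ => eval_var ((hs'.1 10 (by decide) (by decide)).trans h10₁))).mono ?_)
  rintro s₂ t₂ ⟨hs₂, hf₂, ht₂⟩
  have h10₂ : s₂.var 10 = n := (hs₂.1 10 (by decide) (by decide)).trans h10₁
  refine (Run.tab (by decide) (n * n) (fun _ => n)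
    (eval_mul (eval_var h10₂) (eval_var h10₂) (by omega)) (by omega)
    (fun _ _ s' hs' _ _ => eval_var ((hs'.1 10 (by decide) (by decide)).trans h10₂))).mono ?_
  rintro s₃ t₃ ⟨hs₃, hf₃, ht₃⟩
  refine ⟨?_, ?_, hf₃, ?_, ?_⟩
  · have := (hs₁.outside.trans hs₂.outside).trans hs₃.outside
    refine ⟨this.1, fun b hb => this.2 b ?_⟩
    simp at hb ⊢
    omega
  · rw [hs₃.2.1 0 (by decide)]; exact hf₂
  · rw [hs₃.2.1 11 (by decide), hs₂.2.1 11 (by decide)]; exact hf₁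
  · simp only [Expr.cost] at ht₁ ht₂ ht₃
    omega

end

/-! ### The search in the segment trees -/

section

variable {N n : ℕ} (M : SignedTreeModel (Fin N) (Fin n)) (hn : 0 < n) (L : ℕ)

/-- The relation on numbers that represents a graph. -/
def NatAdj (G : SimpleGraph (Fin n)) (x v : ℕ) : Prop :=
  ∃ a b : Fin n, (a : ℕ) = x ∧ (b : ℕ) = v ∧ G.Adj a b

theorem below_root {j : ℕ} (hj : j < 2 ^ L) : Below (2 ^ L) (2 * 2 ^ L - 2) j := by
  have h : node L L 0 = 2 * 2 ^ L - 2 := by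
    rw [node, show L + 1 - L = 1 by omega, pow_succ]
    omega
  rw [← h, below_node_iff le_rfl (by simp), Nat.div_eq_of_lt hj]

/-- The name of the segment tree of the neighbours of a vertex. -/
def rootId (x : ℕ) : ℕ :=
  nodeId (2 ^ L) (M.rowBit hn) ((if h : x < n then M.position ⟨x, h⟩ else 0) + 2) (2 * 2 ^ L - 2)

theorem cellVertex_position (v : Fin n) : M.cellVertex hn (M.position v) = v := by
  apply M.position_injective
  rw [M.position_cellVertex]
  have := M.position_lt v
  omega

/-- The segment trees of all rows, as a net for the search. -/
def segNet (hL : n ≤ 2 ^ L) : SearchNet n (NatAdj M.graph) where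
  root := rootId M hn L
  left h := table (2 ^ L) (M.rowBit hn) (childIdx (2 ^ L) h)
  right h := table (2 ^ L) (M.rowBit hn) (childIdx (2 ^ L) h + 1)
  cell h := h % (2 * 2 ^ L) < 2 ^ L
  label h := M.cellVertex hn (h % (2 * 2 ^ L))
  nodes := nodeSet (2 ^ L) (M.rowBit hn) (n + 2)
  root_mem := by
    intro x hx
    refine or_iff_not_imp_left.2 fun h => ?_
    unfold rootId at h ⊢
    rw [dif_pos hx] at h ⊢
    have := M.position_lt ⟨x, hx⟩
    exact nodeId_mem_nodeSet (by omega) (by omega) h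
  left_mem := fun h hh hc => (table_childIdx_mem hh (not_lt.1 hc)).1
  right_mem := fun h hh hc => (table_childIdx_mem hh (not_lt.1 hc)).2
  label_lt := fun h _ _ => (M.cellVertex hn _).2
  iff_reach := by
    intro x hx v hv
    have hS : 0 < 2 ^ L := by positivity
    have key : ∀ j < 2 ^ L, (rootId M hn L x ≠ 0 ∧ ∃ h, Relation.ReflTransGen
        (Edge (2 ^ L) (M.rowBit hn)) (rootId M hn L x) h ∧ h % (2 * 2 ^ L) = j) ↔
        M.graph.Adj ⟨x, hx⟩ (M.cellVertex hn j) := by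
      intro j hj
      rw [rootId, dif_pos hx, exists_reach_iff (by omega) hj]
      simp only [below_root L hj, true_and, bit, SignedTreeModel.rowBit, decide_eq_true_eq,
        cellVertex_position]
    have hedge : (fun a b => ¬ a % (2 * 2 ^ L) < 2 ^ L ∧ b ≠ 0 ∧
        (b = table (2 ^ L) (M.rowBit hn) (childIdx (2 ^ L) a) ∨
          b = table (2 ^ L) (M.rowBit hn) (childIdx (2 ^ L) a + 1))) =
        Edge (2 ^ L) (M.rowBit hn) := by
      funext a b
      simp only [Edge, not_lt]
    rw [hedge]
    constructor
    · rintro ⟨a, b, rfl, rfl, hab⟩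
      have hb := M.position_lt b
      have h1 := (key (M.position b) (by omega)).2 (by rwa [cellVertex_position])
      obtain ⟨h0, h, hr, hh⟩ := h1
      exact ⟨h0, h, hr, by omega, by rw [hh, cellVertex_position]⟩
    · rintro ⟨h0, h, hr, hc, rfl⟩
      exact ⟨⟨x, hx⟩, _, rfl, rfl, (key _ hc).1 ⟨h0, h, hr, rfl⟩⟩

end

/-- The memory contains the tree of a model, and the number of vertices and the adjacency matrix
of its graph under the name `B`. -/
structure HoldsInput {N n : ℕ} (M : SignedTreeModel (Fin N) (Fin n)) (B : ℕ) (s : State) :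
    Prop where
  model : HoldsModel s M
  n_eq : s.var B = n
  adj : ∀ u v : Fin n, M.graph.Adj u v → s.arr B (u * n + v) = 1
  not_adj : ∀ u v : Fin n, ¬ M.graph.Adj u v → s.arr B (u * n + v) = 0

/-- The preparations cost `O(n ^ 2)`. The searches cost `n + 1` times the number of vertices and
stored nodes, and `card_nodeSet_rowBit_le` bounds the latter. -/
theorem run_modelApsp {N n w B : ℕ} {M : SignedTreeModel (Fin N) (Fin n)} {ω : ℕ → Fin (2 ^ w)}
    {s : State} (hw : Roomy n w) (hn : 0 < n) (hB : 100 ≤ B) (H : HoldsInput M B s) :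
    Run w ω (modelApsp B) s fun s' t => APSP n M.graph s' ∧
      ∃ L, 2 ^ L < 2 * n ∧ t ≤ 25000 * (n * n) + 10000 * (n * (M.numPairs * (L + 1))) := by
  have b4 := hw.bound
  have : NeZero n := ⟨hn.ne'⟩
  have : NeZero N := ⟨by have := M.tree.root.2; omega⟩
  obtain ⟨b5, b6⟩ := le_sq (n := n)
  refine Run.seq (Run.assign (eval_var H.n_eq) ?_)
  have H₀ : HoldsTree M (s.setVar 10 n) := by
    refine ⟨?_, ?_, ?_, ?_, ?_⟩
    · simpa using H.model.num_nodes
    · simpa using H.model.root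
    · simp
    · simpa using H.model.parent
    · simpa using H.model.leaf
  refine Run.seq ((run_orderProg hw H₀).mono ?_)
  rintro s₁ t₁ ⟨hs₁, h8, h9, ht₁⟩
  have h10₁ : s₁.var 10 = n := (hs₁.1 10 (by decide) (by decide)).trans (by simp)
  have hB₁ : s₁.arr B = s.arr B := by
    rw [hs₁.2 B (by simp; omega)]; rfl
  refine Run.seq ((run_sizeProg hw hn h10₁).mono ?_)
  rintro s₂ t₂ ⟨hv₂, ha₂, ⟨L, h12₂, h11₂, hL, hL'⟩, ht₂⟩
  have O₂ : HoldsOrder M B (2 ^ L) s₂ := by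
    refine ⟨(hv₂ 10 (by decide) (by decide)).trans h10₁, h11₂, h12₂, ?_, ?_, ?_, ?_⟩
    · rw [ha₂]; exact h8
    · rw [ha₂]; exact h9
    · rw [ha₂, hB₁]; exact H.adj
    · rw [ha₂, hB₁]; exact H.not_adj
  refine Run.seq ((run_cellProg hw hn hL' O₂).mono ?_)
  rintro s₃ t₃ ⟨hs₃, h12, ht₃⟩
  have O₃ := O₂.congr hs₃ (by simp) (by simp) (by simp; omega)
  refine Run.seq ((run_tableProg hw hn hL' hL hB O₃ h12).mono ?_)
  rintro s₄ t₄ ⟨hs₄, h10, ht₄⟩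
  have O₄ := O₃.congr hs₄ (by simp) (by simp) (by simp; omega)
  refine Run.seq ((run_clearProg hw hn hL' O₄.n_eq O₄.S2_eq).mono ?_)
  rintro s₅ t₅ ⟨hs₅, h0, h1, h11, ht₅⟩
  have O₅ := O₄.congr hs₅ (by simp) (by simp) (by simp; omega)
  have hS : 0 < 2 ^ L := by positivity
  have b7 : (n + 2) * (2 * 2 ^ L) ≤ 12 * (n * n) := by
    calc (n + 2) * (2 * 2 ^ L) ≤ (n + 2) * (4 * n) := Nat.mul_le_mul_left _ (by omega)
      _ = 4 * (n * n) + 8 * n := by ring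
      _ ≤ _ := by omega
  have h10' : ∀ k < (n + 2) * (2 * 2 ^ L), s₅.arr 10 k = table (2 ^ L) (M.rowBit hn) k := by
    rw [hs₅.2 10 (by decide)]; exact h10
  have hchild : ∀ h ∈ nodeSet (2 ^ L) (M.rowBit hn) (n + 2), ¬ h % (2 * 2 ^ L) < 2 ^ L →
      childIdx (2 ^ L) h + 1 < (n + 2) * (2 * 2 ^ L) := by
    intro h hh _
    have := lt_of_mem_nodeSet hh
    have := mod_lt_of_mem_nodeSet hh
    have := two_mul_le_of_mem_nodeSet hh
    unfold childIdx
    omega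
  have hnet : HoldsNet (segNet M hn L hL) (2 ^ L) s₅ := by
    refine ⟨O₅.n_eq, O₅.S2_eq, O₅.S_eq, hS, ?_, ?_, fun _ _ => Iff.rfl, ?_, ?_, ?_, ?_⟩
    · intro x hx
      have := O₅.pos ⟨x, hx⟩
      simp only at this
      rw [this]
      exact M.position_lt _
    · intro x hx
      have := O₅.pos ⟨x, hx⟩
      have hp := M.position_lt ⟨x, hx⟩
      simp only at this
      rw [this]
      have h2 : (M.position ⟨x, hx⟩ + 2 + 1) * (2 * 2 ^ L) ≤ (n + 2) * (2 * 2 ^ L) :=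
        Nat.mul_le_mul_right _ (by omega)
      rw [add_mul _ 1] at h2
      rw [h10' _ (by omega), table_add (by omega)]
      simp only [segNet, rootId, dif_pos hx]
    · intro h hh hc
      have := hchild h hh hc
      exact h10' _ (by unfold childIdx at this; omega)
    · intro h hh hc
      exact h10' _ (hchild h hh hc)
    · intro h hh hc
      rw [hs₅.2 12 (by decide), hs₄.2 12 (by decide)]
      exact h12 _ hc
    · exact fun h hh => lt_of_mem_nodeSet hh
  refine (run_bfsAll (by unfold Fits; omega) hnet h0 h1
    (fun h hh => h11 h (lt_of_mem_nodeSet hh))).mono ?_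
  rintro s₆ t₆ ⟨hT, ht₆⟩
  refine ⟨fun u v => (hT u u.2).correct v, L, hL', ?_⟩
  have hcard : #(segNet M hn L hL).nodes ≤ 4 * 2 ^ L + 8 * M.numPairs * (L + 1) :=
    M.card_nodeSet_rowBit_le hn L
  -- Here `n + 1 ≤ 2 * n`, and `4 * 2 ^ L ≤ 8 * n` by the choice of `L`.
  have e1 : (n + 1) * (300 * (n + #(segNet M hn L hL).nodes) + 200) ≤
      (2 * n) * (300 * (n + (8 * n + 8 * M.numPairs * (L + 1))) + 200) :=
    Nat.mul_le_mul (by omega) (by omega)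
  have e2 : (2 * n) * (300 * (n + (8 * n + 8 * M.numPairs * (L + 1))) + 200) =
      5400 * (n * n) + 4800 * (n * (M.numPairs * (L + 1))) + 400 * n := by ring
  simp only [Expr.cost]
  omega

end WordRAM

end

noncomputable section

/-! ### The adjacency matrix -/

namespace AdjLists

variable {n : ℕ} {G : SimpleGraph (Fin n)} (L : AdjLists G)

/-- The total length of the adjacency lists of the vertices below `i`. -/
def offset (i : ℕ) : ℕ := ∑ u : Fin n, if (u : ℕ) < i then (L.nbrs u).length else 0

/-- The `i`-th entry of the concatenation of the adjacency lists. -/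
def entry (i : ℕ) : ℕ := (((List.finRange n).flatMap L.nbrs).map Fin.val).getD i 0

theorem length_nbrs_le (u : Fin n) : (L.nbrs u).length ≤ n := by
  simpa using (L.nodup u).length_le_card

theorem offset_le (i : ℕ) : L.offset i ≤ n * n := by
  refine (Finset.sum_le_card_nsmul _ _ n fun u _ => ?_).trans (by simp)
  split_ifs
  · exact L.length_nbrs_le u
  · exact Nat.zero_le _

theorem offset_succ (u : Fin n) : L.offset (u + 1) = L.offset u + (L.nbrs u).length := by
  have h : ∀ x : Fin n, (if (x : ℕ) < u + 1 then (L.nbrs x).length else 0) =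
      (if (x : ℕ) < u then (L.nbrs x).length else 0) +
        if x = u then (L.nbrs x).length else 0 := by
    intro x
    rcases lt_trichotomy (x : ℕ) u with h | h | h
    · simp [h, Nat.lt_succ_of_lt h, Fin.ext_iff, h.ne]
    · simp [h, Fin.ext_iff]
    · simp [h.not_gt, Fin.ext_iff, h.ne', show ¬ (x : ℕ) < u + 1 by omega]
  rw [offset, Finset.sum_congr rfl fun x _ => h x, Finset.sum_add_distrib]
  simp [offset]

/-- The default `0` past the end is a vertex number as well. The matrix program reads beyond the
lists and still addresses a cell of the matrix. -/
theorem entry_lt (hn : 0 < n) (i : ℕ) : L.entry i < n := by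
  rw [entry, List.getD_eq_getElem?_getD, List.getElem?_map]
  cases ((List.finRange n).flatMap L.nbrs)[i]? with
  | none => simpa
  | some x => simp

theorem entry_offset_add {u : Fin n} {d : ℕ} (hd : d < (L.nbrs u).length) :
    L.entry (L.offset u + d) = (L.nbrs u)[d] := by
  have hu : (u : ℕ) < (List.finRange n).length := by simp
  have hl : ((List.finRange n).take u).flatMap L.nbrs ++
      (L.nbrs u ++ ((List.finRange n).drop (u + 1)).flatMap L.nbrs) =
      (List.finRange n).flatMap L.nbrs := by
    conv_rhs => rw [← List.take_append_drop u (List.finRange n), List.flatMap_append,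
      List.drop_eq_getElem_cons hu, List.flatMap_cons]
    simp
  have ho : (((List.finRange n).take u).flatMap L.nbrs).length = L.offset u := by
    have h1 : ((List.finRange n).take u).map (fun x => (L.nbrs x).length) =
        ((List.finRange n).take u).map
          (fun x : Fin n => if (x : ℕ) < u then (L.nbrs x).length else 0) := by
      refine List.map_congr_left fun x hx => ?_
      obtain ⟨i, hi, rfl⟩ := List.getElem_of_mem hx
      simp at hi ⊢
      omega
    have h2 : (((List.finRange n).drop u).map
        (fun x : Fin n => if (x : ℕ) < u then (L.nbrs x).length else 0)).sum = 0 := by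
      refine List.sum_eq_zero fun y hy => ?_
      obtain ⟨x, hx, rfl⟩ := List.mem_map.1 hy
      obtain ⟨i, hi, rfl⟩ := List.getElem_of_mem hx
      simp
    rw [List.length_flatMap, h1, offset, Fin.sum_univ_def]
    conv_rhs => rw [← List.take_append_drop u (List.finRange n), List.map_append,
      List.sum_append, h2]
    simp
  rw [entry, ← hl, List.getD_eq_getElem?_getD, List.getElem?_map, ← ho,
    List.getElem?_append_right (by omega), Nat.add_sub_cancel_left, List.getElem?_append_left hd,
    List.getElem?_eq_getElem hd]
  rfl

end AdjLists

namespace WordRAM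

open WordRAM.Expr Prog BinOp Finset

/-- The row of the current entry. -/
def rowExpr (B : ℕ) : Expr := op div (var (B + 1)) (var 0)

/-- The current position in the concatenation of the adjacency lists. -/
def listExpr (B : ℕ) : Expr :=
  op add (get 0 (rowExpr B)) (op mod (var (B + 1)) (var 0))

/-- The scalar `B` gets the number of vertices, and the array `B` the adjacency matrix. -/
def matrixProg (B : ℕ) : Prog :=
  seq (assign B (var 0))
    (scatter (B + 1) (B + 2) B (op mul (var 0) (var 0))
      (op add (op mul (rowExpr B) (var 0)) (get 1 (listExpr B)))
      (op lt (listExpr B) (get 0 (op add (rowExpr B) (const 1)))))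

/-- For every vertex, `n` consecutive list entries are tried; an entry beyond the vertex's own list
contributes `0`. Only names from `B` on are changed, which leaves the input intact for the program
that follows. -/
theorem run_matrixProg {n w B : ℕ} {G : SimpleGraph (Fin n)} (L : AdjLists G)
    {ω : ℕ → Fin (2 ^ w)} (hw : Roomy n w) (hn : 0 < n) (hB : 2 ≤ B) :
    Run w ω (matrixProg B) L.init fun s t => AgreeBelow B L.init s ∧ s.var B = n ∧
      (∀ u v : Fin n, G.Adj u v → s.arr B (u * n + v) = 1) ∧
      (∀ u v : Fin n, ¬ G.Adj u v → s.arr B (u * n + v) = 0) ∧ t ≤ 200 * (n * n) := by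
  have b4 := hw.bound
  have : NeZero n := ⟨hn.ne'⟩
  obtain ⟨b5, b6⟩ := le_sq (n := n)
  have hv0 : ∀ s', SameExcept (B + 1) (B + 2) B (L.init.setVar B n) s' → s'.var 0 = n := by
    intro s' hs
    rw [hs.1 0 (by omega) (by omega), State.setVar_var, if_neg (by omega)]
    rfl
  have ha0 : ∀ s', SameExcept (B + 1) (B + 2) B (L.init.setVar B n) s' → ∀ i ≤ n,
      s'.arr 0 i = L.offset i := by
    intro s' hs i hi
    rw [hs.2.1 0 (by omega)]
    simp [AdjLists.init, AdjLists.offset, hi]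
  have ha1 : ∀ s', SameExcept (B + 1) (B + 2) B (L.init.setVar B n) s' → ∀ i,
      s'.arr 1 i = L.entry i := by
    intro s' hs i
    rw [hs.2.1 1 (by omega)]
    simp [AdjLists.init, AdjLists.entry]
  have hi0 : ∀ i, (L.init.setVar B n).arr B i = 0 := by
    intro i
    simp [AdjLists.init, show B ≠ 0 by omega, show B ≠ 1 by omega]
  set l : ℕ → ℕ := fun k => k / n * n + L.entry (L.offset (k / n) + k % n) with hl
  set f : ℕ → ℕ := fun k => if L.offset (k / n) + k % n < L.offset (k / n + 1) then 1 else 0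
    with hf
  have hf1 : ∀ k, f k ≤ 1 := fun k => by simp only [hf]; split_ifs <;> omega
  refine Run.seq (Run.assign (v := n) rfl ?_)
  refine (Run.scatter (by omega) (n * n) l f
    (eval_mul (eval_var (hv0 _ ⟨fun _ _ _ => rfl, fun _ _ => rfl, rfl⟩))
      (eval_var (hv0 _ ⟨fun _ _ _ => rfl, fun _ _ => rfl, rfl⟩)) (by omega)) (by omega)
    ?_ ?_).mono ?_
  · intro k hk s' hs hI
    have hu : k / n < n := Nat.div_lt_of_lt_mul hk
    have hd : k % n < n := Nat.mod_lt _ hn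
    have hrow := row_lt hu (L.entry_lt hn (L.offset (k / n) + k % n))
    have ho := L.offset_le (k / n)
    have e1 : (rowExpr B).eval w s' = k / n :=
      eval_div (eval_var hI) (eval_var (hv0 s' hs))
    have e2 : (listExpr B).eval w s' = L.offset (k / n) + k % n :=
      eval_add (eval_get e1 (ha0 s' hs _ hu.le)) (eval_mod (eval_var hI) (eval_var (hv0 s' hs)))
        (by omega)
    exact ⟨eval_add (eval_mul e1 (eval_var (hv0 s' hs)) (by omega))
      (eval_get e2 (ha1 s' hs _)) (by omega),
      eval_lt e2 (eval_get (eval_add e1 (eval_const (by omega)) (by omega)) (ha0 s' hs _ hu))⟩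
  · intro k _
    have h1 : ∑ j ∈ range (n * n) with l j = l k, f j ≤ n * n :=
      (sum_le_card_nsmul _ _ 1 fun j _ => hf1 j).trans
        (by simpa using card_filter_le (range (n * n)) (fun j => l j = l k))
    rw [hi0]
    omega
  rintro s t ⟨hs, hA, ht⟩
  have key : ∀ u v : Fin n, ∀ j < n * n, l j = u * n + v → f j ≠ 0 →
      ∃ d, ∃ hd : d < (L.nbrs u).length, (L.nbrs u)[d] = v ∧ j = u * n + d := by
    intro u v j hj hlj hfj
    have hu : j / n < n := Nat.div_lt_of_lt_mul hj
    simp only [hf, ne_eq, ite_eq_right_iff, one_ne_zero, imp_false, not_not] at hfj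
    have h1 := L.offset_succ ⟨j / n, hu⟩
    simp only at h1
    have hd : j % n < (L.nbrs ⟨j / n, hu⟩).length := by omega
    have h2 := L.entry_offset_add hd
    simp only at h2
    simp only [hl, h2] at hlj
    have h3 : j / n = u := by
      have := congrArg (· / n) hlj
      simpa [mul_comm _ n, Nat.mul_add_div hn, Nat.div_eq_of_lt] using this
    have h4 : (⟨j / n, hu⟩ : Fin n) = u := Fin.ext h3
    subst h4
    refine ⟨j % n, hd, Fin.ext (by simp only at hlj; omega), (Nat.div_add_mod' j n).symm⟩
  refine ⟨⟨?_, ?_, hs.2.2.symm⟩, ?_, ?_, ?_, ?_⟩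
  · intro x hx
    rw [hs.1 x (by omega) (by omega), State.setVar_var, if_neg (by omega)]
  · intro a ha
    rw [hs.2.1 a (by omega)]
    rfl
  · rw [hs.1 B (by omega) (by omega)]
    simp
  · intro u v huv
    rw [hA, hi0, zero_add]
    obtain ⟨d, hd, hdv⟩ := List.getElem_of_mem ((L.mem_nbrs u v).2 huv)
    have hdn := hd.trans_le (L.length_nbrs_le u)
    have hdiv : (u * n + d : ℕ) / n = u := by
      rw [mul_comm, Nat.mul_add_div hn, Nat.div_eq_of_lt hdn, add_zero]
    have hmod : (u * n + d : ℕ) % n = d := by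
      rw [mul_comm, Nat.mul_add_mod, Nat.mod_eq_of_lt hdn]
    -- Adjacency lists have no duplicates, so exactly one index contributes and the matrix entry is
    -- `1`.
    rw [sum_eq_single (u * n + d : ℕ)]
    · simp only [hf, hdiv, hmod, L.offset_succ u]
      exact if_pos (by omega)
    · intro j hj hne
      rw [mem_filter, mem_range] at hj
      by_contra hcon
      obtain ⟨d', hd', h1, h2⟩ := key u v j hj.1 hj.2 hcon
      rw [← hdv, (L.nodup u).getElem_inj_iff] at h1
      exact hne (by rw [h2, h1])
    · intro hcon
      refine absurd (mem_filter.2 ⟨mem_range.2 (row_lt u.2 hdn), ?_⟩) hcon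
      simp only [hl, hdiv, hmod, L.entry_offset_add hd, hdv]
  · intro u v huv
    rw [hA, hi0, zero_add]
    refine sum_eq_zero fun j hj => ?_
    rw [mem_filter, mem_range] at hj
    by_contra hcon
    obtain ⟨d, hd, h1, -⟩ := key u v j hj.1 hj.2 hcon
    exact huv ((L.mem_nbrs u v).1 (h1 ▸ List.getElem_mem hd))
  · simp only [Expr.cost, rowExpr, listExpr] at ht ⊢
    omega

end WordRAM

end

/-! ### The reduction, for deterministic and randomized algorithms -/

noncomputable section

open WordRAM

namespace WordRAM

theorem Exec.pos {w : ℕ} {ω : ℕ → Fin (2 ^ w)} {P : Prog} {s : State} {t : ℕ} {s' : State}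
    (h : Exec w ω P s t s') : 0 < t := by
  induction h <;> omega

theorem one_le_runTime (w : ℕ) (ω : ℕ → Fin (2 ^ w)) (P : Prog) (s : State) :
    1 ≤ runTime w ω P s :=
  le_iInf₂ fun _ ⟨_, h⟩ => by exact_mod_cast h.pos

instance (w : ℕ) : MeasureTheory.IsProbabilityMeasure (randomWords w) := by
  unfold randomWords
  infer_instance

/-- Ten factors `n + 2 ≥ 2` absorb the constant `729 ≤ 2 ^ 10`, and two more give the square. -/
theorem roomy_of_pow_le {n k w : ℕ} (h : (n + 2) ^ max k 12 ≤ 2 ^ w) : Roomy n w :=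
  calc 729 * ((n + 2) * (n + 2)) ≤ (n + 2) ^ 10 * ((n + 2) * (n + 2)) :=
        Nat.mul_le_mul_right _ ((by norm_num : 729 ≤ 2 ^ 10).trans
          (Nat.pow_le_pow_left (by omega) 10))
    _ = (n + 2) ^ 12 := by ring
    _ ≤ (n + 2) ^ max k 12 := Nat.pow_le_pow_right (by omega) (le_max_right _ _)
    _ ≤ 2 ^ w := h

theorem pow_le_of_pow_max_le {n k l m : ℕ} (h : (n + 2) ^ max k l ≤ m) : (n + 2) ^ k ≤ m :=
  (Nat.pow_le_pow_right (by omega) (le_max_left _ _)).trans h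

/-- All-Pairs Shortest Path by means of the program `P` for signed tree models. -/
def apspProg (P : Prog) : Prog :=
  .seq (matrixProg (max 100 P.bound)) (.seq P (modelApsp (max 100 P.bound)))

theorem apspProg_deterministic {P : Prog} (h : P.Deterministic) : (apspProg P).Deterministic := by
  simp [apspProg, matrixProg, modelApsp, orderProg, iterProg, weightProg, sibProg, posProg, ordProg,
    sizeProg, cellProg, tableProg, clearProg, bfsAll, bfsFrom, bfsLoop, bfsDequeue, bfsPop,
    bfsVisit, bfsExpand, tab, scatter, forLoop, Prog.Deterministic, h]

end WordRAM

/-- For `n = 1` the logarithm vanishes and cannot pay for the pairs, so an absolute bound is needed: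
at most two nodes have at most three unordered pairs. -/
theorem SignedTreeModel.numPairs_le_three {N : ℕ} (M : SignedTreeModel (Fin N) (Fin 1)) :
    M.numPairs ≤ 3 := by
  have hN : N ≤ 2 := M.card_nodes_le
  rw [numPairs, ← Finset.card_union_of_disjoint M.disjoint]
  refine (Finset.card_le_univ _).trans ?_
  rw [Sym2.card, Fintype.card_fin]
  interval_cases N <;> decide

theorem mul_logb_nonneg {n : ℕ} (q : ℕ) (hn : 0 < n) : (0 : ℝ) ≤ n * q * Real.logb 2 n := by
  have : 0 ≤ Real.logb 2 n := Real.logb_nonneg (by norm_num) (by exact_mod_cast hn)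
  positivity

/-- The additive term in the running time of the reduction. -/
theorem SignedTreeModel.pairs_mul_log_le {n N q L : ℕ} (M : SignedTreeModel (Fin N) (Fin n))
    (hn : 0 < n) (hq : M.numPairs ≤ q) (hL : 2 ^ L < 2 * n) :
    ((n * (M.numPairs * (L + 1)) : ℕ) : ℝ) ≤ 3 * (n * n) + 3 * (n * q * Real.logb 2 n) := by
  have hlog : 0 ≤ Real.logb 2 n := Real.logb_nonneg (by norm_num) (by exact_mod_cast hn)
  obtain rfl | hn2 : n = 1 ∨ 2 ≤ n := by omega
  · have hL0 : L = 0 := by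
      by_contra h
      have := Nat.pow_le_pow_right (n := 2) (by norm_num) (Nat.one_le_iff_ne_zero.2 h)
      omega
    subst hL0
    have : (M.numPairs : ℝ) ≤ 3 := by exact_mod_cast M.numPairs_le_three
    simpa using this
  · have h1 : (1 : ℝ) ≤ Real.logb 2 n := by
      rw [Real.le_logb_iff_rpow_le (by norm_num) (by positivity)]
      simpa using (by exact_mod_cast hn2 : (2 : ℝ) ≤ n)
    have h2 : (L : ℝ) ≤ 1 + Real.logb 2 n := by
      have h3 : (1 : ℝ) + Real.logb 2 n = Real.logb 2 (2 * n) := by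
        rw [Real.logb_mul (by norm_num) (by positivity), Real.logb_self_eq_one (by norm_num)]
      rw [h3, Real.le_logb_iff_rpow_le (by norm_num) (by positivity), Real.rpow_natCast]
      exact_mod_cast hL.le
    -- `L + 1 ≤ 2 + log₂ n`, and `log₂ n ≥ 1` as `n ≥ 2`.
    have h4 : (L : ℝ) + 1 ≤ 3 * Real.logb 2 n := by linarith
    have h5 : (M.numPairs : ℝ) ≤ q := by exact_mod_cast hq
    push_cast
    calc (n : ℝ) * (M.numPairs * (L + 1)) ≤ n * (q * (3 * Real.logb 2 n)) := by gcongr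
      _ = 3 * (n * q * Real.logb 2 n) := by ring
      _ ≤ _ := le_add_of_nonneg_left (by positivity)

/-- `Exec.frame` moves the run of `P` to a memory that also holds the matrix, with the same steps
and random words. Neither the model nor the matrix is damaged, since they live below and above the
bound on the names of `P`. The overhead is the same for all `ω`. -/
theorem exec_apspProg {P : Prog} {p : ℕ → ℕ} {n w t : ℕ} {G : SimpleGraph (Fin n)} {L : AdjLists G}
    {ω : ℕ → Fin (2 ^ w)} {s : State} (hn : 0 < n) (hw : Roomy n w)
    (h : Exec w ω P L.init t s) (hs : TreeModelProblem p n G s) :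
    ∃ t' s', Exec w ω (apspProg P) L.init t' s' ∧ APSP n G s' ∧
      (t' : ℝ) ≤ t + 60000 * (n ^ 2 + n * p n * Real.logb 2 n) := by
  obtain ⟨N, M, rfl, hp, hM⟩ := hs
  set B := max 100 P.bound with hB
  have hB100 : 100 ≤ B := le_max_left _ _
  obtain ⟨t₁, s₁, e₁, hag, hBn, hadj, hnadj, ht₁⟩ :=
    run_matrixProg L (ω := ω) hw hn (B := B) (by omega)
  obtain ⟨s₂, e₂, hbel, habv⟩ := h.frame (le_max_right _ _ : P.bound ≤ B) hag
  have HM : HoldsModel s₂ M := by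
    have ha : ∀ a < 100, s₂.arr a = s.arr a := fun a ha => (hbel.2.1 a (by omega)).symm
    have hv : ∀ a < 100, s₂.var a = s.var a := fun a ha => (hbel.1 a (by omega)).symm
    refine ⟨?_, ?_, ?_, ?_, ?_, ?_, ?_⟩
    · rw [hv 0 (by omega)]; exact hM.num_nodes
    · rw [hv 1 (by omega)]; exact hM.root
    · rw [hv 2 (by omega)]; exact hM.num_pairs
    · rw [ha 0 (by omega)]; exact hM.parent
    · rw [ha 1 (by omega)]; exact hM.leaf
    · rw [ha 2 (by omega), ha 3 (by omega), ha 4 (by omega)]; exact hM.listed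
    · rw [ha 2 (by omega), ha 3 (by omega)]; exact hM.complete
  have HI : HoldsInput M B s₂ := by
    refine ⟨HM, ?_, ?_, ?_⟩
    · rw [← habv.1 B le_rfl]; exact hBn
    · rw [← habv.2 B le_rfl]; exact hadj
    · rw [← habv.2 B le_rfl]; exact hnadj
  obtain ⟨t₃, s₃, e₃, hA, L', hL', ht₃⟩ := run_modelApsp (ω := ω) hw hn hB100 HI
  refine ⟨_, s₃, .seq e₁ (.seq e₂ e₃), hA, ?_⟩
  have h1 := M.pairs_mul_log_le hn hp hL'
  have h2 : (t₁ : ℝ) ≤ 200 * (n * n) := by exact_mod_cast ht₁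
  have h3 : (t₃ : ℝ) ≤ 25000 * (n * n) + 10000 * (n * (M.numPairs * (L' + 1)) : ℕ) := by
    exact_mod_cast ht₃
  have h4 := mul_logb_nonneg (p n) hn
  push_cast at h3 ⊢
  push_cast at h1
  -- The coefficients are `200 + 25000 + 3 * 10000` for `n ^ 2` and `3 * 10000` for the logarithmic
  -- term.
  nlinarith [mul_self_nonneg (n : ℝ)]

/-- The size of the output is absorbed by the time bound. -/
theorem add_time_le {t T X m : ℝ} {c d : ℕ} (ht : 0 < t) (htT : t ≤ c * T) (hX : 0 ≤ X)
    (hm : m ≤ d * (T + X)) :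
    t + 60000 * (m + X) ≤ (c + 60000 * d + 60000 : ℕ) * (T + X) := by
  -- Nonnegativity of the time bound is not assumed; it follows because `t` is positive.
  have hT : 0 < T := pos_of_mul_pos_right (ht.trans_le htT) (Nat.cast_nonneg c)
  have hc : (0 : ℝ) ≤ c * X := by positivity
  push_cast
  linarith

section

variable {𝒞 : GraphClass} {p : ℕ → ℕ} {T : ℕ → ℕ → ℝ} {d : ℕ} {P : Prog}

theorem SolvesDet.apsp (h : SolvesDet 𝒞 (TreeModelProblem p) T P)
    (hd : ∀ n, 0 < n → ∀ G : SimpleGraph (Fin n), 𝒞 n G →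
      (n : ℝ) ^ 2 ≤ d * (T n (numEdges G) + n * p n * Real.logb 2 n)) :
    SolvesDet 𝒞 APSP (fun n m => T n m + n * p n * Real.logb 2 n) (apspProg P) := by
  obtain ⟨hdet, k, c, hP⟩ := h
  refine ⟨apspProg_deterministic hdet, max k 12, c + 60000 * d + 60000, ?_⟩
  intro n hn G hG L w hw ω
  obtain ⟨t, s, e, hs, ht⟩ := hP n hn G hG L w (pow_le_of_pow_max_le hw) ω
  obtain ⟨t', s', e', hs', ht'⟩ := exec_apspProg hn (roomy_of_pow_le hw) e hs
  exact ⟨t', s', e', hs', ht'.trans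
    (add_time_le (by exact_mod_cast e.pos) ht (mul_logb_nonneg (p n) hn) (hd n hn G hG))⟩

/-- Each failure event of the composed program is contained in the corresponding one of `P`, so
monotonicity alone transfers both probabilities; measurability of the events plays no role. -/
theorem SolvesRand.apsp {δ ε : ℕ → ℝ≥0∞} (h : SolvesRand 𝒞 (TreeModelProblem p) T δ ε P)
    (hd : ∀ n, 0 < n → ∀ G : SimpleGraph (Fin n), 𝒞 n G →
      (n : ℝ) ^ 2 ≤ d * (T n (numEdges G) + n * p n * Real.logb 2 n)) :
    SolvesRand 𝒞 APSP (fun n m => T n m + n * p n * Real.logb 2 n) δ ε (apspProg P) := by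
  obtain ⟨k, c, hP⟩ := h
  refine ⟨max k 12, c + 60000 * d + 60000, ?_⟩
  intro n hn G hG L w hw
  obtain ⟨h1, h2⟩ := hP n hn G hG L w (pow_le_of_pow_max_le hw)
  constructor
  · refine (MeasureTheory.measure_mono ?_).trans h1
    rintro ω hω ⟨t, s, e, hs, ht⟩
    obtain ⟨t', s', e', hs', ht'⟩ := exec_apspProg hn (roomy_of_pow_le hw) e hs
    exact hω ⟨t', s', e', hs', ht'.trans
      (add_time_le (by exact_mod_cast e.pos) ht (mul_logb_nonneg (p n) hn) (hd n hn G hG))⟩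
  · refine (MeasureTheory.measure_mono ?_).trans h2
    rintro ω hω ⟨t, s, e, hs⟩
    obtain ⟨t', s', e', hs', -⟩ := exec_apspProg hn (roomy_of_pow_le hw) e hs
    exact hω ⟨t', s', e', hs'⟩

/-- Almost surely the running times differ by at most a constant `K`, and constants are measurable,
so the integral splits whether or not the running time is measurable. -/
theorem SolvesExpected.apsp (h : SolvesExpected 𝒞 (TreeModelProblem p) T P)
    (hd : ∀ n, 0 < n → ∀ G : SimpleGraph (Fin n), 𝒞 n G →
      (n : ℝ) ^ 2 ≤ d * (T n (numEdges G) + n * p n * Real.logb 2 n)) :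
    SolvesExpected 𝒞 APSP (fun n m => T n m + n * p n * Real.logb 2 n) (apspProg P) := by
  obtain ⟨k, c, hP⟩ := h
  refine ⟨max k 12, c + 60000 * d + 60000, ?_⟩
  intro n hn G hG L w hw
  obtain ⟨h1, h2⟩ := hP n hn G hG L w (pow_le_of_pow_max_le hw)
  refine ⟨h1.mono fun ω ⟨t, s, e, hs⟩ => ?_, ?_⟩
  · obtain ⟨t', s', e', hs', -⟩ := exec_apspProg hn (roomy_of_pow_le hw) e hs
    exact ⟨t', s', e', hs'⟩
  have h3 : (1 : ℝ≥0∞) ≤ ENNReal.ofReal (c * T n (numEdges G)) := by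
    refine le_trans ?_ h2
    calc (1 : ℝ≥0∞) = ∫⁻ _, 1 ∂(randomWords w) := by simp
      _ ≤ _ := MeasureTheory.lintegral_mono fun ω => one_le_runTime w ω P L.init
  have h4 : 0 < c * T n (numEdges G) := by
    by_contra hcon
    rw [ENNReal.ofReal_eq_zero.2 (not_lt.1 hcon)] at h3
    simp at h3
  set K : ℝ := 60000 * (n ^ 2 + n * p n * Real.logb 2 n) with hK
  have hK0 : 0 ≤ K := by have := mul_logb_nonneg (p n) hn; positivity
  calc ∫⁻ ω, runTime w ω (apspProg P) L.init ∂(randomWords w)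
      ≤ ∫⁻ ω, (runTime w ω P L.init + ENNReal.ofReal K) ∂(randomWords w) := by
        refine MeasureTheory.lintegral_mono_ae (h1.mono fun ω ⟨t, s, e, hs⟩ => ?_)
        obtain ⟨t', s', e', -, ht'⟩ := exec_apspProg hn (roomy_of_pow_le hw) e hs
        rw [runTime_eq e, runTime_eq e', ← ENNReal.ofReal_natCast t, ← ENNReal.ofReal_natCast t',
          ← ENNReal.ofReal_add (Nat.cast_nonneg t) hK0]
        exact ENNReal.ofReal_le_ofReal ht'
    _ = ∫⁻ ω, runTime w ω P L.init ∂(randomWords w) + ENNReal.ofReal K := by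
        rw [MeasureTheory.lintegral_add_right _ measurable_const]
        simp
    _ ≤ ENNReal.ofReal (c * T n (numEdges G)) + ENNReal.ofReal K := by gcongr
    _ = ENNReal.ofReal (c * T n (numEdges G) + K) := (ENNReal.ofReal_add h4.le hK0).symm
    _ ≤ _ := ENNReal.ofReal_le_ofReal
        (add_time_le h4 le_rfl (mul_logb_nonneg (p n) hn) (hd n hn G hG))

end

end

theorem corollary3 (𝒞 : GraphClass) (p : ℕ → ℕ) (T : ℕ → ℕ → ℝ)
    (hsize : ∃ c : ℕ, ∀ n, 0 < n → ∀ G : SimpleGraph (Fin n), 𝒞 n G →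
      (n : ℝ) ^ 2 ≤ c * (T n (numEdges G) + n * p n * Real.logb 2 n)) :
    ((∃ P, SolvesDet 𝒞 (TreeModelProblem p) T P) →
      ∃ Q, SolvesDet 𝒞 APSP (fun n m => T n m + n * p n * Real.logb 2 n) Q) ∧
    (∀ δ ε : ℕ → ENNReal, (∃ P, SolvesRand 𝒞 (TreeModelProblem p) T δ ε P) →
      ∃ Q, SolvesRand 𝒞 APSP (fun n m => T n m + n * p n * Real.logb 2 n) δ ε Q) ∧
    ((∃ P, SolvesExpected 𝒞 (TreeModelProblem p) T P) →
      ∃ Q, SolvesExpected 𝒞 APSP (fun n m => T n m + n * p n * Real.logb 2 n) Q) := by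
  obtain ⟨d, hd⟩ := hsize
  exact ⟨fun ⟨_, h⟩ => ⟨_, h.apsp hd⟩, fun _ _ ⟨_, h⟩ => ⟨_, h.apsp hd⟩,
    fun ⟨_, h⟩ => ⟨_, h.apsp hd⟩⟩
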